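/- All manifolds are smooth, finite-dimensional, Hausdorff and second countable; all vector bundles are real, smooth and of finite constant rank; $\Gamma E$ denotes the smooth sections of $E$. Let $A\to M$ and $B\to N$ be Lie algebroids, with anchors $\rho_A,\rho_B$, and let $(\Phi,\phi)$ be a Lie algebroid morphism from $A$ to $B$, i.e. a smooth vector bundle map $\Phi:A\to B$ over $\phi:M\to N$ such that the induced pull-back $\Gamma(\wedge^\bullet B^*)\to\Gamma(\wedge^\bullet A^*)$ commutes with the Lie algebroid differentials $d_B,d_A$. A *connection* of $A$ on a vector bundle $E\to M$ is an $\mathbb R$-bilinear map $D:\Gamma A\times\Gamma E\to\Gamma E$ with $D(fa)x=fD(a)x$ and $D(a)(fx)=fD(a)x+(\rho_A(a)f)\,x$ for $f\in C^\infty(M)$; it is a *representation* if moreover $D(a_1)D(a_2)x-D(a_2)D(a_1)x=D([a_1,a_2])x$. For a representation $D$ of $A$ on a line bundle $L\to M$ with a nowhere-vanishing section $\lambda$, $\operatorname{char}D\in H^1(A)$ is the class of the section $\alpha$ of $A^*$ given by $\langle\alpha,a\rangle\lambda=D(a)\lambda$; if $L$ has no nowhere-vanishing section, $\operatorname{char}D$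 is one half of the class obtained in this way from $D\otimes D$ on $L\otimes L$. Let $L^A=\wedge^{\rm top}A\otimes\wedge^{\rm top}T^*M$, and let $D^A$ be the connection on $L^A$ with $$D^A_a(\omega\otimes\mu)=[a,\omega]\otimes\mu+\omega\otimes\mathcal L_{\rho_A(a)}\mu,\qquad [a,x_1\wedge\dots\wedge x_r]=\sum_i x_1\wedge\dots\wedge[a,x_i]\wedge\dots\wedge x_r .$$ Put $\operatorname{Mod}A=\operatorname{char}D^A$; define $L^B$, $D^B$, $\operatorname{Mod}B$ likewise, and let $\operatorname{Mod}\Phi=\operatorname{Mod}A-\tilde\Phi^*(\operatorname{Mod}B)$, where $\tilde\Phi^*:H^1(B)\to H^1(A)$ is induced by $\Phi$. Let $(D^B)^*$ be the dual of $D^B$ on $(L^B)^*$, i.e. $\langle (D^B)^*(b)\xi,x\rangle=-\langle\xi,D^B(b)x\rangle+\rho_B(b)\langle\xi,x\rangle$. Let $\Phi^!((D^B)^*)$ be its pull-back, the connection of $A$ on $\phi^!((L^B)^*)$ such that, for all $a\in\Gamma A$, $b\in\Gamma B$, $y\in\Gamma((L^B)^*)$ and $m\in M$ with $\Phi(a(m))=b(\phi(m))$,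 one has $(a\cdot\phi^!y)(m)=(b\cdot y)(\phi(m))$, where $\phi^!y=y\circ\phi$. Let $D^\Phi=D^A\otimes\Phi^!((D^B)^*)$ be the tensor product connection, the connection with $D^\Phi(a)(x\otimes y)=D^A(a)x\otimes y+x\otimes\Phi^!((D^B)^*)(a)y$. **Theorem.** The operators $D^A$, $D^B$, $(D^B)^*$, $\Phi^!((D^B)^*)$ and $D^\Phi$ exist and are uniquely determined by these properties, and: (i) $L^\phi=L^A\otimes\phi^!((L^B)^*)$ is a line bundle on $M$ and $D^\Phi$ is a representation of $A$ on it. (ii) The characteristic classes of $D^A$, $D^B$ and $D^\Phi$ are well defined (each exists and is unique), and $\operatorname{Mod}\Phi=\operatorname{char}D^\Phi$. -/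

import Mathlib

open Bundle Filter
open scoped Manifold ContDiff Topology TensorProduct

noncomputable section

namespace LieAlgd

universe u v w w'

/-! ### Families of vector spaces with their smooth sections

The bundles derived from a Lie algebroid (tensor products, duals, exterior powers, pull-backs) are
presented by their fibres together with the space of their smooth global sections.  Such a family is
a smooth vector bundle of rank `k` when it satisfies `SmoothFamily.IsVectorBundle k` below. -/

section Families

variable {E : Type*} [NormedAddCommGroup E] [NormedSpace ℝ E]
  {M : Type*} [TopologicalSpace M] [ChartedSpace E M]

/-- A family of real vector spaces over the manifold `M`, with its `C^∞(M)`-module of smooth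
sections. -/
structure SmoothFamily (E : Type*) [NormedAddCommGroup E] [NormedSpace ℝ E]
    (M : Type*) [TopologicalSpace M] [ChartedSpace E M] where
  Fib : M → Type w
  [grp : ∀ m, AddCommGroup (Fib m)]
  [mod : ∀ m, Module ℝ (Fib m)]
  smooth : Submodule ℝ (∀ m, Fib m)
  smul_mem' : ∀ (f : C^∞⟮𝓘(ℝ, E), M; ℝ⟯) (s : ∀ m, Fib m), s ∈ smooth →
    (fun m => f m • s m) ∈ smooth

attribute [instance] SmoothFamily.grp SmoothFamily.mod

/-- The space `Γ V` of smooth global sections. -/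
def SmoothFamily.Γ (V : SmoothFamily.{w} E M) : Type _ := V.smooth

instance (V : SmoothFamily.{w} E M) : AddCommGroup V.Γ := inferInstanceAs (AddCommGroup V.smooth)

instance (V : SmoothFamily.{w} E M) : Module ℝ V.Γ := inferInstanceAs (Module ℝ V.smooth)

/-- Multiplication of a smooth section by a smooth function. -/
def SmoothFamily.fsmul {V : SmoothFamily.{w} E M} (f : C^∞⟮𝓘(ℝ, E), M; ℝ⟯) (s : V.Γ) : V.Γ :=
  ⟨fun m => f m • s.1 m, V.smul_mem' f s.1 s.2⟩

/-- `V` is a smooth vector bundle of rank `k`: smoothness of a section is a local property, and near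
every point there is a smooth frame of `k` sections, in which smooth sections have smooth
coefficients. -/
def SmoothFamily.IsVectorBundle (k : ℕ) (V : SmoothFamily.{w} E M) : Prop :=
  (∀ t : ∀ m, V.Fib m, (∀ m, ∃ t' : V.Γ, ∀ᶠ x in 𝓝 m, t x = t'.1 x) → t ∈ V.smooth) ∧
  ∀ m, ∃ s : Fin k → V.Γ,
    (∀ᶠ x in 𝓝 m, LinearIndependent ℝ (fun i => (s i).1 x) ∧
      Submodule.span ℝ (Set.range fun i => (s i).1 x) = ⊤) ∧
    ∀ t : V.Γ, ∃ f : Fin k → C^∞⟮𝓘(ℝ, E), M; ℝ⟯, ∀ᶠ x in 𝓝 m, t.1 x = ∑ i, f i x • (s i).1 x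

/-- A section is nowhere vanishing. -/
def SmoothFamily.NowhereZero {V : SmoothFamily.{w} E M} (s : V.Γ) : Prop := ∀ m, s.1 m ≠ 0

/-- The sections which, near each point, are finite combinations `∑ fᵢ sᵢ` with `fᵢ` smooth functions
and `sᵢ ∈ S`. -/
def localSpan {X : M → Type w} [∀ m, AddCommGroup (X m)] [∀ m, Module ℝ (X m)]
    (S : Set (∀ m, X m)) : Submodule ℝ (∀ m, X m) where
  carrier := {t | ∀ m, ∃ t' ∈ Submodule.span ℝ
    {r : ∀ m, X m | ∃ f : C^∞⟮𝓘(ℝ, E), M; ℝ⟯, ∃ s ∈ S, r = fun x => f x • s x},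
      ∀ᶠ x in 𝓝 m, t x = t' x}
  add_mem' := by
    intro a b ha hb m
    obtain ⟨a', ha', ha⟩ := ha m
    obtain ⟨b', hb', hb⟩ := hb m
    refine ⟨a' + b', Submodule.add_mem _ ha' hb', ?_⟩
    filter_upwards [ha, hb] with x h1 h2
    simp [h1, h2]
  zero_mem' := fun m => ⟨0, Submodule.zero_mem _, by simp⟩
  smul_mem' := by
    intro c a ha m
    obtain ⟨a', ha', ha⟩ := ha m
    refine ⟨c • a', Submodule.smul_mem _ c ha', ?_⟩
    filter_upwards [ha] with x h1
    simp [h1]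

theorem localSpan_fsmul {X : M → Type w} [∀ m, AddCommGroup (X m)] [∀ m, Module ℝ (X m)]
    (S : Set (∀ m, X m)) (f : C^∞⟮𝓘(ℝ, E), M; ℝ⟯) (s : ∀ m, X m)
    (hs : s ∈ localSpan (E := E) S) : (fun m => f m • s m) ∈ localSpan (E := E) S := by
  intro m
  obtain ⟨t', ht', h⟩ := hs m
  refine ⟨fun x => f x • t' x, ?_, by filter_upwards [h] with x hx; rw [hx]⟩
  clear h hs
  induction ht' using Submodule.span_induction with
  | mem r hr =>
    obtain ⟨g, s, hs, rfl⟩ := hr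
    exact Submodule.subset_span ⟨f * g, s, hs, by funext x; simp [mul_smul]⟩
  | zero => convert Submodule.zero_mem _ using 1; funext x; simp
  | add a b _ _ ha hb => convert Submodule.add_mem _ ha hb using 1; funext x; simp
  | smul c a _ ha =>
    convert Submodule.smul_mem _ c ha using 1; funext x; simp [smul_comm c]

theorem subset_localSpan {X : M → Type w} [∀ m, AddCommGroup (X m)] [∀ m, Module ℝ (X m)]
    {S : Set (∀ m, X m)} {s : ∀ m, X m} (hs : s ∈ S) : s ∈ localSpan (E := E) S := fun _ =>
  ⟨s, Submodule.subset_span ⟨1, s, hs, by funext x; simp⟩, Eventually.of_forall fun _ => rfl⟩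

/-- The dual `V^*`; a section is smooth when its pairing with every smooth section of `V` is. -/
abbrev SmoothFamily.dual (V : SmoothFamily.{w} E M) : SmoothFamily.{w} E M where
  Fib m := Module.Dual ℝ (V.Fib m)
  smooth :=
    { carrier := {ξ | ∀ s : V.Γ, ContMDiff 𝓘(ℝ, E) 𝓘(ℝ, ℝ) ∞ fun m => ξ m (s.1 m)}
      add_mem' := fun ha hb s => (ha s).add (hb s)
      zero_mem' := fun _ => contMDiff_const
      smul_mem' := fun _ _ ha s => contMDiff_const.mul (ha s) }
  smul_mem' f _ hξ s := f.contMDiff.mul (hξ s)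

/-- The bundle `∧^k V^*` of alternating `k`-forms on the fibres of `V`; a form is smooth when its
value on any `k` smooth sections of `V` is a smooth function. -/
abbrev SmoothFamily.alt (k : ℕ) (V : SmoothFamily.{w} E M) : SmoothFamily.{w} E M where
  Fib m := V.Fib m [⋀^Fin k]→ₗ[ℝ] ℝ
  smooth :=
    { carrier := {α | ∀ s : Fin k → V.Γ,
        ContMDiff 𝓘(ℝ, E) 𝓘(ℝ, ℝ) ∞ fun m => α m (fun i => (s i).1 m)}
      add_mem' := fun ha hb s => (ha s).add (hb s)
      zero_mem' := fun _ => contMDiff_const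
      smul_mem' := fun _ _ ha s => contMDiff_const.mul (ha s) }
  smul_mem' f _ hξ s := f.contMDiff.mul (hξ s)

/-- The exterior power `∧^k V`; smooth sections are locally finite sums of `x₁ ∧ … ∧ x_k` with smooth
`xᵢ`. -/
abbrev SmoothFamily.ext (k : ℕ) (V : SmoothFamily.{w} E M) : SmoothFamily.{w} E M where
  Fib m := ⋀[ℝ]^k (V.Fib m)
  smooth := localSpan (E := E)
    {t | ∃ x : Fin k → V.Γ, t = fun m => exteriorPower.ιMulti ℝ k (fun i => (x i).1 m)}
  smul_mem' f s hs := localSpan_fsmul _ f s hs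

/-- The section `x₁ ∧ … ∧ x_k` of `∧^k V`. -/
def SmoothFamily.wedge {k : ℕ} {V : SmoothFamily.{w} E M} (x : Fin k → V.Γ) : (V.ext k).Γ :=
  ⟨fun m => exteriorPower.ιMulti ℝ k (fun i => (x i).1 m), subset_localSpan ⟨x, rfl⟩⟩

/-- The tensor product `V ⊗ W`; smooth sections are locally finite sums of `x ⊗ y` with `x`, `y`
smooth. -/
abbrev SmoothFamily.tensor (V : SmoothFamily.{v} E M) (W : SmoothFamily.{w} E M) :
    SmoothFamily.{max v w} E M where
  Fib m := V.Fib m ⊗[ℝ] W.Fib m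
  smooth := localSpan (E := E) {t | ∃ (x : V.Γ) (y : W.Γ), t = fun m => x.1 m ⊗ₜ[ℝ] y.1 m}
  smul_mem' f s hs := localSpan_fsmul _ f s hs

/-- The section `x ⊗ y` of `V ⊗ W`. -/
def SmoothFamily.tmul {V : SmoothFamily.{v} E M} {W : SmoothFamily.{w} E M} (x : V.Γ) (y : W.Γ) :
    (V.tensor W).Γ :=
  ⟨fun m => x.1 m ⊗ₜ[ℝ] y.1 m, subset_localSpan ⟨x, y, rfl⟩⟩

/-- The derivative `v · f` of a function `f` along a tangent vector `v` at `m`. -/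
def dirDeriv (f : M → ℝ) (m : M) (v : TangentSpace 𝓘(ℝ, E) m) : ℝ :=
  mfderiv 𝓘(ℝ, E) 𝓘(ℝ, ℝ) f m v

end Families

/-- The pull-back `φ^! V` of `V` by a smooth map `φ : M → N`; smooth sections are locally finite sums
`∑ fᵢ (yᵢ ∘ φ)` with `fᵢ ∈ C^∞(M)` and `yᵢ` smooth sections of `V`. -/
abbrev SmoothFamily.pullback {E : Type*} [NormedAddCommGroup E] [NormedSpace ℝ E]
    {M : Type*} [TopologicalSpace M] [ChartedSpace E M]
    {E' : Type*} [NormedAddCommGroup E'] [NormedSpace ℝ E']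
    {N : Type*} [TopologicalSpace N] [ChartedSpace E' N]
    (φ : C^∞⟮𝓘(ℝ, E), M; 𝓘(ℝ, E'), N⟯) (V : SmoothFamily.{w} E' N) : SmoothFamily.{w} E M where
  Fib m := V.Fib (φ m)
  smooth := localSpan (E := E) {t | ∃ y : V.Γ, t = fun m => y.1 (φ m)}
  smul_mem' f s hs := localSpan_fsmul _ f s hs

/-- The section `φ^! y = y ∘ φ` of `φ^! V`. -/
def SmoothFamily.pullSec {E : Type*} [NormedAddCommGroup E] [NormedSpace ℝ E]
    {M : Type*} [TopologicalSpace M] [ChartedSpace E M]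
    {E' : Type*} [NormedAddCommGroup E'] [NormedSpace ℝ E']
    {N : Type*} [TopologicalSpace N] [ChartedSpace E' N]
    (φ : C^∞⟮𝓘(ℝ, E), M; 𝓘(ℝ, E'), N⟯) {V : SmoothFamily.{w} E' N} (y : V.Γ) : (V.pullback φ).Γ :=
  ⟨fun m => y.1 (φ m), subset_localSpan ⟨y, rfl⟩⟩

/-- The family underlying a smooth vector bundle `A → M` with typical fibre `F`. -/
abbrev ofBundle (E : Type*) [NormedAddCommGroup E] [NormedSpace ℝ E]
    (F : Type*) [NormedAddCommGroup F] [NormedSpace ℝ F]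
    {M : Type*} [TopologicalSpace M] [ChartedSpace E M]
    (A : M → Type w) [TopologicalSpace (TotalSpace F A)] [∀ m, AddCommGroup (A m)]
    [∀ m, Module ℝ (A m)] [∀ m, TopologicalSpace (A m)] [FiberBundle F A] [VectorBundle ℝ F A] :
    SmoothFamily.{w} E M where
  Fib := A
  smooth :=
    { carrier := {s | ContMDiff 𝓘(ℝ, E) (𝓘(ℝ, E).prod 𝓘(ℝ, F)) ∞ fun m => TotalSpace.mk' F m (s m)}
      add_mem' := fun ha hb => ContMDiff.add_section ha hb
      zero_mem' := Bundle.contMDiff_zeroSection ℝ A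
      smul_mem' := fun _ _ ha => ContMDiff.const_smul_section ha }
  smul_mem' f _ hs := ContMDiff.smul_section f.contMDiff hs

/-- The tangent bundle `TM`. -/
abbrev tangent (E : Type u) [NormedAddCommGroup E] [NormedSpace ℝ E]
    (M : Type*) [TopologicalSpace M] [ChartedSpace E M] [IsManifold 𝓘(ℝ, E) ∞ M] :
    SmoothFamily.{u} E M :=
  haveI : IsManifold 𝓘(ℝ, E) 1 M := IsManifold.of_le (n := ∞) (by simp)
  ofBundle E E (fun m : M => TangentSpace 𝓘(ℝ, E) m)

/-! ### Lie algebroids, cohomology, morphisms -/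

section Algebroids

variable {E : Type u} [NormedAddCommGroup E] [NormedSpace ℝ E]
  {F : Type*} [NormedAddCommGroup F] [NormedSpace ℝ F]
  {M : Type*} [TopologicalSpace M] [ChartedSpace E M] [IsManifold 𝓘(ℝ, E) ∞ M]
  {A : M → Type v} [TopologicalSpace (TotalSpace F A)] [∀ m, AddCommGroup (A m)]
  [∀ m, Module ℝ (A m)] [∀ m, TopologicalSpace (A m)] [FiberBundle F A] [VectorBundle ℝ F A]

/-- A Lie algebroid structure on the vector bundle `A → M`: a smooth anchor `A → TM` and a real Lie
bracket on the smooth sections of `A`, satisfying the Leibniz rule. -/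
structure LieAlgebroid (E : Type u) [NormedAddCommGroup E] [NormedSpace ℝ E]
    (F : Type*) [NormedAddCommGroup F] [NormedSpace ℝ F]
    {M : Type*} [TopologicalSpace M] [ChartedSpace E M] [IsManifold 𝓘(ℝ, E) ∞ M]
    (A : M → Type v) [TopologicalSpace (TotalSpace F A)] [∀ m, AddCommGroup (A m)]
    [∀ m, Module ℝ (A m)] [∀ m, TopologicalSpace (A m)] [FiberBundle F A] [VectorBundle ℝ F A] where
  anchor : ∀ m, A m →ₗ[ℝ] TangentSpace 𝓘(ℝ, E) m
  contMDiff_anchor :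
    haveI : IsManifold 𝓘(ℝ, E) 1 M := IsManifold.of_le (n := ∞) (by simp)
    ContMDiff (𝓘(ℝ, E).prod 𝓘(ℝ, F)) (𝓘(ℝ, E).prod 𝓘(ℝ, E)) ∞ fun p : TotalSpace F A =>
      (TotalSpace.mk' E p.1 (anchor p.1 p.2) : TangentBundle 𝓘(ℝ, E) M)
  bracket : (ofBundle E F A).Γ →ₗ[ℝ] (ofBundle E F A).Γ →ₗ[ℝ] (ofBundle E F A).Γ
  bracket_self : ∀ a, bracket a a = 0
  jacobi : ∀ a b c, bracket a (bracket b c) = bracket (bracket a b) c + bracket b (bracket a c)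
  leibniz : ∀ (a b : (ofBundle E F A).Γ) (f : C^∞⟮𝓘(ℝ, E), M; ℝ⟯) (m : M),
    (bracket a (SmoothFamily.fsmul f b)).1 m =
      f m • (bracket a b).1 m + dirDeriv f m (anchor m (a.1 m)) • b.1 m
  anchor_bracket : ∀ (a b : (ofBundle E F A).Γ) (m : M), anchor m ((bracket a b).1 m) =
    VectorField.mlieBracket 𝓘(ℝ, E) (fun x => anchor x (a.1 x)) (fun x => anchor x (b.1 x)) m

namespace LieAlgebroid

variable (𝔸 : LieAlgebroid E F A)

/-- The underlying vector bundle, as a smooth family. -/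
abbrev bundle (_ : LieAlgebroid E F A) : SmoothFamily.{v} E M := ofBundle E F A

/-- Smooth `k`-cochains: sections of `∧^k A^*`. -/
abbrev Form (k : ℕ) : Type _ := (𝔸.bundle.alt k).Γ

/-- The derivative `ρ(a) · f` at `m`. -/
def der (a : 𝔸.bundle.Γ) (f : M → ℝ) (m : M) : ℝ := dirDeriv f m (𝔸.anchor m (a.1 m))

/-- The value `(d_A α)(a₀, …, a_k)` at `m`, for a family `α` of alternating `k`-forms on the fibres of
`A`.  In the second sum of the usual formula the argument `[aᵢ, aⱼ]` has been moved from the front to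
the slot of `aⱼ`, which turns the sign `(-1)^(i+j)` into `-(-1)^i`. -/
def dValue {k : ℕ} (α : ∀ m, A m [⋀^Fin k]→ₗ[ℝ] ℝ) (a : Fin (k + 1) → 𝔸.bundle.Γ) (m : M) : ℝ :=
  ∑ i : Fin (k + 1), (-1 : ℝ) ^ (i : ℕ) *
      𝔸.der (a i) (fun x => α x (fun l => (a (i.succAbove l)).1 x)) m -
  ∑ i : Fin (k + 1), ∑ j ∈ Finset.univ.filter (fun j => i < j), (-1 : ℝ) ^ (i : ℕ) *
      α m (fun l => (Function.update a j (𝔸.bracket (a i) (a j)) (i.succAbove l)).1 m)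

/-- `β = d_A α`. -/
def IsDifferential {k : ℕ} (α : ∀ m, A m [⋀^Fin k]→ₗ[ℝ] ℝ)
    (β : ∀ m, A m [⋀^Fin (k + 1)]→ₗ[ℝ] ℝ) : Prop :=
  ∀ (a : Fin (k + 1) → 𝔸.bundle.Γ) (m : M), β m (fun i => (a i).1 m) = 𝔸.dValue α a m

theorem form_mdifferentiableAt {k : ℕ} (α : 𝔸.Form k) (a : Fin k → 𝔸.bundle.Γ) (m : M) :
    MDifferentiableAt 𝓘(ℝ, E) 𝓘(ℝ, ℝ) (fun x => α.1 x (fun l => (a l).1 x)) m :=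
  ((α.2 a) m).mdifferentiableAt (by simp)

theorem dValue_zero {k : ℕ} (a : Fin (k + 1) → 𝔸.bundle.Γ) (m : M) :
    𝔸.dValue (k := k) (fun _ => 0) a m = 0 := by
  have h : ∀ i, 𝔸.der (a i) (fun _ : M => (0 : ℝ)) m = 0 := fun i => by
    unfold der dirDeriv; rw [mfderiv_const]; rfl
  simp [dValue, h]

theorem dValue_add {k : ℕ} (α β : 𝔸.Form k) (a : Fin (k + 1) → 𝔸.bundle.Γ) (m : M) :
    𝔸.dValue (α + β).1 a m = 𝔸.dValue α.1 a m + 𝔸.dValue β.1 a m := by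
  have h : ∀ i : Fin (k + 1),
      𝔸.der (a i) (fun x => (α + β).1 x (fun l => (a (i.succAbove l)).1 x)) m =
      𝔸.der (a i) (fun x => α.1 x (fun l => (a (i.succAbove l)).1 x)) m +
      𝔸.der (a i) (fun x => β.1 x (fun l => (a (i.succAbove l)).1 x)) m := fun i => by
    have := mfderiv_add (𝔸.form_mdifferentiableAt α (fun l => a (i.succAbove l)) m)
      (𝔸.form_mdifferentiableAt β (fun l => a (i.succAbove l)) m)
    exact congrArg (fun L => L (𝔸.anchor m ((a i).1 m))) this
  have h2 : ∀ v, (α + β).1 m v = α.1 m v + β.1 m v := fun v => rfl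
  simp only [dValue, h, h2, mul_add, Finset.sum_add_distrib]
  ring

theorem dValue_smul {k : ℕ} (c : ℝ) (α : 𝔸.Form k) (a : Fin (k + 1) → 𝔸.bundle.Γ) (m : M) :
    𝔸.dValue (c • α).1 a m = c * 𝔸.dValue α.1 a m := by
  have h : ∀ i : Fin (k + 1),
      𝔸.der (a i) (fun x => (c • α).1 x (fun l => (a (i.succAbove l)).1 x)) m =
      c * 𝔸.der (a i) (fun x => α.1 x (fun l => (a (i.succAbove l)).1 x)) m := fun i => by
    have := const_smul_mfderiv (𝔸.form_mdifferentiableAt α (fun l => a (i.succAbove l)) m) c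
    exact congrArg (fun L => L (𝔸.anchor m ((a i).1 m))) this
  have h2 : ∀ v, (c • α).1 m v = c * α.1 m v := fun v => rfl
  simp only [dValue, h, h2, mul_sub, Finset.mul_sum]
  congr 1
  · exact Finset.sum_congr rfl fun i _ => by ring
  · exact Finset.sum_congr rfl fun i _ => Finset.sum_congr rfl fun j _ => by ring

/-- The space of `d_A`-closed sections of `A^*`. -/
def closed : Submodule ℝ (𝔸.Form 1) where
  carrier := {α | 𝔸.IsDifferential α.1 (fun _ => 0)}
  add_mem' := fun {α β} ha hb a m => by
    rw [dValue_add, ← ha a m, ← hb a m]; simp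
  zero_mem' := fun a m => by
    rw [show (0 : 𝔸.Form 1).1 = fun _ => 0 from rfl, dValue_zero]; simp
  smul_mem' := fun c α ha a m => by
    rw [dValue_smul, ← ha a m]; simp

/-- The space of sections of `A^*` of the form `d_A f`, with `f ∈ C^∞(M)`. -/
def exact : Submodule ℝ (𝔸.Form 1) where
  carrier := {β | ∃ α : 𝔸.Form 0, 𝔸.IsDifferential α.1 β.1}
  add_mem' := by
    rintro β β' ⟨α, h⟩ ⟨α', h'⟩
    exact ⟨α + α', fun a m => by rw [dValue_add, ← h a m, ← h' a m]; rfl⟩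
  zero_mem' := ⟨0, fun a m => by
    rw [show (0 : 𝔸.Form 0).1 = fun _ => 0 from rfl, dValue_zero]; rfl⟩
  smul_mem' := by
    rintro c β ⟨α, h⟩
    exact ⟨c • α, fun a m => by rw [dValue_smul, ← h a m]; rfl⟩

/-- The 1-cohomology `H¹(A)`. -/
abbrev H1 : Type _ := 𝔸.closed ⧸ 𝔸.exact.comap 𝔸.closed.subtype

/-! ### Representations -/

/-- The `ℝ`-bilinear maps `Γ A × Γ V → Γ V`. -/
abbrev Op (V : SmoothFamily.{w} E M) : Type _ := 𝔸.bundle.Γ →ₗ[ℝ] V.Γ →ₗ[ℝ] V.Γ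

variable {V : SmoothFamily.{w} E M}

/-- `D` is an `A`-connection on `V`. -/
structure IsConnection (D : 𝔸.Op V) : Prop where
  fsmul_left : ∀ (f : C^∞⟮𝓘(ℝ, E), M; ℝ⟯) (a : 𝔸.bundle.Γ) (x : V.Γ),
    D (SmoothFamily.fsmul f a) x = SmoothFamily.fsmul f (D a x)
  fsmul_right : ∀ (f : C^∞⟮𝓘(ℝ, E), M; ℝ⟯) (a : 𝔸.bundle.Γ) (x : V.Γ) (m : M),
    (D a (SmoothFamily.fsmul f x)).1 m = f m • (D a x).1 m + 𝔸.der a f m • x.1 m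

/-- `D` is a representation of `A` on `V`, that is, a flat `A`-connection. -/
structure IsRepresentation (D : 𝔸.Op V) : Prop extends 𝔸.IsConnection D where
  flat : ∀ (a b : 𝔸.bundle.Γ) (x : V.Γ), D a (D b x) - D b (D a x) = D (𝔸.bracket a b) x

/-- `D'` is the dual of `D`: `⟨D'(a) ξ, x⟩ = -⟨ξ, D(a) x⟩ + ρ(a)⟨ξ, x⟩`. -/
def IsDual (D : 𝔸.Op V) (D' : 𝔸.Op V.dual) : Prop :=
  ∀ (a : 𝔸.bundle.Γ) (ξ : V.dual.Γ) (x : V.Γ) (m : M),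
    (show Module.Dual ℝ (V.Fib m) from (D' a ξ).1 m) (x.1 m) =
      -(show Module.Dual ℝ (V.Fib m) from ξ.1 m) ((D a x).1 m) +
        𝔸.der a (fun y => (show Module.Dual ℝ (V.Fib y) from ξ.1 y) (x.1 y)) m

/-- `D` is the tensor product of `D₁` and `D₂`: the `A`-connection with
`D(a)(x ⊗ y) = D₁(a) x ⊗ y + x ⊗ D₂(a) y`. -/
def IsTensor {V₁ : SmoothFamily.{w} E M} {V₂ : SmoothFamily.{w'} E M}
    (D₁ : 𝔸.Op V₁) (D₂ : 𝔸.Op V₂) (D : 𝔸.Op (V₁.tensor V₂)) : Prop :=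
  𝔸.IsConnection D ∧ ∀ (a : 𝔸.bundle.Γ) (x : V₁.Γ) (y : V₂.Γ),
    D a (SmoothFamily.tmul x y) =
      SmoothFamily.tmul (D₁ a x) y + SmoothFamily.tmul x (D₂ a y)

/-- The dual representation `D^*` (the unique operator as in `IsDual`). -/
def dualRep (D : 𝔸.Op V) : 𝔸.Op V.dual := Classical.epsilon (𝔸.IsDual D)

/-- The tensor product representation `D₁ ⊗ D₂` (the unique operator as in `IsTensor`). -/
def tensorRep {V₁ : SmoothFamily.{w} E M} {V₂ : SmoothFamily.{w'} E M}
    (D₁ : 𝔸.Op V₁) (D₂ : 𝔸.Op V₂) : 𝔸.Op (V₁.tensor V₂) :=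
  Classical.epsilon (𝔸.IsTensor D₁ D₂)

/-! ### Characteristic classes -/

/-- `α` is the characteristic cocycle of `D` associated with the section `s`:
`⟨α, a⟩ s = D(a) s` for all `a`. -/
def IsCharCocycle (D : 𝔸.Op V) (s : V.Γ) (α : 𝔸.Form 1) : Prop :=
  ∀ (a : 𝔸.bundle.Γ) (m : M), α.1 m (fun _ => a.1 m) • s.1 m = (D a s).1 m

/-- `c` is the class of the characteristic cocycle of `D` associated with some nowhere-vanishing
section of `V`. -/
def IsCocycleClass (D : 𝔸.Op V) (c : 𝔸.H1) : Prop :=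
  ∃ (s : V.Γ) (α : 𝔸.closed), SmoothFamily.NowhereZero s ∧ 𝔸.IsCharCocycle D s α.1 ∧
    c = Submodule.Quotient.mk α

/-- `c` is the characteristic class of the representation `D` on the line bundle `V`: the class of a
characteristic cocycle if `V` has a nowhere-vanishing section (that is, if `V` is orientable), and
otherwise one half of the class so obtained from `D ⊗ D` on `V ⊗ V`. -/
def IsCharClass (D : 𝔸.Op V) (c : 𝔸.H1) : Prop :=
  ((∃ s : V.Γ, SmoothFamily.NowhereZero s) ∧ 𝔸.IsCocycleClass D c) ∨
  ((¬ ∃ s : V.Γ, SmoothFamily.NowhereZero s) ∧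
    ∃ c₂ : 𝔸.H1, 𝔸.IsCocycleClass (𝔸.tensorRep D D) c₂ ∧ c = (1 / 2 : ℝ) • c₂)

/-- The characteristic class `char D` (the unique class as in `IsCharClass`). -/
def charClass (D : 𝔸.Op V) : 𝔸.H1 := Classical.epsilon (𝔸.IsCharClass D)

/-! ### The modular class -/

/-- The line bundle `L^A = ∧^top A ⊗ ∧^top T^*M`. -/
abbrev modularBundle : SmoothFamily.{max u v} E M :=
  (𝔸.bundle.ext (Module.finrank ℝ F)).tensor ((tangent E M).alt (Module.finrank ℝ E))

/-- `ν = 𝓛_X μ` for differential forms `μ`, `ν` of degree `k` and the vector field `X = ρ(a)`. -/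
def IsLieDeriv (a : 𝔸.bundle.Γ) {k : ℕ} (μ ν : ((tangent E M).alt k).Γ) : Prop :=
  ∀ (Y : Fin k → (tangent E M).Γ) (m : M),
    ν.1 m (fun i => (Y i).1 m) =
      𝔸.der a (fun x => μ.1 x (fun i => (Y i).1 x)) m -
        ∑ i, μ.1 m (Function.update (fun j => (Y j).1 m) i
          (VectorField.mlieBracket 𝓘(ℝ, E) (fun x => 𝔸.anchor x (a.1 x)) (Y i).1 m))

/-- `D` is the canonical operator `D^A` on `L^A`: the `A`-connection with
`D_a(ω ⊗ μ) = [a, ω] ⊗ μ + ω ⊗ 𝓛_{ρ(a)} μ`, where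
`[a, x₁ ∧ … ∧ x_r] = ∑ᵢ x₁ ∧ … ∧ [a, xᵢ] ∧ … ∧ x_r`. -/
def IsModular (D : 𝔸.Op 𝔸.modularBundle) : Prop :=
  𝔸.IsConnection D ∧
  ∀ (a : 𝔸.bundle.Γ) (x : Fin (Module.finrank ℝ F) → 𝔸.bundle.Γ)
    (μ ν : ((tangent E M).alt (Module.finrank ℝ E)).Γ), 𝔸.IsLieDeriv a μ ν →
    D a (SmoothFamily.tmul (SmoothFamily.wedge x) μ) =
      SmoothFamily.tmul (∑ i, SmoothFamily.wedge (Function.update x i (𝔸.bracket a (x i)))) μ +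
        SmoothFamily.tmul (SmoothFamily.wedge x) ν

/-- The canonical representation `D^A` of `A` on `L^A` (the unique operator as in `IsModular`). -/
def modularRep : 𝔸.Op 𝔸.modularBundle := Classical.epsilon 𝔸.IsModular

/-- The modular class `Mod A`. -/
def modularClass : 𝔸.H1 := 𝔸.charClass 𝔸.modularRep

end LieAlgebroid
end Algebroids

/-! ### Morphisms -/

section Morphisms

variable {E : Type u} [NormedAddCommGroup E] [NormedSpace ℝ E]
  {F : Type*} [NormedAddCommGroup F] [NormedSpace ℝ F]
  {M : Type*} [TopologicalSpace M] [ChartedSpace E M] [IsManifold 𝓘(ℝ, E) ∞ M]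
  {A : M → Type v} [TopologicalSpace (TotalSpace F A)] [∀ m, AddCommGroup (A m)]
  [∀ m, Module ℝ (A m)] [∀ m, TopologicalSpace (A m)] [FiberBundle F A] [VectorBundle ℝ F A]
  {E' : Type*} [NormedAddCommGroup E'] [NormedSpace ℝ E']
  {F' : Type*} [NormedAddCommGroup F'] [NormedSpace ℝ F']
  {N : Type*} [TopologicalSpace N] [ChartedSpace E' N] [IsManifold 𝓘(ℝ, E') ∞ N]
  {B : N → Type*} [TopologicalSpace (TotalSpace F' B)] [∀ n, AddCommGroup (B n)]
  [∀ n, Module ℝ (B n)] [∀ n, TopologicalSpace (B n)] [FiberBundle F' B] [VectorBundle ℝ F' B]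

/-- A morphism of Lie algebroids `(Φ, φ)` from `A → M` to `B → N`: a smooth vector bundle map for which
the pull-back of cochains is a chain map, i.e. `γ = d_B β` implies `Φ^* γ = d_A (Φ^* β)`, in all
degrees. -/
structure Morphism (𝔸 : LieAlgebroid E F A) (𝔹 : LieAlgebroid E' F' B) where
  base : C^∞⟮𝓘(ℝ, E), M; 𝓘(ℝ, E'), N⟯
  map : ∀ m, A m →ₗ[ℝ] B (base m)
  contMDiff_map : ContMDiff (𝓘(ℝ, E).prod 𝓘(ℝ, F)) (𝓘(ℝ, E').prod 𝓘(ℝ, F')) ∞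
    fun p : TotalSpace F A => (TotalSpace.mk' F' (base p.1) (map p.1 p.2) : TotalSpace F' B)
  chain_map : ∀ (k : ℕ) (β : 𝔹.Form k) (γ : 𝔹.Form (k + 1)), 𝔹.IsDifferential β.1 γ.1 →
    𝔸.IsDifferential (fun m => (β.1 (base m)).compLinearMap (map m))
      (fun m => (γ.1 (base m)).compLinearMap (map m))

/-- Near every point of the base, a smooth vector bundle has a frame of global smooth sections, and
the coefficients of a smooth map into the total space are smooth. -/
theorem exists_frame [FiniteDimensional ℝ E'] [FiniteDimensional ℝ F'] [T2Space N]
    [ContMDiffVectorBundle ∞ F' B 𝓘(ℝ, E')] (n₀ : N) :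
    ∃ (s : Fin (Module.finrank ℝ F') → (ofBundle E' F' B).Γ)
      (c : Fin (Module.finrank ℝ F') → TotalSpace F' B → ℝ),
      (∀ᶠ n in 𝓝 n₀, ∀ v : B n, v = ∑ i, c i ⟨n, v⟩ • (s i).1 n) ∧
      ∀ (f : M → TotalSpace F' B) (m₀ : M), (f m₀).proj = n₀ →
        ContMDiffAt 𝓘(ℝ, E) (𝓘(ℝ, E').prod 𝓘(ℝ, F')) ∞ f m₀ →
        ∀ i, ContMDiffAt 𝓘(ℝ, E) 𝓘(ℝ, ℝ) ∞ (fun m => c i (f m)) m₀ := by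
  set e := trivializationAt F' B n₀ with he
  let b := Module.finBasis ℝ F'
  obtain ⟨ψ, -, hψ⟩ := (SmoothBumpFunction.nhds_basis_tsupport (I := 𝓘(ℝ, E')) n₀).mem_iff.1
    (e.open_baseSet.mem_nhds (FiberBundle.mem_baseSet_trivializationAt' n₀))
  refine ⟨fun i => ⟨(ψ : N → ℝ) • e.localFrame b i, ?_⟩, fun i p => b.repr (e p).2 i, ?_, ?_⟩
  · exact ContMDiffOn.smul_section_of_tsupport (ψ.contMDiff.contMDiffOn) e.open_baseSet hψ
      (e.contMDiffOn_localFrame_baseSet ∞ b i)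
  · filter_upwards [ψ.eventuallyEq_one, e.open_baseSet.mem_nhds
      (FiberBundle.mem_baseSet_trivializationAt' n₀)] with n h1 hn v
    have := (e.basisAt b hn).sum_repr v
    conv_lhs => rw [← this]
    refine Finset.sum_congr rfl fun i _ => ?_
    simp [h1, hn, Bundle.Trivialization.basisAt]
  · rintro f m₀ rfl hf i
    have h := (contMDiffAt_totalSpace.1 hf).2
    have hL : ContDiff ℝ ∞ (fun v : F' => b.repr v i) :=
      (LinearMap.toContinuousLinearMap (b.coord i)).contDiff
    exact (hL.contMDiff.contMDiffAt).comp m₀ h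

namespace Morphism

variable {𝔸 : LieAlgebroid E F A} {𝔹 : LieAlgebroid E' F' B} (Φ : Morphism 𝔸 𝔹)

theorem smooth_pullForm [FiniteDimensional ℝ E'] [FiniteDimensional ℝ F'] [T2Space N]
    [ContMDiffVectorBundle ∞ F' B 𝓘(ℝ, E')] {k : ℕ} (β : 𝔹.Form k) :
    (fun m => (β.1 (Φ.base m)).compLinearMap (Φ.map m)) ∈ (𝔸.bundle.alt k).smooth := by
  intro a m₀
  obtain ⟨s, c, hs, hc⟩ := exists_frame (E := E) (M := M) (F' := F') (E' := E') (B := B)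
    (Φ.base m₀)
  have key : ∀ᶠ m in 𝓝 m₀, β.1 (Φ.base m) (fun i => Φ.map m ((a i).1 m)) =
      ∑ r : Fin k → Fin (Module.finrank ℝ F'),
        (∏ i, c (r i) ⟨Φ.base m, Φ.map m ((a i).1 m)⟩) *
          β.1 (Φ.base m) (fun i => (s (r i)).1 (Φ.base m)) := by
    filter_upwards [Φ.base.contMDiff.continuous.continuousAt.eventually hs] with m hm
    conv_lhs => rw [show (fun i => Φ.map m ((a i).1 m)) = fun i =>
      ∑ j, c j ⟨Φ.base m, Φ.map m ((a i).1 m)⟩ • (s j).1 (Φ.base m) from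
        funext fun i => hm _]
    have := (β.1 (Φ.base m)).toMultilinearMap.map_sum
      (fun i j => c j ⟨Φ.base m, Φ.map m ((a i).1 m)⟩ • (s j).1 (Φ.base m))
    refine this.trans (Finset.sum_congr rfl fun r _ => ?_)
    exact (β.1 (Φ.base m)).toMultilinearMap.map_smul_univ _ _
  refine ContMDiffAt.congr_of_eventuallyEq ?_ key
  have hco : ∀ j i, ContMDiffAt 𝓘(ℝ, E) 𝓘(ℝ, ℝ) ∞
      (fun m => c j ⟨Φ.base m, Φ.map m ((a i).1 m)⟩) m₀ := fun j i =>
    hc (fun m => ⟨Φ.base m, Φ.map m ((a i).1 m)⟩) m₀ rfl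
      ((Φ.contMDiff_map.comp (a i).2).contMDiffAt) j
  refine ContMDiffAt.sum fun r _ => ContMDiffAt.mul ?_ ?_
  · exact contMDiffAt_finsetProd fun i _ => hco _ _
  · exact ((β.2 fun i => s (r i)).comp Φ.base.contMDiff).contMDiffAt

section
variable [FiniteDimensional ℝ E'] [FiniteDimensional ℝ F'] [T2Space N]
    [ContMDiffVectorBundle ∞ F' B 𝓘(ℝ, E')]

/-- The pull-back of `k`-cochains, `(Φ^* β)_m (a₁, …, a_k) = β_{φ(m)} (Φ a₁, …, Φ a_k)`. -/
def pullForm (k : ℕ) : 𝔹.Form k →ₗ[ℝ] 𝔸.Form k where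
  toFun β := ⟨fun m => (β.1 (Φ.base m)).compLinearMap (Φ.map m), Φ.smooth_pullForm β⟩
  map_add' _ _ := rfl
  map_smul' _ _ := rfl

/-- The pull-back of closed 1-cochains. -/
def pullClosed : 𝔹.closed →ₗ[ℝ] 𝔸.closed :=
  (Φ.pullForm 1).restrict fun β hβ => Φ.chain_map 1 β 0 hβ

/-- The map `Φ^* : H¹(B) → H¹(A)` induced by a morphism. -/
def pullH1 : 𝔹.H1 →ₗ[ℝ] 𝔸.H1 :=
  Submodule.mapQ _ _ Φ.pullClosed fun β hβ => by
    obtain ⟨f, hf⟩ := hβ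
    exact ⟨Φ.pullForm 0 f, Φ.chain_map 0 f β.1 hf⟩

/-- The relative modular class `Mod Φ = Mod A - Φ^* (Mod B)`. -/
def modularClass : 𝔸.H1 := 𝔸.modularClass - Φ.pullH1 𝔹.modularClass

end

/-- `D'` is the pull-back of `D` by `(Φ, φ)`: the `A`-connection on `φ^! V` whose differential
satisfies `d(φ^! y) = (Φ^* ⊗ φ^!)(d y)`; evaluated on `a` at the point `m`, this says that
`(a · φ^! y)(m) = (b · y)(φ(m))` whenever `b(φ(m)) = Φ(a(m))`. -/
def IsPullback {V : SmoothFamily.{w} E' N} (D : 𝔹.Op V) (D' : 𝔸.Op (V.pullback Φ.base)) : Prop :=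
  𝔸.IsConnection D' ∧
  ∀ (a : 𝔸.bundle.Γ) (b : 𝔹.bundle.Γ) (y : V.Γ) (m : M), Φ.map m (a.1 m) = b.1 (Φ.base m) →
    (D' a (SmoothFamily.pullSec Φ.base y)).1 m = (D b y).1 (Φ.base m)

/-- The pull-back representation `Φ^! D` (the unique operator as in `IsPullback`). -/
def pullbackRep {V : SmoothFamily.{w} E' N} (D : 𝔹.Op V) : 𝔸.Op (V.pullback Φ.base) :=
  Classical.epsilon (Φ.IsPullback D)

/-- The line bundle `L^φ = L^A ⊗ φ^! ((L^B)^*)`. -/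
abbrev modularBundle := 𝔸.modularBundle.tensor (𝔹.modularBundle.dual.pullback Φ.base)

/-- `D^Φ = D^A ⊗ Φ^! ((D^B)^*)`. -/
def modularRep : 𝔸.Op Φ.modularBundle :=
  𝔸.tensorRep 𝔸.modularRep (Φ.pullbackRep (𝔹.dualRep 𝔹.modularRep))

end Morphism
end Morphisms
end LieAlgd

namespace LieAlgd

universe u v w w'

/-! ### Smooth functions and directional derivatives -/

section Functions

variable {E : Type*} [NormedAddCommGroup E] [NormedSpace ℝ E]
  {M : Type*} [TopologicalSpace M] [ChartedSpace E M]

/-! The main device turns connections on line bundles into global 1-forms, orientable or not. A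
partition of unity gives every line bundle a fibre metric, hence in each fibre a pair of opposite
unit vectors (`IsLine.exists_isUnits`). Two local unit sections differ by a function with square 1,
whose derivatives vanish. So the form `β` with `D(a) u = ⟨β, a⟩ u` does not depend on the local unit
section `u`, and it is defined globally.

This sets up a dictionary. Every 1-form comes from a connection and every connection from a 1-form,
which determines it (`exists_connection_of_form`, `IsConnection.exists_unitForm`,
`IsUnitForm.unique`). A connection is flat exactly when its form is closed
(`IsUnitForm.isRepresentation_iff`). Tensor products add forms, duals negate them, and pull-backs
pull them back. The characteristic class is the class of the form (`IsUnitForm.isCharClass_iff`): if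
a nowhere-vanishing section is locally `f u`, its cocycle is `β + d log |f|`. If there is no such
section, `u ⊗ u` is a global section of the square, where the form is `2β`, and halving restores
`β`. With `α` and `β` the forms of `D^A` and `D^B`, the form of `D^Φ` is `α - Φ^*β`. This is closed,
and its class is `Mod A - Φ^*(Mod B)`.

It remains to construct `D^A` and to prove it flat. Tested against a functional built from a form on
`A` and vector fields on `M`, the prescribed derivative of `x₁ ∧ … ∧ x_r ⊗ μ` is the derivative of
the test value minus a term of order zero (`exists_modularDual_defect`). Hence the prescription
obeys the Leibniz rule and is consistent between frames (`modularValue_of_eventually`). In a frame,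
its connection form is `tr [a, ·] - tr [ρ(a), ·]`. Each trace separately fails to be function-linear
in `a`, but the two failures cancel (`modularForm_fsmul`). The form is closed by the Jacobi
identities and the formula for the trace of a commutator of derivations (`IsDer.trace_commutator`,
`modularForm_bracket`). -/

theorem dirDeriv_congr {f g : M → ℝ} {m : M} (h : f =ᶠ[𝓝 m] g) (v : TangentSpace 𝓘(ℝ, E) m) :
    dirDeriv f m v = dirDeriv g m v := by
  simp only [dirDeriv, h.mfderiv_eq]
  rfl

theorem mdifferentiableAt_smooth (f : C^∞⟮𝓘(ℝ, E), M; ℝ⟯) (m : M) :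
    MDifferentiableAt 𝓘(ℝ, E) 𝓘(ℝ, ℝ) f m :=
  (f.contMDiff m).mdifferentiableAt (by simp)

/-- The derivative along a tangent vector, as a linear functional on smooth functions. -/
def dirD (m : M) (v : TangentSpace 𝓘(ℝ, E) m) : C^∞⟮𝓘(ℝ, E), M; ℝ⟯ →ₗ[ℝ] ℝ where
  toFun f := dirDeriv f m v
  map_add' f g := by
    have := mfderiv_add (mdifferentiableAt_smooth f m) (mdifferentiableAt_smooth g m)
    exact congrArg (fun L => L v) this
  map_smul' c f := by
    have := const_smul_mfderiv (mdifferentiableAt_smooth f m) c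
    exact congrArg (fun L => L v) this

theorem dirD_apply (m : M) (v : TangentSpace 𝓘(ℝ, E) m) (f : C^∞⟮𝓘(ℝ, E), M; ℝ⟯) :
    dirD m v f = dirDeriv f m v := rfl

theorem dirD_mul (m : M) (v : TangentSpace 𝓘(ℝ, E) m) (f g : C^∞⟮𝓘(ℝ, E), M; ℝ⟯) :
    dirD m v (f * g) = f m * dirD m v g + dirD m v f * g m := by
  have := (mdifferentiableAt_smooth f m).hasMFDerivAt.mul
    (mdifferentiableAt_smooth g m).hasMFDerivAt
  have h2 := congrArg (fun L => L v) this.mfderiv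
  refine Eq.trans h2 ?_
  change f m * _ + g m * _ = _
  rw [mul_comm (g m)]
  rfl

theorem dirD_congr {m : M} (v : TangentSpace 𝓘(ℝ, E) m) {f g : C^∞⟮𝓘(ℝ, E), M; ℝ⟯}
    (h : ∀ᶠ x in 𝓝 m, f x = g x) : dirD m v f = dirD m v g :=
  dirDeriv_congr h v

theorem dirD_eq_zero_of_eventually_const {m : M} (v : TangentSpace 𝓘(ℝ, E) m)
    {f : C^∞⟮𝓘(ℝ, E), M; ℝ⟯} {c : ℝ} (h : ∀ᶠ x in 𝓝 m, f x = c) : dirD m v f = 0 := by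
  rw [dirD_apply, dirDeriv_congr (g := fun _ => c) h, dirDeriv, mfderiv_const]
  rfl

@[simp] theorem smooth_mul_apply (f g : C^∞⟮𝓘(ℝ, E), M; ℝ⟯) (m : M) : (f * g) m = f m * g m := rfl
@[simp] theorem smooth_add_apply (f g : C^∞⟮𝓘(ℝ, E), M; ℝ⟯) (m : M) : (f + g) m = f m + g m := rfl
@[simp] theorem smooth_sub_apply (f g : C^∞⟮𝓘(ℝ, E), M; ℝ⟯) (m : M) : (f - g) m = f m - g m := rfl
@[simp] theorem smooth_neg_apply (f : C^∞⟮𝓘(ℝ, E), M; ℝ⟯) (m : M) : (-f) m = -f m := rfl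
@[simp] theorem smooth_smul_apply (c : ℝ) (f : C^∞⟮𝓘(ℝ, E), M; ℝ⟯) (m : M) :
    (c • f) m = c * f m := rfl
@[simp] theorem smooth_one_apply (m : M) : (1 : C^∞⟮𝓘(ℝ, E), M; ℝ⟯) m = 1 := rfl

@[simp] theorem smooth_sum_apply {ι : Type*} (t : Finset ι) (f : ι → C^∞⟮𝓘(ℝ, E), M; ℝ⟯) (m : M) :
    (∑ i ∈ t, f i) m = ∑ i ∈ t, f i m := by
  classical
  induction t using Finset.induction_on with
  | empty => simp
  | insert a s ha ih => rw [Finset.sum_insert ha, Finset.sum_insert ha, smooth_add_apply, ih]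

variable [FiniteDimensional ℝ E] [T2Space M] [IsManifold 𝓘(ℝ, E) ∞ M]

/-- A smooth function which is `1` near `m` and has support inside a given neighbourhood. -/
theorem exists_cutoff {m : M} {s : Set M} (hs : s ∈ 𝓝 m) :
    ∃ ψ : C^∞⟮𝓘(ℝ, E), M; ℝ⟯, (∀ᶠ x in 𝓝 m, ψ x = 1) ∧ tsupport ψ ⊆ s := by
  obtain ⟨ψ, -, hψ⟩ := (SmoothBumpFunction.nhds_basis_tsupport (I := 𝓘(ℝ, E)) m).mem_iff.1 hs
  exact ⟨⟨ψ, ψ.contMDiff⟩, ψ.eventuallyEq_one, hψ⟩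

/-- A function which is smooth near `m` agrees near `m` with a smooth function. -/
theorem exists_smooth_extension {m : M} {f : M → ℝ}
    (hf : ∀ᶠ x in 𝓝 m, ContMDiffAt 𝓘(ℝ, E) 𝓘(ℝ, ℝ) ∞ f x) :
    ∃ g : C^∞⟮𝓘(ℝ, E), M; ℝ⟯, ∀ᶠ x in 𝓝 m, g x = f x := by
  obtain ⟨ψ, h1, hψ⟩ := exists_cutoff (E := E) hf
  refine ⟨⟨fun x => ψ x * f x, contMDiff_of_tsupport fun x hx => ?_⟩, ?_⟩
  · exact (ψ.contMDiff x).mul (hψ (closure_mono (Function.support_mul_subset_left _ _) hx))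
  · filter_upwards [h1] with x hx
    change ψ x * f x = f x
    rw [hx, one_mul]

end Functions

/-! ### Sections -/

section Sections

variable {E : Type*} [NormedAddCommGroup E] [NormedSpace ℝ E]
  {M : Type*} [TopologicalSpace M] [ChartedSpace E M] {V : SmoothFamily.{w} E M}

namespace SmoothFamily

@[ext] theorem Γ_ext {s t : V.Γ} (h : ∀ m, s.1 m = t.1 m) : s = t := Subtype.ext (funext h)

@[simp] theorem add_val (s t : V.Γ) (m : M) : (s + t).1 m = s.1 m + t.1 m := rfl
@[simp] theorem sub_val (s t : V.Γ) (m : M) : (s - t).1 m = s.1 m - t.1 m := rfl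
@[simp] theorem neg_val (s : V.Γ) (m : M) : (-s).1 m = -s.1 m := rfl
@[simp] theorem zero_val (m : M) : (0 : V.Γ).1 m = 0 := rfl
@[simp] theorem smul_val (c : ℝ) (s : V.Γ) (m : M) : (c • s).1 m = c • s.1 m := rfl
@[simp] theorem fsmul_val (f : C^∞⟮𝓘(ℝ, E), M; ℝ⟯) (s : V.Γ) (m : M) :
    (fsmul f s).1 m = f m • s.1 m := rfl

/-- Evaluation of sections at a point. -/
def ev (V : SmoothFamily.{w} E M) (m : M) : V.Γ →ₗ[ℝ] V.Fib m where
  toFun s := s.1 m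
  map_add' _ _ := rfl
  map_smul' _ _ := rfl

@[simp] theorem ev_apply (m : M) (s : V.Γ) : V.ev m s = s.1 m := rfl

@[simp] theorem sum_val {ι : Type*} (t : Finset ι) (s : ι → V.Γ) (m : M) :
    (∑ i ∈ t, s i).1 m = ∑ i ∈ t, (s i).1 m := map_sum (V.ev m) s t

/-- The value at `m` of a section of the dual, as a linear functional. -/
def at' (ξ : V.dual.Γ) (m : M) : V.Fib m →ₗ[ℝ] ℝ := ξ.1 m

/-- The pairing of a section of the dual with a section. -/
def pair (ξ : V.dual.Γ) : V.Γ →ₗ[ℝ] C^∞⟮𝓘(ℝ, E), M; ℝ⟯ where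
  toFun s := ⟨fun m => at' ξ m (s.1 m), ξ.2 s⟩
  map_add' s t := by ext m; exact map_add (at' ξ m) (s.1 m) (t.1 m)
  map_smul' c s := by ext m; exact map_smul (at' ξ m) c (s.1 m)

@[simp] theorem pair_apply (ξ : V.dual.Γ) (s : V.Γ) (m : M) : pair ξ s m = at' ξ m (s.1 m) := rfl

@[simp] theorem pair_fsmul (ξ : V.dual.Γ) (f : C^∞⟮𝓘(ℝ, E), M; ℝ⟯) (s : V.Γ) :
    pair ξ (fsmul f s) = f * pair ξ s := by ext m; simp

/-- Smoothness of sections of `V` is a local property. -/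
def IsLocal (V : SmoothFamily.{w} E M) : Prop :=
  ∀ t : ∀ m, V.Fib m, (∀ m, ∃ t' : V.Γ, ∀ᶠ x in 𝓝 m, t x = t'.1 x) → t ∈ V.smooth

/-- `s` is a frame of `V` near `m`, with dual frame `ξ`. -/
def IsFrame {k : ℕ} (s : Fin k → V.Γ) (ξ : Fin k → V.dual.Γ) (m : M) : Prop :=
  ∀ᶠ x in 𝓝 m, (∀ i j, at' (ξ i) x ((s j).1 x) = if i = j then 1 else 0) ∧
    ∀ v : V.Fib x, v = ∑ i, at' (ξ i) x v • (s i).1 x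

/-- `V` is a smooth vector bundle of rank `k`, presented by local frames with dual frames. -/
def IsFramed (k : ℕ) (V : SmoothFamily.{w} E M) : Prop :=
  V.IsLocal ∧ ∀ m, ∃ (s : Fin k → V.Γ) (ξ : Fin k → V.dual.Γ), IsFrame s ξ m

/-- `e` is a frame of the line bundle `V` near `m`, with dual frame `ξ`. -/
def IsLineFrame (e : V.Γ) (ξ : V.dual.Γ) (m : M) : Prop :=
  ∀ᶠ x in 𝓝 m, at' ξ x (e.1 x) = 1 ∧ ∀ v : V.Fib x, v = at' ξ x v • e.1 x

/-- `V` is a smooth line bundle. -/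
def IsLine (V : SmoothFamily.{w} E M) : Prop :=
  V.IsLocal ∧ ∀ m, ∃ (e : V.Γ) (ξ : V.dual.Γ), IsLineFrame e ξ m

theorem IsLineFrame.eventually {e : V.Γ} {ξ : V.dual.Γ} {m : M} (h : IsLineFrame e ξ m) :
    ∀ᶠ x in 𝓝 m, IsLineFrame e ξ x := eventually_eventually_nhds.2 h

theorem IsFrame.eventually {k : ℕ} {s : Fin k → V.Γ} {ξ : Fin k → V.dual.Γ} {m : M}
    (h : IsFrame s ξ m) : ∀ᶠ x in 𝓝 m, IsFrame s ξ x := eventually_eventually_nhds.2 h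

theorem IsLineFrame.ne_zero {e : V.Γ} {ξ : V.dual.Γ} {m : M} (h : IsLineFrame e ξ m) :
    e.1 m ≠ 0 := fun h0 => by
  have := h.self_of_nhds.1
  rw [h0, map_zero] at this
  exact zero_ne_one this

/-- Pairing with the dual frame produces the smooth coefficients that the frame description asks
for. -/
theorem IsLine.isVectorBundle (h : V.IsLine) : V.IsVectorBundle 1 := by
  refine ⟨h.1, fun m => ?_⟩
  obtain ⟨e, ξ, he⟩ := h.2 m
  refine ⟨fun _ => e, ?_, fun t => ⟨fun _ => pair ξ t, ?_⟩⟩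
  · filter_upwards [he, he.eventually] with x hx hx'
    refine ⟨LinearIndependent.of_subsingleton 0 hx'.ne_zero, ?_⟩
    rw [eq_top_iff]
    intro v _
    rw [hx.2 v]
    exact Submodule.smul_mem _ _ (Submodule.subset_span ⟨0, rfl⟩)
  · filter_upwards [he] with x hx
    simpa using hx.2 (t.1 x)

theorem IsFrame.ev_surjective {k : ℕ} {s : Fin k → V.Γ} {ξ : Fin k → V.dual.Γ} {m : M}
    (h : IsFrame s ξ m) : Function.Surjective (V.ev m) := fun v =>
  ⟨∑ i, at' (ξ i) m v • s i, by rw [h.self_of_nhds.2 v]; simp [h.self_of_nhds.1]⟩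

theorem IsLineFrame.ev_surjective {e : V.Γ} {ξ : V.dual.Γ} {m : M}
    (h : IsLineFrame e ξ m) : Function.Surjective (V.ev m) := fun v =>
  ⟨at' ξ m v • e, (h.self_of_nhds.2 v).symm⟩

/-- A linear choice of a section through every vector of the fibre at `m`. -/
def lift (V : SmoothFamily.{w} E M) (m : M) : V.Fib m →ₗ[ℝ] V.Γ :=
  Classical.epsilon fun σ => V.ev m ∘ₗ σ = LinearMap.id

/-- The section is an `epsilon` choice, so it is meaningful only where evaluation is surjective; any
local frame ensures this. -/
theorem lift_spec {m : M} (h : Function.Surjective (V.ev m)) (v : V.Fib m) :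
    (V.lift m v).1 m = v := by
  have := Classical.epsilon_spec
    (LinearMap.exists_rightInverse_of_surjective (V.ev m) (LinearMap.range_eq_top.2 h))
  exact LinearMap.congr_fun this v

variable [FiniteDimensional ℝ E] [T2Space M] [IsManifold 𝓘(ℝ, E) ∞ M]

/-- An operator which is function-linear at `m` only depends on the germ at `m`. -/
theorem tensorial_of_eventually {W : Type*} [AddCommGroup W] [Module ℝ W] {m : M}
    (T : V.Γ →ₗ[ℝ] W) (hT : ∀ (f : C^∞⟮𝓘(ℝ, E), M; ℝ⟯) s, T (fsmul f s) = f m • T s) {s : V.Γ}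
    (hs : ∀ᶠ x in 𝓝 m, s.1 x = 0) : T s = 0 := by
  -- The cutoff is supported where `s` vanishes, so `ψ s = 0`, while `ψ m = 1`.
  obtain ⟨ψ, h1, h2⟩ := exists_cutoff (E := E) hs
  have h0 : fsmul ψ s = 0 := by
    ext x
    by_cases hx : x ∈ tsupport ψ
    · have : s.1 x = 0 := h2 hx
      simp [this]
    · simp [image_eq_zero_of_notMem_tsupport hx]
  have := hT ψ s
  rwa [h0, map_zero, h1.self_of_nhds, one_smul, eq_comm] at this

/-- An operator which is function-linear at `m` only depends on the value at `m`. -/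
theorem IsFrame.tensorial {W : Type*} [AddCommGroup W] [Module ℝ W] {k : ℕ} {e : Fin k → V.Γ}
    {ξ : Fin k → V.dual.Γ} {m : M} (he : IsFrame e ξ m)
    (T : V.Γ →ₗ[ℝ] W) (hT : ∀ (f : C^∞⟮𝓘(ℝ, E), M; ℝ⟯) s, T (fsmul f s) = f m • T s) {s : V.Γ}
    (hs : s.1 m = 0) : T s = 0 := by
  -- The frame expansion has the same germ as `s`, and its coefficients vanish at `m`.
  have h : T (s - ∑ i, fsmul (pair (ξ i) s) (e i)) = 0 := by
    refine tensorial_of_eventually T hT ?_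
    filter_upwards [he] with x hx
    simp [← hx.2]
  rw [map_sub, sub_eq_zero] at h
  rw [h, map_sum]
  refine Finset.sum_eq_zero fun i _ => ?_
  rw [hT, pair_apply, hs, map_zero, zero_smul]

/-- This lets a function-linear operator on sections be read as a linear map on the fibre, with no
dependence on the chosen lift. -/
theorem IsFrame.tensorial_lift {W : Type*} [AddCommGroup W] [Module ℝ W] {k : ℕ} {e : Fin k → V.Γ}
    {ξ : Fin k → V.dual.Γ} {m : M} (he : IsFrame e ξ m)
    (T : V.Γ →ₗ[ℝ] W) (hT : ∀ (f : C^∞⟮𝓘(ℝ, E), M; ℝ⟯) s, T (fsmul f s) = f m • T s) (s : V.Γ) :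
    T (V.lift m (s.1 m)) = T s := by
  have := he.tensorial T hT (s := V.lift m (s.1 m) - s)
    (by simp [lift_spec he.ev_surjective])
  rwa [map_sub, sub_eq_zero] at this

end SmoothFamily

end Sections

/-! ### Local frames of the bundles in use -/

section Frames

open SmoothFamily

/-! ### Frames of vector bundles given by trivializations -/

section OfBundle

variable {E : Type u} [NormedAddCommGroup E] [NormedSpace ℝ E]
  {F : Type*} [NormedAddCommGroup F] [NormedSpace ℝ F]
  {M : Type*} [TopologicalSpace M] [ChartedSpace E M]
  {A : M → Type v} [TopologicalSpace (TotalSpace F A)] [∀ m, AddCommGroup (A m)]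
  [∀ m, Module ℝ (A m)] [∀ m, TopologicalSpace (A m)] [FiberBundle F A] [VectorBundle ℝ F A]

theorem ofBundle_isLocal : (ofBundle E F A).IsLocal := fun t ht m => by
  obtain ⟨t', h⟩ := ht m
  refine (t'.2 m).congr_of_eventuallyEq ?_
  filter_upwards [h] with x hx
  rw [hx]

/-- A cutoff extends both the frame of a trivialization and its coordinate functionals to global
sections. They remain dual to each other where the cutoff equals 1. -/
theorem ofBundle_isFramed [FiniteDimensional ℝ E] [FiniteDimensional ℝ F] [T2Space M]
    [IsManifold 𝓘(ℝ, E) ∞ M] [ContMDiffVectorBundle ∞ F A 𝓘(ℝ, E)] :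
    (ofBundle E F A).IsFramed (Module.finrank ℝ F) := by
  refine ⟨ofBundle_isLocal, fun m₀ => ?_⟩
  set e := trivializationAt F A m₀ with he
  have hm₀ := e.open_baseSet.mem_nhds
    (FiberBundle.mem_baseSet_trivializationAt' (F := F) (E := A) m₀)
  let b := Module.finBasis ℝ F
  obtain ⟨ψ, h1, hψ⟩ := exists_cutoff (E := E) hm₀
  refine ⟨fun i => ⟨(ψ : M → ℝ) • e.localFrame b i, ?_⟩,
    fun i => ⟨fun x => ψ x • (b.coord i ∘ₗ e.linearMapAt ℝ x), fun a => ?_⟩, ?_⟩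
  · exact ContMDiffOn.smul_section_of_tsupport (ψ.contMDiff.contMDiffOn) e.open_baseSet hψ
      (e.contMDiffOn_localFrame_baseSet ∞ b i)
  · refine contMDiff_of_tsupport fun x hx => ?_
    have hx' : x ∈ e.baseSet := hψ (closure_mono (Function.support_smul_subset_left
      (ψ : M → ℝ) (fun x => b.coord i (e.linearMapAt ℝ x (a.1 x)))) hx)
    have h : ContMDiffAt 𝓘(ℝ, E) 𝓘(ℝ, F) ∞ (fun y => (e ⟨y, a.1 y⟩).2) x :=
      (e.contMDiffAt_section_iff (s := a.1) hx').1 (a.2 x)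
    have hL : ContDiff ℝ ∞ (fun v : F => b.coord i v) :=
      (LinearMap.toContinuousLinearMap (b.coord i)).contDiff
    refine (ψ.contMDiff x).mul (((hL.contMDiff.contMDiffAt).comp x h).congr_of_eventuallyEq ?_)
    filter_upwards [e.open_baseSet.mem_nhds hx'] with y hy
    simp [Function.comp, e.linearMapAt_apply, hy]
  · filter_upwards [h1, hm₀] with x hx hxb
    have hl : ∀ i (v : A x), b.coord i (e.linearMapAt ℝ x v) = (e.basisAt b hxb).repr v i :=
      fun i v => by simp [Bundle.Trivialization.basisAt, e.linearMapAt_apply, hxb]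
    refine ⟨fun i j => ?_, fun v => ?_⟩
    · change ψ x • b.coord i (e.linearMapAt ℝ x (ψ x • e.localFrame b j x)) = _
      rw [hx, one_smul, one_smul, e.localFrame_apply_of_mem_baseSet b hxb, hl,
        Module.Basis.repr_self, Finsupp.single_apply]
      simp only [eq_comm]
    · conv_lhs => rw [← (e.basisAt b hxb).sum_repr v]
      refine Finset.sum_congr rfl fun i _ => ?_
      change _ = (ψ x • b.coord i (e.linearMapAt ℝ x v)) • (ψ x • e.localFrame b i x)
      rw [hx, one_smul, one_smul, e.localFrame_apply_of_mem_baseSet b hxb, hl]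

theorem tangent_isFramed [FiniteDimensional ℝ E] [T2Space M] [IsManifold 𝓘(ℝ, E) ∞ M] :
    (tangent E M).IsFramed (Module.finrank ℝ E) := by
  have : IsManifold 𝓘(ℝ, E) 1 M := IsManifold.of_le (n := ∞) (by simp)
  -- The tangent bundle costs one derivative, and `∞ + 1` is `∞`.
  have : IsManifold 𝓘(ℝ, E) (∞ + 1) M := ‹IsManifold 𝓘(ℝ, E) ∞ M›
  exact ofBundle_isFramed (A := fun m : M => TangentSpace 𝓘(ℝ, E) m)

end OfBundle

/-! ### Line frames of top exterior powers, duals and tensor products -/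

section Derived

variable {E : Type*} [NormedAddCommGroup E] [NormedSpace ℝ E]
  {M : Type*} [TopologicalSpace M] [ChartedSpace E M] {V : SmoothFamily.{w} E M}

theorem contMDiff_of_eventually {f : M → ℝ}
    (h : ∀ m, ∃ g : C^∞⟮𝓘(ℝ, E), M; ℝ⟯, ∀ᶠ x in 𝓝 m, f x = g x) :
    ContMDiff 𝓘(ℝ, E) 𝓘(ℝ, ℝ) ∞ f := fun m => by
  obtain ⟨g, hg⟩ := h m
  exact (g.contMDiff m).congr_of_eventuallyEq hg

theorem localSpan_isLocal {X : M → Type w} [∀ m, AddCommGroup (X m)] [∀ m, Module ℝ (X m)]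
    {S : Set (∀ m, X m)} {t : ∀ m, X m}
    (ht : ∀ m, ∃ t' ∈ localSpan (E := E) S, ∀ᶠ x in 𝓝 m, t x = t' x) :
    t ∈ localSpan (E := E) S := fun m => by
  obtain ⟨t', ht', h⟩ := ht m
  obtain ⟨t'', h'', h'⟩ := ht' m
  exact ⟨t'', h'', by filter_upwards [h, h'] with x h1 h2; rw [h1, h2]⟩

/-- A family of functionals is smooth on a local span if it is smooth on the generators. -/
theorem contMDiff_of_localSpan {X : M → Type w} [∀ m, AddCommGroup (X m)] [∀ m, Module ℝ (X m)]
    {S : Set (∀ m, X m)} (P : ∀ m, X m →ₗ[ℝ] ℝ)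
    (hP : ∀ s ∈ S, ContMDiff 𝓘(ℝ, E) 𝓘(ℝ, ℝ) ∞ fun m => P m (s m)) {t : ∀ m, X m}
    (ht : t ∈ localSpan (E := E) S) : ContMDiff 𝓘(ℝ, E) 𝓘(ℝ, ℝ) ∞ fun m => P m (t m) := fun m => by
  obtain ⟨t', ht', h⟩ := ht m
  suffices H : ContMDiff 𝓘(ℝ, E) 𝓘(ℝ, ℝ) ∞ fun m => P m (t' m) by
    refine (H m).congr_of_eventuallyEq ?_
    filter_upwards [h] with x hx
    rw [hx]
  clear h
  induction ht' using Submodule.span_induction with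
  | mem r hr =>
    obtain ⟨f, s, hs, rfl⟩ := hr
    simp only [map_smul, smul_eq_mul]
    exact f.contMDiff.mul (hP s hs)
  | zero => simpa using contMDiff_const
  | add a b _ _ ha hb =>
    simp only [Pi.add_apply, map_add]
    exact ha.add hb
  | smul c a _ ha =>
    simp only [Pi.smul_apply, map_smul, smul_eq_mul]
    exact contMDiff_const.mul ha

theorem alt_isLocal (k : ℕ) : (V.alt k).IsLocal := fun t ht s => contMDiff_of_eventually fun m => by
  obtain ⟨t', h⟩ := ht m
  refine ⟨⟨_, t'.2 s⟩, ?_⟩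
  filter_upwards [h] with x hx
  rw [hx]
  rfl

theorem dual_isLocal : V.dual.IsLocal := fun t ht s => contMDiff_of_eventually fun m => by
  obtain ⟨t', h⟩ := ht m
  refine ⟨⟨_, t'.2 s⟩, ?_⟩
  filter_upwards [h] with x hx
  rw [hx]
  rfl

theorem ext_isLocal (k : ℕ) : (V.ext k).IsLocal := fun _ ht =>
  localSpan_isLocal fun m => let ⟨t', h⟩ := ht m; ⟨t'.1, t'.2, h⟩

theorem tensor_isLocal (W : SmoothFamily.{v} E M) : (V.tensor W).IsLocal := fun _ ht =>
  localSpan_isLocal fun m => let ⟨t', h⟩ := ht m; ⟨t'.1, t'.2, h⟩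

/-- The section of `∧^k V^*` with value `det (ξᵢ vⱼ)` on `v₁, …, v_k`. -/
def detForm {k : ℕ} (ξ : Fin k → V.dual.Γ) : (V.alt k).Γ :=
  ⟨fun m => Matrix.detRowAlternating.compLinearMap (LinearMap.pi fun i => at' (ξ i) m), fun s => by
    have : (fun m => Matrix.detRowAlternating.compLinearMap (LinearMap.pi fun i => at' (ξ i) m)
        (fun i => (s i).1 m)) = fun m => (∑ σ : Equiv.Perm (Fin k), ((Equiv.Perm.sign σ : ℤ) : ℝ) •
          ∏ i, pair (ξ i) (s (σ i))) m := by
      funext m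
      rw [smooth_sum_apply]
      refine (Matrix.det_apply' _).trans (Finset.sum_congr rfl fun σ _ => ?_)
      rw [smooth_smul_apply]
      congr 1
      induction (Finset.univ : Finset (Fin k)) using Finset.induction_on with
      | empty => simp
      | insert a t ha ih =>
        rw [Finset.prod_insert ha, Finset.prod_insert ha, ih]
        rfl
    rw [this]
    exact ContMDiffMap.contMDiff _⟩

/-- The value at `m` of a section of `∧^k V^*`, as an alternating map. -/
def altAt {k : ℕ} (α : (V.alt k).Γ) (m : M) : V.Fib m [⋀^Fin k]→ₗ[ℝ] ℝ := α.1 m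

theorem det_eq_one_of_dual {k : ℕ} {c : Fin k → Fin k → ℝ}
    (h : ∀ i j, c i j = if i = j then 1 else 0) : Matrix.det (Matrix.of fun j i => c i j) = 1 := by
  rw [show (Matrix.of fun j i => c i j) = 1 by
    ext i j
    simp [h, Matrix.one_apply, eq_comm], Matrix.det_one]

/-- In a frame, an alternating map of top degree is a multiple of the determinant. -/
theorem alternating_eq_det {k : ℕ} {U N : Type*} [AddCommGroup U] [Module ℝ U] [AddCommGroup N]
    [Module ℝ N] {s : Fin k → U} {ξ : Fin k → U →ₗ[ℝ] ℝ}
    (h1 : ∀ i j, ξ i (s j) = if i = j then 1 else 0) (h2 : ∀ v, v = ∑ i, ξ i v • s i)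
    (f : U [⋀^Fin k]→ₗ[ℝ] N) (v : Fin k → U) :
    f v = Matrix.det (Matrix.of fun j i => ξ i (v j)) • f s := by
  let D : U [⋀^Fin k]→ₗ[ℝ] ℝ := Matrix.detRowAlternating.compLinearMap (LinearMap.pi ξ)
  have hli : LinearIndependent ℝ s := by
    rw [Fintype.linearIndependent_iff]
    intro g hg i
    have := congrArg (ξ i) hg
    simpa [h1] using this
  let b : Module.Basis (Fin k) ℝ U := Module.Basis.mk hli fun v _ => by
    rw [h2 v]
    exact Submodule.sum_mem _ fun i _ => Submodule.smul_mem _ _ (Submodule.subset_span ⟨i, rfl⟩)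
  have hD : D s = 1 := det_eq_one_of_dual h1
  have key : f = (LinearMap.toSpanSingleton ℝ N (f s)).compAlternatingMap D := by
    -- Alternating maps are compared on injective choices of basis vectors. In top degree these are
    -- permutations, and both sides change by the sign.
    refine b.ext_alternating fun σ hσ => ?_
    let τ : Equiv.Perm (Fin k) := Equiv.ofBijective σ (Finite.injective_iff_bijective.1 hσ)
    have hb : (fun i => b (σ i)) = s ∘ τ := by
      funext i
      simp [b, τ]
    rw [hb, AlternatingMap.map_perm, AlternatingMap.map_perm]
    simp [hD]
  exact congrArg (fun g => g v) key

/-- Evaluation on `k` sections, as a section of the dual of `∧^k V^*`. -/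
def evalOn {k : ℕ} (s : Fin k → V.Γ) : (V.alt k).dual.Γ :=
  ⟨fun m =>
    { toFun := fun α => (show V.Fib m [⋀^Fin k]→ₗ[ℝ] ℝ from α) fun i => (s i).1 m
      map_add' := fun _ _ => rfl
      map_smul' := fun _ _ => rfl }, fun α => α.2 s⟩

/-- A section of `∧^k V^*` as a section of the dual of `∧^k V`. -/
def extDual {k : ℕ} (α : (V.alt k).Γ) : (V.ext k).dual.Γ :=
  ⟨fun m => exteriorPower.alternatingMapLinearEquiv (altAt α m), fun s =>
    contMDiff_of_localSpan (fun m => exteriorPower.alternatingMapLinearEquiv (altAt α m)) (by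
      rintro _ ⟨x, rfl⟩
      simp only [exteriorPower.alternatingMapLinearEquiv_apply_ιMulti]
      exact α.2 x) s.2⟩

@[simp] theorem at'_extDual_wedge {k : ℕ} (α : (V.alt k).Γ) (x : Fin k → V.Γ) (m : M) :
    at' (extDual α) m ((wedge x).1 m) = altAt α m fun i => (x i).1 m :=
  exteriorPower.alternatingMapLinearEquiv_apply_ιMulti _ _

/-- In top degree every alternating form is a multiple of the determinant, with its value on the
frame as the factor; so evaluation on the frame is the dual coordinate. -/
theorem SmoothFamily.IsFrame.isLineFrame_alt {k : ℕ} {s : Fin k → V.Γ}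
    {ξ : Fin k → V.dual.Γ} {m : M}
    (h : IsFrame s ξ m) : IsLineFrame (detForm ξ) (evalOn s) m := by
  filter_upwards [h] with x hx
  constructor
  · exact det_eq_one_of_dual hx.1
  · intro α
    refine AlternatingMap.ext fun v => ?_
    refine (alternating_eq_det hx.1 hx.2 _ v).trans ?_
    rw [smul_eq_mul, mul_comm]
    rfl

/-- The determinant identity, applied to the universal alternating map `ιMulti`, expresses every
decomposable vector through the wedge of the frame, and decomposables determine a linear map on
`∧^k`. -/
theorem SmoothFamily.IsFrame.isLineFrame_ext {k : ℕ} {s : Fin k → V.Γ}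
    {ξ : Fin k → V.dual.Γ} {m : M}
    (h : IsFrame s ξ m) : IsLineFrame (wedge s) (extDual (detForm ξ)) m := by
  filter_upwards [h] with x hx
  constructor
  · exact (at'_extDual_wedge _ _ _).trans (det_eq_one_of_dual hx.1)
  · intro u
    have : (LinearMap.id : ⋀[ℝ]^k (V.Fib x) →ₗ[ℝ] _) =
        (LinearMap.toSpanSingleton ℝ _ ((wedge s).1 x)).comp (at' (extDual (detForm ξ)) x) := by
      refine exteriorPower.linearMap_ext (AlternatingMap.ext fun v => ?_)
      refine (alternating_eq_det hx.1 hx.2 (exteriorPower.ιMulti ℝ k) v).trans ?_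
      exact congrArg (· • _) (exteriorPower.alternatingMapLinearEquiv_apply_ιMulti
        (altAt (detForm ξ) x) v).symm
    exact LinearMap.congr_fun this u

theorem SmoothFamily.IsFramed.isLine_alt {k : ℕ} (h : V.IsFramed k) : (V.alt k).IsLine :=
  ⟨alt_isLocal k, fun m => let ⟨_, _, hs⟩ := h.2 m; ⟨_, _, IsFrame.isLineFrame_alt hs⟩⟩

theorem SmoothFamily.IsFramed.isLine_ext {k : ℕ} (h : V.IsFramed k) : (V.ext k).IsLine :=
  ⟨ext_isLocal k, fun m => let ⟨_, _, hs⟩ := h.2 m; ⟨_, _, IsFrame.isLineFrame_ext hs⟩⟩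

/-- Evaluation on a section, as a section of the double dual. -/
def evalAt (s : V.Γ) : V.dual.dual.Γ :=
  ⟨fun m =>
    { toFun := fun ξ => (show V.Fib m →ₗ[ℝ] ℝ from ξ) (s.1 m)
      map_add' := fun _ _ => rfl
      map_smul' := fun _ _ => rfl }, fun ξ => ξ.2 s⟩

/-- A functional on a line is its value on the frame vector times the coordinate. -/
theorem SmoothFamily.IsLineFrame.dual {e : V.Γ} {ξ : V.dual.Γ} {m : M} (h : IsLineFrame e ξ m) :
    IsLineFrame ξ (evalAt e) m := by
  filter_upwards [h] with x hx
  refine ⟨hx.1, fun η => LinearMap.ext fun v => ?_⟩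
  have := congrArg (show V.Fib x →ₗ[ℝ] ℝ from η) (hx.2 v)
  rw [map_smul, smul_eq_mul, mul_comm] at this
  exact this

theorem SmoothFamily.IsLine.dual (h : V.IsLine) : V.dual.IsLine :=
  ⟨dual_isLocal, fun m => let ⟨_, _, hs⟩ := h.2 m; ⟨_, _, IsLineFrame.dual hs⟩⟩

/-- The functional `ξ ⊗ η` on `V ⊗ W`. -/
def tmulDual {W : SmoothFamily.{v} E M} (ξ : V.dual.Γ) (η : W.dual.Γ) : (V.tensor W).dual.Γ :=
  ⟨fun m => LinearMap.mul' ℝ ℝ ∘ₗ TensorProduct.map (at' ξ m) (at' η m), fun s =>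
    contMDiff_of_localSpan (fun m => LinearMap.mul' ℝ ℝ ∘ₗ TensorProduct.map (at' ξ m) (at' η m)) (by
      rintro _ ⟨x, y, rfl⟩
      simp only [LinearMap.comp_apply, TensorProduct.map_tmul, LinearMap.mul'_apply]
      exact (ξ.2 x).mul (η.2 y)) s.2⟩

@[simp] theorem at'_tmulDual {W : SmoothFamily.{v} E M} (ξ : V.dual.Γ) (η : W.dual.Γ) (m : M)
    (v : V.Fib m) (w : W.Fib m) : at' (tmulDual ξ η) m (v ⊗ₜ w) = at' ξ m v * at' η m w := rfl

@[simp] theorem tmul_val {W : SmoothFamily.{v} E M} (x : V.Γ) (y : W.Γ) (m : M) :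
    (tmul x y).1 m = x.1 m ⊗ₜ[ℝ] y.1 m := rfl

theorem SmoothFamily.IsLineFrame.tensor {W : SmoothFamily.{v} E M} {e : V.Γ}
    {ξ : V.dual.Γ} {e' : W.Γ}
    {ξ' : W.dual.Γ} {m : M} (h : IsLineFrame e ξ m) (h' : IsLineFrame e' ξ' m) :
    IsLineFrame (tmul e e') (tmulDual ξ ξ') m := by
  filter_upwards [h, h'] with x hx hx'
  refine ⟨(at'_tmulDual ξ ξ' x _ _).trans (by rw [hx.1, hx'.1, one_mul]), fun u => ?_⟩
  have : (LinearMap.id : V.Fib x ⊗[ℝ] W.Fib x →ₗ[ℝ] _) =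
      (LinearMap.toSpanSingleton ℝ _ ((tmul e e').1 x)).comp (at' (tmulDual ξ ξ') x) := by
    refine TensorProduct.ext' fun v w => ?_
    conv_lhs => rw [hx.2 v, hx'.2 w]
    simp only [LinearMap.id_apply, TensorProduct.smul_tmul_smul]
    rfl
  exact LinearMap.congr_fun this u

theorem SmoothFamily.IsLine.tensor {W : SmoothFamily.{v} E M} (h : V.IsLine) (h' : W.IsLine) :
    (V.tensor W).IsLine :=
  ⟨tensor_isLocal W, fun m => let ⟨_, _, hs⟩ := h.2 m; let ⟨_, _, hs'⟩ := h'.2 m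
    ⟨_, _, IsLineFrame.tensor hs hs'⟩⟩

end Derived

/-! ### Line frames of pull-backs -/

section Pullback

variable {E : Type*} [NormedAddCommGroup E] [NormedSpace ℝ E]
  {M : Type*} [TopologicalSpace M] [ChartedSpace E M]
  {E' : Type*} [NormedAddCommGroup E'] [NormedSpace ℝ E']
  {N : Type*} [TopologicalSpace N] [ChartedSpace E' N] {V : SmoothFamily.{w} E' N}
  (φ : C^∞⟮𝓘(ℝ, E), M; 𝓘(ℝ, E'), N⟯)

theorem pullback_isLocal : (V.pullback φ).IsLocal := fun _ ht =>
  localSpan_isLocal fun m => let ⟨t', h⟩ := ht m; ⟨t'.1, t'.2, h⟩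

/-- The functional `ξ ∘ φ` on `φ^! V`. -/
def pullDual (ξ : V.dual.Γ) : (V.pullback φ).dual.Γ :=
  ⟨fun m => at' ξ (φ m), fun s =>
    contMDiff_of_localSpan (fun m => at' ξ (φ m)) (by
      rintro _ ⟨y, rfl⟩
      exact (ξ.2 y).comp φ.contMDiff) s.2⟩

theorem SmoothFamily.IsLineFrame.pullback {e : V.Γ} {ξ : V.dual.Γ} {m : M}
    (h : IsLineFrame e ξ (φ m)) :
    IsLineFrame (pullSec φ e) (pullDual φ ξ) m := by
  filter_upwards [φ.contMDiff.continuous.continuousAt.eventually h] with x hx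
  exact hx

theorem SmoothFamily.IsLine.pullback (h : V.IsLine) : (V.pullback φ).IsLine :=
  ⟨pullback_isLocal φ, fun m => let ⟨_, _, hs⟩ := h.2 (φ m); ⟨_, _, IsLineFrame.pullback φ hs⟩⟩

end Pullback

end Frames

/-! ### Derivations of section spaces over a vector field -/

section Derivations

open SmoothFamily

/-- The arguments are exchanged one slot at a time, by induction on the set of slots already
exchanged. -/
theorem MultilinearMap_eq_of_sub_mem {ι G W : Type*} [Finite ι] [AddCommGroup G] [Module ℝ G]
    [AddCommGroup W] [Module ℝ W] (w : MultilinearMap ℝ (fun _ : ι => G) W) (K : Submodule ℝ G)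
    [DecidableEq ι] (hK : ∀ s i z, z ∈ K → w (Function.update s i z) = 0) {s t : ι → G}
    (h : ∀ i, s i - t i ∈ K) : w s = w t := by
  cases nonempty_fintype ι
  have key : ∀ S : Finset ι, w (S.piecewise s t) = w t := by
    intro S
    induction S using Finset.induction_on with
    | empty => simp
    | insert i S hi ih =>
      rw [Finset.piecewise_insert, ← ih]
      have h1 := hK (S.piecewise s t) i _ (h i)
      rw [w.map_update_sub, sub_eq_zero] at h1
      rw [h1]
      congr 1
      rw [← Finset.piecewise_eq_of_notMem S s t hi, Function.update_eq_self]
  simpa using key Finset.univ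

/-- The action `v ↦ ∑ᵢ w (v₁, …, δ vᵢ, …, v_k)` of an endomorphism on alternating maps. -/
def derAction {ι G W : Type*} [Fintype ι] [DecidableEq ι] [AddCommGroup G] [Module ℝ G]
    [AddCommGroup W] [Module ℝ W] (δ : G →ₗ[ℝ] G) (w : G [⋀^ι]→ₗ[ℝ] W) : G [⋀^ι]→ₗ[ℝ] W :=
  { (∑ i, w.toMultilinearMap.compLinearMap
      (Function.update (fun _ => LinearMap.id) i δ) : MultilinearMap ℝ (fun _ : ι => G) W) with
    map_eq_zero_of_eq' := by
      intro v p q hv hpq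
      have h : ∀ i, w.toMultilinearMap.compLinearMap
          (Function.update (fun _ => LinearMap.id) i δ) v = w (Function.update v i (δ (v i))) := by
        intro i
        rw [MultilinearMap.compLinearMap_apply]
        change w _ = _
        congr 1
        funext l
        by_cases hl : l = i
        · subst hl; simp
        · simp [hl]
      change (∑ i, w.toMultilinearMap.compLinearMap
        (Function.update (fun _ => LinearMap.id) i δ)) v = 0
      -- If `v p = v q`, every term with `i ≠ p, q` still has two equal arguments and vanishes. The
      -- terms `i = p` and `i = q` differ by a transposition, so they cancel.
      rw [sum_apply, Finset.sum_congr rfl fun i _ => h i,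
        ← Finset.sum_subset (Finset.subset_univ {p, q}), Finset.sum_pair hpq]
      · have : Function.update v q (δ (v q)) =
            Function.update v p (δ (v p)) ∘ Equiv.swap p q := by
          funext l
          by_cases h1 : l = p
          · subst h1; simp [hpq, hpq.symm, hv]
          · by_cases h2 : l = q
            · subst h2; simp [hv]
            · simp [h1, h2, Equiv.swap_apply_of_ne_of_ne]
        rw [this, w.map_swap _ hpq, add_neg_cancel]
      · intro i _ hi
        simp only [Finset.mem_insert, Finset.mem_singleton, not_or] at hi
        exact w.map_eq_zero_of_eq _
          (by rw [Function.update_of_ne (Ne.symm hi.1), Function.update_of_ne (Ne.symm hi.2), hv]) hpq }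

theorem derAction_apply {ι G W : Type*} [Fintype ι] [DecidableEq ι] [AddCommGroup G] [Module ℝ G]
    [AddCommGroup W] [Module ℝ W] (δ : G →ₗ[ℝ] G) (w : G [⋀^ι]→ₗ[ℝ] W) (v : ι → G) :
    derAction δ w v = ∑ i, w (Function.update v i (δ (v i))) := by
  change (∑ i, w.toMultilinearMap.compLinearMap
    (Function.update (fun _ => LinearMap.id) i δ)) v = _
  rw [sum_apply]
  refine Finset.sum_congr rfl fun i _ => ?_
  rw [MultilinearMap.compLinearMap_apply]
  change w _ = _
  congr 1
  funext l
  by_cases hl : l = i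
  · subst hl; simp
  · simp [hl]

variable {E : Type u} [NormedAddCommGroup E] [NormedSpace ℝ E]
  {M : Type*} [TopologicalSpace M] [ChartedSpace E M]
  {V : SmoothFamily.{w} E M}

/-- `δ` is a derivation of `Γ V` over the vector field `X`. -/
def IsDer (X : ∀ m : M, TangentSpace 𝓘(ℝ, E) m) (δ : V.Γ →ₗ[ℝ] V.Γ) : Prop :=
  ∀ (f : C^∞⟮𝓘(ℝ, E), M; ℝ⟯) (s : V.Γ) (m : M),
    (δ (fsmul f s)).1 m = f m • (δ s).1 m + dirD m (X m) f • s.1 m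

/-- The value of a form on sections, as an alternating map into smooth functions. -/
def evAlt {k : ℕ} (α : (V.alt k).Γ) : V.Γ [⋀^Fin k]→ₗ[ℝ] C^∞⟮𝓘(ℝ, E), M; ℝ⟯ where
  toFun s := ⟨fun m => altAt α m fun i => (s i).1 m, α.2 s⟩
  map_update_add' s i x y := by
    ext m
    have h := ((altAt α m).compLinearMap (V.ev m)).map_update_add s i x y
    exact h
  map_update_smul' s i c x := by
    ext m
    have h := ((altAt α m).compLinearMap (V.ev m)).map_update_smul s i c x
    exact h
  map_eq_zero_of_eq' s i j h hij := by
    ext m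
    exact (altAt α m).map_eq_zero_of_eq _ (by rw [h]) hij

theorem evAlt_apply {k : ℕ} (α : (V.alt k).Γ) (s : Fin k → V.Γ) (m : M) :
    evAlt α s m = altAt α m fun i => (s i).1 m := rfl

theorem evAlt_update_fsmul {k : ℕ} (α : (V.alt k).Γ) (s : Fin k → V.Γ) (i : Fin k)
    (f : C^∞⟮𝓘(ℝ, E), M; ℝ⟯) (x : V.Γ) :
    evAlt α (Function.update s i (fsmul f x)) = f * evAlt α (Function.update s i x) := by
  ext m
  have h := ((altAt α m).compLinearMap (V.ev m)).map_update_smul s i (f m) x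
  refine Eq.trans ?_ h
  refine congrArg (altAt α m) (funext fun l => ?_)
  by_cases hl : l = i
  · subst hl; simp
  · simp [hl]

/-! ### Locality, traces and Lie derivatives of derivations -/

section Local

variable [FiniteDimensional ℝ E] [T2Space M] [IsManifold 𝓘(ℝ, E) ∞ M]

/-- Multiply the difference by a cutoff supported where it vanishes. In the Leibniz rule at `m` the
term with the derivative of the cutoff drops out, because the difference is zero at `m`. -/
theorem IsDer.congr {X : ∀ m : M, TangentSpace 𝓘(ℝ, E) m} {δ : V.Γ →ₗ[ℝ] V.Γ} (hδ : IsDer X δ)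
    {s t : V.Γ} {m : M} (h : ∀ᶠ x in 𝓝 m, s.1 x = t.1 x) : (δ s).1 m = (δ t).1 m := by
  obtain ⟨ψ, h1, h2⟩ := exists_cutoff (E := E) h
  have h0 : fsmul ψ (s - t) = 0 := by
    ext x
    by_cases hx : x ∈ tsupport ψ
    · have : s.1 x = t.1 x := h2 hx
      simp [this]
    · simp [image_eq_zero_of_notMem_tsupport hx]
  have := hδ ψ (s - t) m
  rw [h0, map_zero, h1.self_of_nhds, one_smul, sub_val, h.self_of_nhds, sub_self, smul_zero, add_zero,
    map_sub, sub_val, zero_val, eq_comm, sub_eq_zero] at this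
  exact this

/-- If `s = f e` near `m`, then `δ s = f δ e + (X f) e` at `m`. -/
theorem IsDer.apply_of_eventually {X : ∀ m : M, TangentSpace 𝓘(ℝ, E) m} {δ : V.Γ →ₗ[ℝ] V.Γ}
    (hδ : IsDer X δ) {s e : V.Γ} {f : C^∞⟮𝓘(ℝ, E), M; ℝ⟯} {m : M}
    (h : ∀ᶠ x in 𝓝 m, s.1 x = f x • e.1 x) :
    (δ s).1 m = f m • (δ e).1 m + dirD m (X m) f • e.1 m := by
  rw [← hδ f e m]
  exact hδ.congr h

/-- The trace of a derivation with respect to a local frame. -/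
def trace {k : ℕ} (s : Fin k → V.Γ) (ξ : Fin k → V.dual.Γ) (δ : V.Γ →ₗ[ℝ] V.Γ) :
    C^∞⟮𝓘(ℝ, E), M; ℝ⟯ := ∑ i, pair (ξ i) (δ (s i))

/-- Expand `ε (s i)` in the frame and apply the Leibniz rule for `δ`. The remaining double sum is
the trace of a product of coefficient matrices. It is symmetric in `δ` and `ε`, so it disappears
from the commutator. -/
theorem IsDer.trace_comp {X : ∀ m : M, TangentSpace 𝓘(ℝ, E) m} {δ ε : V.Γ →ₗ[ℝ] V.Γ}
    (hδ : IsDer X δ) {k : ℕ} {s : Fin k → V.Γ} {ξ : Fin k → V.dual.Γ}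
    {m : M} (h : IsFrame s ξ m) :
    trace s ξ (δ ∘ₗ ε) m = dirD m (X m) (trace s ξ ε) +
      ∑ i, ∑ j, pair (ξ j) (ε (s i)) m * pair (ξ i) (δ (s j)) m := by
  have hi : ∀ i, pair (ξ i) (δ (ε (s i))) m = dirD m (X m) (pair (ξ i) (ε (s i))) +
      ∑ j, pair (ξ j) (ε (s i)) m * pair (ξ i) (δ (s j)) m := by
    intro i
    have h1 : (δ (ε (s i))).1 m = (δ (∑ j, fsmul (pair (ξ j) (ε (s i))) (s j))).1 m := by
      refine hδ.congr ?_
      filter_upwards [h] with x hx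
      simp [← hx.2]
    rw [pair_apply, h1, map_sum, sum_val, map_sum, Finset.sum_congr rfl fun j _ => by
      rw [hδ, map_add, map_smul, map_smul, h.self_of_nhds.1 i j]]
    rw [Finset.sum_add_distrib, add_comm]
    congr 1
    simp
  simp only [trace, smooth_sum_apply, map_sum, LinearMap.comp_apply]
  rw [Finset.sum_congr rfl fun i _ => hi i, Finset.sum_add_distrib]

/-- The trace of a commutator of derivations. -/
theorem IsDer.trace_commutator {X Y : ∀ m : M, TangentSpace 𝓘(ℝ, E) m} {δ ε : V.Γ →ₗ[ℝ] V.Γ}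
    (hδ : IsDer X δ) (hε : IsDer Y ε) {k : ℕ} {s : Fin k → V.Γ} {ξ : Fin k → V.dual.Γ}
    {m : M} (h : IsFrame s ξ m) :
    trace s ξ (δ ∘ₗ ε - ε ∘ₗ δ) m =
      dirD m (X m) (trace s ξ ε) - dirD m (Y m) (trace s ξ δ) := by
  have h1 : trace s ξ (δ ∘ₗ ε - ε ∘ₗ δ) = trace s ξ (δ ∘ₗ ε) - trace s ξ (ε ∘ₗ δ) := by
    simp [trace]
  rw [h1, smooth_sub_apply, hδ.trace_comp h, hε.trace_comp h, Finset.sum_comm]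
  simp only [mul_comm]
  ring

/-- The Lie derivative of a form along a derivation, evaluated on sections at a point. -/
def altDerAt (X : ∀ m : M, TangentSpace 𝓘(ℝ, E) m) (δ : V.Γ →ₗ[ℝ] V.Γ) {k : ℕ} (α : (V.alt k).Γ)
    (m : M) : V.Γ [⋀^Fin k]→ₗ[ℝ] ℝ :=
  (dirD m (X m)).compAlternatingMap (evAlt α) - derAction δ ((altAt α m).compLinearMap (V.ev m))

theorem altDerAt_apply (X : ∀ m : M, TangentSpace 𝓘(ℝ, E) m) (δ : V.Γ →ₗ[ℝ] V.Γ) {k : ℕ}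
    (α : (V.alt k).Γ) (m : M) (s : Fin k → V.Γ) : altDerAt X δ α m s =
      dirD m (X m) (evAlt α s) - ∑ i, evAlt α (Function.update s i (δ (s i))) m := by
  change dirD m (X m) (evAlt α s) - derAction δ ((altAt α m).compLinearMap (V.ev m)) s = _
  rw [derAction_apply]
  rfl

/-- The derivative of `f` appears twice with opposite signs, once from differentiating the value of
`α` and once from `δ (f x)`. The two terms cancel. -/
theorem altDerAt_fsmul {X : ∀ m : M, TangentSpace 𝓘(ℝ, E) m} {δ : V.Γ →ₗ[ℝ] V.Γ} (hδ : IsDer X δ)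
    {k : ℕ} (α : (V.alt k).Γ) (m : M) (s : Fin k → V.Γ) (j : Fin k) (f : C^∞⟮𝓘(ℝ, E), M; ℝ⟯)
    (x : V.Γ) : altDerAt X δ α m (Function.update s j (fsmul f x)) =
      f m * altDerAt X δ α m (Function.update s j x) := by
  rw [altDerAt_apply, altDerAt_apply, evAlt_update_fsmul, dirD_mul]
  -- Only the summand in which `δ` hits slot `j` differentiates `f`.
  have h : ∀ i, evAlt α (Function.update (Function.update s j (fsmul f x)) i
      (δ (Function.update s j (fsmul f x) i))) m =
      f m * evAlt α (Function.update (Function.update s j x) i (δ (Function.update s j x i))) m +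
        if i = j then dirD m (X m) f * evAlt α (Function.update s j x) m else 0 := by
    intro i
    by_cases hi : i = j
    · subst hi
      simp only [Function.update_self, Function.update_idem, if_true]
      have h1 := ((altAt α m).compLinearMap (V.ev m)).map_update_smul s i (f m) (δ x)
      have h2 := ((altAt α m).compLinearMap (V.ev m)).map_update_smul s i (dirD m (X m) f) x
      have h3 := ((altAt α m).compLinearMap (V.ev m)).map_update_add s i (f m • δ x)
        (dirD m (X m) f • x)
      rw [h1, h2] at h3
      refine Eq.trans ?_ h3
      refine congrArg (altAt α m) (funext fun l => ?_)
      by_cases hl : l = i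
      · subst hl; simp [hδ f x m]
      · simp [hl]
    · rw [if_neg hi, add_zero, Function.update_of_ne hi, Function.update_of_ne hi,
        Function.update_comm (Ne.symm hi), evAlt_update_fsmul, Function.update_comm hi]
      rfl
  rw [Finset.sum_congr rfl fun i _ => h i, Finset.sum_add_distrib, ← Finset.mul_sum]
  simp only [Finset.sum_ite_eq', Finset.mem_univ, if_true]
  ring

/-- Function-linearity in each slot makes the Lie derivative depend on point values only. It can
therefore be defined on fibres by extending vectors to arbitrary sections, as `altDer` does. -/
theorem SmoothFamily.IsFramed.altDerAt_congr {n : ℕ} (hV : V.IsFramed n)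
    {X : ∀ m : M, TangentSpace 𝓘(ℝ, E) m}
    {δ : V.Γ →ₗ[ℝ] V.Γ} (hδ : IsDer X δ) {k : ℕ} (α : (V.alt k).Γ) (m : M) {s t : Fin k → V.Γ}
    (h : ∀ i, (s i).1 m = (t i).1 m) : altDerAt X δ α m s = altDerAt X δ α m t := by
  obtain ⟨e, ξ, he⟩ := hV.2 m
  refine MultilinearMap_eq_of_sub_mem (altDerAt X δ α m).toMultilinearMap
    (LinearMap.ker (V.ev m)) (fun s i z hz => ?_) fun i => ?_
  · refine he.tensorial ((altDerAt X δ α m).toMultilinearMap.toLinearMap s i) (fun f x => ?_) hz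
    exact altDerAt_fsmul hδ α m s i f x
  · simp [h]

/-- The derivation of `Γ (∧^k V^*)` induced by a derivation of `Γ V`. -/
def altDer {n : ℕ} (hV : V.IsFramed n) {X : ∀ m : M, TangentSpace 𝓘(ℝ, E) m}
    (hX : ∀ f : C^∞⟮𝓘(ℝ, E), M; ℝ⟯, ContMDiff 𝓘(ℝ, E) 𝓘(ℝ, ℝ) ∞ fun m => dirD m (X m) f)
    {δ : V.Γ →ₗ[ℝ] V.Γ} (hδ : IsDer X δ) {k : ℕ} (α : (V.alt k).Γ) : (V.alt k).Γ :=
  ⟨fun m => (altDerAt X δ α m).compLinearMap (V.lift m), fun s => by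
    have : (fun m => (altDerAt X δ α m).compLinearMap (V.lift m) fun i => (s i).1 m) = fun m =>
        dirD m (X m) (evAlt α s) - (∑ i, evAlt α (Function.update s i (δ (s i)))) m := by
      funext m
      rw [smooth_sum_apply, ← altDerAt_apply]
      obtain ⟨e, ξ, he⟩ := hV.2 m
      exact IsFramed.altDerAt_congr hV hδ α m fun i => lift_spec he.ev_surjective _
    rw [this]
    exact (hX _).sub (ContMDiffMap.contMDiff _)⟩

theorem altDer_apply {n : ℕ} (hV : V.IsFramed n) {X : ∀ m : M, TangentSpace 𝓘(ℝ, E) m}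
    (hX : ∀ f : C^∞⟮𝓘(ℝ, E), M; ℝ⟯, ContMDiff 𝓘(ℝ, E) 𝓘(ℝ, ℝ) ∞ fun m => dirD m (X m) f)
    {δ : V.Γ →ₗ[ℝ] V.Γ} (hδ : IsDer X δ) {k : ℕ} (α : (V.alt k).Γ) (s : Fin k → V.Γ) (m : M) :
    evAlt (altDer hV hX hδ α) s m =
      dirD m (X m) (evAlt α s) - ∑ i, evAlt α (Function.update s i (δ (s i))) m := by
  rw [← altDerAt_apply]
  obtain ⟨e, ξ, he⟩ := hV.2 m
  exact IsFramed.altDerAt_congr hV hδ α m fun i => lift_spec he.ev_surjective _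

end Local

end Derivations

/-! ### Vector fields -/

section VectorFields

open SmoothFamily

variable {E : Type u} [NormedAddCommGroup E] [NormedSpace ℝ E]
  {M : Type*} [TopologicalSpace M] [ChartedSpace E M] [IsManifold 𝓘(ℝ, E) ∞ M]

theorem two_le_infty : (2 : WithTop ℕ∞) ≤ ∞ := WithTop.coe_le_coe.2 (le_top : (2 : ℕ∞) ≤ ⊤)

theorem three_le_infty : (3 : WithTop ℕ∞) ≤ ∞ := WithTop.coe_le_coe.2 (le_top : (3 : ℕ∞) ≤ ⊤)

/-- The derivative of `f` along `X` is the fibre component of the tangent map of `f` composed with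
the section `X`. -/
theorem contMDiff_dirD (X : (tangent E M).Γ) (f : C^∞⟮𝓘(ℝ, E), M; ℝ⟯) :
    ContMDiff 𝓘(ℝ, E) 𝓘(ℝ, ℝ) ∞ fun m => dirD (E := E) m (X.1 m) f := by
  have h := (f.contMDiff.contMDiff_tangentMap (m := ∞) (by simp)).comp X.2
  exact (contMDiff_snd_tangentBundle_modelSpace ℝ 𝓘(ℝ, ℝ)).comp h

/-- The Lie derivative of smooth functions along a vector field. -/
def lieD (X : (tangent E M).Γ) : C^∞⟮𝓘(ℝ, E), M; ℝ⟯ →ₗ[ℝ] C^∞⟮𝓘(ℝ, E), M; ℝ⟯ where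
  toFun f := ⟨fun m => dirD (E := E) m (X.1 m) f, contMDiff_dirD X f⟩
  map_add' f g := by
    ext m
    exact map_add (dirD (E := E) m (X.1 m)) f g
  map_smul' c f := by
    ext m
    exact map_smul (dirD (E := E) m (X.1 m)) c f

theorem tangent_mdifferentiableAt (X : (tangent E M).Γ) (m : M) :
    MDifferentiableAt 𝓘(ℝ, E) (𝓘(ℝ, E).prod 𝓘(ℝ, E))
      (fun x => (TotalSpace.mk' E x (X.1 x) : TangentBundle 𝓘(ℝ, E) M)) m :=
  (X.2 m).mdifferentiableAt (by simp)

variable [FiniteDimensional ℝ E]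

/-- The Lie bracket with the vector field `X`, as a derivation of the space of vector fields. -/
def lieBr (X : (tangent E M).Γ) : (tangent E M).Γ →ₗ[ℝ] (tangent E M).Γ :=
  have : IsManifold 𝓘(ℝ, E) 1 M := IsManifold.of_le (n := ∞) (by simp)
  have : IsManifold 𝓘(ℝ, E) 2 M := IsManifold.of_le (n := ∞) two_le_infty
  have : IsManifold 𝓘(ℝ, E) (∞ + 1) M := ‹IsManifold 𝓘(ℝ, E) ∞ M›
  have : IsManifold 𝓘(ℝ, E) (minSmoothness ℝ 2) M := IsManifold.of_le (n := ∞)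
    (by simpa using two_le_infty)
  have : IsManifold 𝓘(ℝ, E) ((⊤ : ℕ∞) + 1) M := ‹IsManifold 𝓘(ℝ, E) ∞ M›
  { toFun := fun Y => ⟨VectorField.mlieBracket 𝓘(ℝ, E) X.1 Y.1,
      ContDiff.mlieBracket_vectorField (m := ⊤) (n := ⊤) X.2 Y.2 (by simp)⟩
    map_add' := fun Y Z => by
      ext m
      exact VectorField.mlieBracket_add_right (tangent_mdifferentiableAt Y m)
        (tangent_mdifferentiableAt Z m)
    map_smul' := fun c Y => by
      ext m
      exact VectorField.mlieBracket_const_smul_right (tangent_mdifferentiableAt Y m) }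

theorem isDer_lieBr (X : (tangent E M).Γ) : IsDer X.1 (lieBr X) := fun f Y m => by
  have : IsManifold 𝓘(ℝ, E) 2 M := IsManifold.of_le (n := ∞) two_le_infty
  refine (VectorField.mlieBracket_smul_right (mdifferentiableAt_smooth f m)
    (tangent_mdifferentiableAt Y m)).trans ?_
  rw [add_comm]
  rfl

theorem lieBr_fsmul_left (X Y : (tangent E M).Γ) (f : C^∞⟮𝓘(ℝ, E), M; ℝ⟯) (m : M) :
    (lieBr (fsmul f X) Y).1 m = f m • (lieBr X Y).1 m - dirD (E := E) m (Y.1 m) f • X.1 m := by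
  have : IsManifold 𝓘(ℝ, E) 2 M := IsManifold.of_le (n := ∞) two_le_infty
  refine (VectorField.mlieBracket_smul_left (mdifferentiableAt_smooth f m)
    (tangent_mdifferentiableAt X m)).trans ?_
  rw [add_comm, neg_smul, ← sub_eq_add_neg]
  rfl

theorem lieBr_add_left (X X' Y : (tangent E M).Γ) :
    lieBr (X + X') Y = lieBr X Y + lieBr X' Y := by
  have : IsManifold 𝓘(ℝ, E) 2 M := IsManifold.of_le (n := ∞) two_le_infty
  ext m
  exact VectorField.mlieBracket_add_left (tangent_mdifferentiableAt X m)
    (tangent_mdifferentiableAt X' m)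

theorem lieBr_smul_left (c : ℝ) (X Y : (tangent E M).Γ) :
    lieBr (c • X) Y = c • lieBr X Y := by
  have : IsManifold 𝓘(ℝ, E) 2 M := IsManifold.of_le (n := ∞) two_le_infty
  ext m
  exact VectorField.mlieBracket_const_smul_left (tangent_mdifferentiableAt X m)

theorem lieBr_jacobi (X Y : (tangent E M).Γ) :
    lieBr X ∘ₗ lieBr Y - lieBr Y ∘ₗ lieBr X = lieBr (lieBr X Y) := by
  have : IsManifold 𝓘(ℝ, E) (minSmoothness ℝ 3) M := IsManifold.of_le (n := ∞)
    (by simpa using three_le_infty)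
  refine LinearMap.ext fun Z => Γ_ext fun m => ?_
  have := VectorField.leibniz_identity_mlieBracket_apply (I := 𝓘(ℝ, E)) (x := m)
    ((X.2 m).of_le (by simpa using two_le_infty)) ((Y.2 m).of_le (by simpa using two_le_infty))
    ((Z.2 m).of_le (by simpa using two_le_infty))
  change (lieBr X (lieBr Y Z)).1 m - (lieBr Y (lieBr X Z)).1 m = _
  rw [sub_eq_iff_eq_add]
  exact this

variable [T2Space M]

/-- The bracket of vector fields acts on functions as the commutator. -/
theorem dirD_lieBr (X Y : (tangent E M).Γ) (f : C^∞⟮𝓘(ℝ, E), M; ℝ⟯) (m : M) :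
    dirD (E := E) m ((lieBr X Y).1 m) f = dirD (E := E) m (X.1 m) (lieD Y f) -
      dirD (E := E) m (Y.1 m) (lieD X f) := by
  -- Apply the Jacobi identity to `f Z` and expand by Leibniz. The terms with first derivatives of
  -- `f` cancel, and what is left is the discrepancy times `Z`.
  have key : ∀ Z : (tangent E M).Γ, (dirD (E := E) m (X.1 m) (lieD Y f) -
      dirD (E := E) m (Y.1 m) (lieD X f) - dirD (E := E) m ((lieBr X Y).1 m) f) • Z.1 m = 0 := by
    intro Z
    have hexp : ∀ X Y : (tangent E M).Γ, (lieBr X (lieBr Y (fsmul f Z))).1 m =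
        f m • (lieBr X (lieBr Y Z)).1 m + dirD (E := E) m (X.1 m) f • (lieBr Y Z).1 m +
        (dirD (E := E) m (Y.1 m) f • (lieBr X Z).1 m +
          dirD (E := E) m (X.1 m) (lieD Y f) • Z.1 m) := by
      intro X Y
      have h1 : lieBr Y (fsmul f Z) = fsmul f (lieBr Y Z) + fsmul (lieD Y f) Z :=
        Γ_ext fun x => isDer_lieBr Y f Z x
      rw [h1, map_add, add_val]
      exact congrArg₂ (· + ·) (isDer_lieBr X f (lieBr Y Z) m) (isDer_lieBr X (lieD Y f) Z m)
    have hj : ∀ Z : (tangent E M).Γ, (lieBr X (lieBr Y Z)).1 m - (lieBr Y (lieBr X Z)).1 m =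
        (lieBr (lieBr X Y) Z).1 m := fun Z => by
      rw [← lieBr_jacobi]
      rfl
    have h1 := hj (fsmul f Z)
    rw [hexp, hexp, isDer_lieBr (lieBr X Y), ← hj Z] at h1
    rw [← sub_eq_zero] at h1
    rw [← h1]
    module
  -- A nonzero discrepancy would force the tangent space at `m` to be zero, since every tangent
  -- vector is a value of some `Z`. In that case both sides vanish anyway.
  by_contra hne
  have hz : ∀ v : TangentSpace 𝓘(ℝ, E) m, v = 0 := fun v => by
    obtain ⟨e, ξ, he⟩ := (tangent_isFramed (E := E) (M := M)).2 m
    obtain ⟨Z, hZ⟩ := he.ev_surjective v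
    have h := (smul_eq_zero.1 (key Z)).resolve_left fun h => hne (sub_eq_zero.1 h).symm
    rw [← hZ]
    exact h
  refine hne ?_
  rw [hz ((lieBr X Y).1 m), hz (X.1 m), hz (Y.1 m)]
  have h0 : ∀ g : C^∞⟮𝓘(ℝ, E), M; ℝ⟯, dirD (E := E) m (0 : TangentSpace 𝓘(ℝ, E) m) g = 0 := fun g =>
    map_zero (mfderiv 𝓘(ℝ, E) 𝓘(ℝ, ℝ) g m)
  exact (h0 f).trans (by rw [h0 (lieD Y f), h0 (lieD X f), sub_zero])

end VectorFields

/-! ### Connections on line bundles -/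

section Connections

open SmoothFamily

variable {E : Type u} [NormedAddCommGroup E] [NormedSpace ℝ E]
  {F : Type*} [NormedAddCommGroup F] [NormedSpace ℝ F]
  {M : Type*} [TopologicalSpace M] [ChartedSpace E M] [IsManifold 𝓘(ℝ, E) ∞ M]
  {A : M → Type v} [TopologicalSpace (TotalSpace F A)] [∀ m, AddCommGroup (A m)]
  [∀ m, Module ℝ (A m)] [∀ m, TopologicalSpace (A m)] [FiberBundle F A] [VectorBundle ℝ F A]

namespace LieAlgebroid

variable (𝔸 : LieAlgebroid E F A)

/-- The vector field `ρ(a)`. -/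
def anchorSec (a : 𝔸.bundle.Γ) : (tangent E M).Γ :=
  ⟨fun m => 𝔸.anchor m (a.1 m), 𝔸.contMDiff_anchor.comp a.2⟩

theorem anchorSec_val (a : 𝔸.bundle.Γ) (m : M) : (𝔸.anchorSec a).1 m = 𝔸.anchor m (a.1 m) := rfl

/-- The derivative `ρ(a) · f` of a smooth function. -/
def act (a : 𝔸.bundle.Γ) : C^∞⟮𝓘(ℝ, E), M; ℝ⟯ →ₗ[ℝ] C^∞⟮𝓘(ℝ, E), M; ℝ⟯ := lieD (𝔸.anchorSec a)

theorem act_apply (a : 𝔸.bundle.Γ) (f : C^∞⟮𝓘(ℝ, E), M; ℝ⟯) (m : M) :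
    𝔸.act a f m = 𝔸.der a f m := rfl

theorem act_eq_dirD (a : 𝔸.bundle.Γ) (f : C^∞⟮𝓘(ℝ, E), M; ℝ⟯) (m : M) :
    𝔸.act a f m = dirD m (𝔸.anchor m (a.1 m)) f := rfl

theorem act_mul (a : 𝔸.bundle.Γ) (f g : C^∞⟮𝓘(ℝ, E), M; ℝ⟯) :
    𝔸.act a (f * g) = f * 𝔸.act a g + 𝔸.act a f * g := by
  ext m
  exact dirD_mul m _ f g

theorem act_add_left (a b : 𝔸.bundle.Γ) (f : C^∞⟮𝓘(ℝ, E), M; ℝ⟯) (m : M) :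
    𝔸.act (a + b) f m = 𝔸.act a f m + 𝔸.act b f m := by
  rw [act_eq_dirD, add_val, map_add]
  exact map_add (mfderiv 𝓘(ℝ, E) 𝓘(ℝ, ℝ) f m) _ _

theorem act_smul_left (c : ℝ) (a : 𝔸.bundle.Γ) (f : C^∞⟮𝓘(ℝ, E), M; ℝ⟯) (m : M) :
    𝔸.act (c • a) f m = c * 𝔸.act a f m := by
  rw [act_eq_dirD, smul_val, map_smul]
  exact map_smul (mfderiv 𝓘(ℝ, E) 𝓘(ℝ, ℝ) f m) _ _

theorem act_fsmul_left (g : C^∞⟮𝓘(ℝ, E), M; ℝ⟯) (a : 𝔸.bundle.Γ) (f : C^∞⟮𝓘(ℝ, E), M; ℝ⟯) (m : M) :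
    𝔸.act (fsmul g a) f m = g m * 𝔸.act a f m := by
  rw [act_eq_dirD, fsmul_val, map_smul]
  exact map_smul (mfderiv 𝓘(ℝ, E) 𝓘(ℝ, ℝ) f m) _ _

theorem act_congr (a : 𝔸.bundle.Γ) {f g : C^∞⟮𝓘(ℝ, E), M; ℝ⟯} {m : M}
    (h : ∀ᶠ x in 𝓝 m, f x = g x) : 𝔸.act a f m = 𝔸.act a g m := dirD_congr _ h

/-- A function with locally constant square has vanishing derivatives where it does not vanish. -/
theorem act_eq_zero_of_sq (a : 𝔸.bundle.Γ) {h : C^∞⟮𝓘(ℝ, E), M; ℝ⟯} {m : M}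
    (hh : ∀ᶠ x in 𝓝 m, h x * h x = 1) : 𝔸.act a h m = 0 := by
  have h0 : 𝔸.act a (h * h) m = 0 :=
    dirD_eq_zero_of_eventually_const (f := h * h) _ hh
  have h1 := hh.self_of_nhds
  rw [act_mul, smooth_add_apply, smooth_mul_apply, smooth_mul_apply] at h0
  have h2 : h m ≠ 0 := fun hz => by rw [hz, zero_mul] at h1; exact zero_ne_one h1
  have h3 : h m * 𝔸.act a h m = 0 := by linarith [mul_comm (h m) (𝔸.act a h m)]
  exact (mul_eq_zero.1 h3).resolve_left h2

/-! ### Differentials of functions and closed 1-forms -/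

section Forms

/-- The pairing of a 1-form with sections of `A`. -/
def pairing (β : 𝔸.Form 1) : 𝔸.bundle.Γ →ₗ[ℝ] C^∞⟮𝓘(ℝ, E), M; ℝ⟯ where
  toFun a := evAlt β fun _ => a
  map_add' a b := by
    ext m
    exact map_add ((AlternatingMap.ofSubsingleton ℝ (A m) ℝ (0 : Fin 1)).symm (altAt β m))
      (a.1 m) (b.1 m)
  map_smul' c a := by
    ext m
    exact map_smul ((AlternatingMap.ofSubsingleton ℝ (A m) ℝ (0 : Fin 1)).symm (altAt β m))
      c (a.1 m)

theorem pairing_apply (β : 𝔸.Form 1) (a : 𝔸.bundle.Γ) (m : M) :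
    𝔸.pairing β a m = β.1 m fun _ => a.1 m := rfl

theorem pairing_fsmul (β : 𝔸.Form 1) (f : C^∞⟮𝓘(ℝ, E), M; ℝ⟯) (a : 𝔸.bundle.Γ) (m : M) :
    𝔸.pairing β (fsmul f a) m = f m * 𝔸.pairing β a m :=
  map_smul ((AlternatingMap.ofSubsingleton ℝ (A m) ℝ (0 : Fin 1)).symm (altAt β m)) (f m) (a.1 m)

@[simp] theorem pairing_add_left (β γ : 𝔸.Form 1) (a : 𝔸.bundle.Γ) :
    𝔸.pairing (β + γ) a = 𝔸.pairing β a + 𝔸.pairing γ a := by ext m; rfl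

@[simp] theorem pairing_neg_left (β : 𝔸.Form 1) (a : 𝔸.bundle.Γ) :
    𝔸.pairing (-β) a = -𝔸.pairing β a := by ext m; rfl

/-- The 1-form with given values. -/
def mkForm (T : ∀ m, A m →ₗ[ℝ] ℝ)
    (hT : ∀ a : 𝔸.bundle.Γ, ContMDiff 𝓘(ℝ, E) 𝓘(ℝ, ℝ) ∞ fun m => T m (a.1 m)) : 𝔸.Form 1 :=
  ⟨fun m => AlternatingMap.ofSubsingleton ℝ (A m) ℝ (0 : Fin 1) (T m), fun a => hT (a 0)⟩

theorem pairing_mkForm (T : ∀ m, A m →ₗ[ℝ] ℝ)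
    (hT : ∀ a : 𝔸.bundle.Γ, ContMDiff 𝓘(ℝ, E) 𝓘(ℝ, ℝ) ∞ fun m => T m (a.1 m))
    (a : 𝔸.bundle.Γ) (m : M) : 𝔸.pairing (𝔸.mkForm T hT) a m = T m (a.1 m) := rfl

theorem dValue_one (β : 𝔸.Form 1) (a : Fin 2 → 𝔸.bundle.Γ) (m : M) :
    𝔸.dValue β.1 a m = 𝔸.act (a 0) (𝔸.pairing β (a 1)) m - 𝔸.act (a 1) (𝔸.pairing β (a 0)) m -
      𝔸.pairing β (𝔸.bracket (a 0) (a 1)) m := by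
  have h1 : Finset.univ.filter (fun j : Fin 2 => 0 < j) = {1} := by decide
  have h2 : Finset.univ.filter (fun j : Fin 2 => 1 < j) = ∅ := by decide
  have e0 : (fun (x : M) (l : Fin 1) => (a ((0 : Fin 2).succAbove l)).1 x) =
      fun x _ => (a 1).1 x := by
    funext x l
    fin_cases l
    rfl
  have e1 : (fun (x : M) (l : Fin 1) => (a ((1 : Fin 2).succAbove l)).1 x) =
      fun x _ => (a 0).1 x := by
    funext x l
    fin_cases l
    rfl
  have e2 : (fun (l : Fin 1) =>
      (Function.update a 1 (𝔸.bracket (a 0) (a 1)) ((0 : Fin 2).succAbove l)).1 m) =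
      fun _ => (𝔸.bracket (a 0) (a 1)).1 m := by
    funext l
    fin_cases l
    rfl
  have e0' : (fun x => β.1 x fun l => (a ((0 : Fin 2).succAbove l)).1 x) =
      (𝔸.pairing β (a 1) : M → ℝ) := by
    funext x
    exact congrArg (β.1 x) (congrFun e0 x)
  have e1' : (fun x => β.1 x fun l => (a ((1 : Fin 2).succAbove l)).1 x) =
      (𝔸.pairing β (a 0) : M → ℝ) := by
    funext x
    exact congrArg (β.1 x) (congrFun e1 x)
  rw [dValue, Fin.sum_univ_two, Fin.sum_univ_two, h1, h2, Finset.sum_singleton, Finset.sum_empty,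
    e0', e1', e2]
  simp only [Fin.val_zero, pow_zero, one_mul, Fin.val_one, pow_one, add_zero, act_apply,
    pairing_apply]
  ring

theorem mem_closed_iff (β : 𝔸.Form 1) : β ∈ 𝔸.closed ↔ ∀ (a b : 𝔸.bundle.Γ) (m : M),
    𝔸.act a (𝔸.pairing β b) m - 𝔸.act b (𝔸.pairing β a) m = 𝔸.pairing β (𝔸.bracket a b) m := by
  constructor
  · intro h a b m
    have h1 := h ![a, b] m
    rw [dValue_one] at h1
    exact (sub_eq_zero.1 h1.symm)
  · intro h a m
    rw [dValue_one, h, sub_self]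
    rfl

theorem dValue_zero_form (α : ∀ m, A m [⋀^Fin 0]→ₗ[ℝ] ℝ) (a : Fin 1 → 𝔸.bundle.Γ) (m : M) :
    𝔸.dValue α a m = 𝔸.der (a 0) (fun x => α x 0) m := by
  have h2 : (Finset.univ.filter (fun j : Fin 1 => 0 < j)) = ∅ := by decide
  have e : ∀ v : ∀ x, Fin 0 → A x, (fun x => α x (v x)) = fun x => α x 0 := fun v =>
    funext fun x => congrArg (α x) (Subsingleton.elim _ _)
  rw [dValue, Fin.sum_univ_one, Fin.sum_univ_one, h2, Finset.sum_empty, sub_zero, Fin.val_zero,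
    pow_zero, one_mul, e]

/-- A smooth function as a 0-form. -/
def zeroForm (f : C^∞⟮𝓘(ℝ, E), M; ℝ⟯) : 𝔸.Form 0 :=
  ⟨fun m => AlternatingMap.constOfIsEmpty ℝ (A m) (Fin 0) (f m), fun _ => f.contMDiff⟩

/-- The differential of a smooth function. -/
def dForm (f : C^∞⟮𝓘(ℝ, E), M; ℝ⟯) : 𝔸.Form 1 :=
  𝔸.mkForm (fun m => (mfderiv 𝓘(ℝ, E) 𝓘(ℝ, ℝ) f m).toLinearMap ∘ₗ 𝔸.anchor m)
    fun a => (𝔸.act a f).contMDiff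

@[simp] theorem pairing_dForm (f : C^∞⟮𝓘(ℝ, E), M; ℝ⟯) (a : 𝔸.bundle.Γ) :
    𝔸.pairing (𝔸.dForm f) a = 𝔸.act a f := by ext m; rfl

theorem isDifferential_dForm (f : C^∞⟮𝓘(ℝ, E), M; ℝ⟯) :
    𝔸.IsDifferential (𝔸.zeroForm f).1 (𝔸.dForm f).1 := fun a m => by
  rw [dValue_zero_form]
  rfl

theorem dForm_mem_exact (f : C^∞⟮𝓘(ℝ, E), M; ℝ⟯) : 𝔸.dForm f ∈ 𝔸.exact :=
  ⟨𝔸.zeroForm f, 𝔸.isDifferential_dForm f⟩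

end Forms

variable {𝔸} {V : SmoothFamily.{w} E M}

theorem IsConnection.isDer {D : 𝔸.Op V} (hD : 𝔸.IsConnection D) (a : 𝔸.bundle.Γ) :
    IsDer (fun m => 𝔸.anchor m (a.1 m)) (D a) := fun f s m => hD.fsmul_right f a s m

variable [FiniteDimensional ℝ E] [T2Space M]

theorem anchorSec_bracket (a b : 𝔸.bundle.Γ) :
    𝔸.anchorSec (𝔸.bracket a b) = lieBr (𝔸.anchorSec a) (𝔸.anchorSec b) :=
  Γ_ext fun m => 𝔸.anchor_bracket a b m

/-- The anchor preserves brackets, so the claim reduces to vector fields. -/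
theorem act_bracket (a b : 𝔸.bundle.Γ) (f : C^∞⟮𝓘(ℝ, E), M; ℝ⟯) (m : M) :
    𝔸.act (𝔸.bracket a b) f m = 𝔸.act a (𝔸.act b f) m - 𝔸.act b (𝔸.act a f) m := by
  change lieD (𝔸.anchorSec (𝔸.bracket a b)) f m = _
  rw [anchorSec_bracket]
  exact dirD_lieBr _ _ f m

/-- If `s = f e` near `m`, then `D(a) s = f D(a) e + (a f) e` at `m`. -/
theorem IsConnection.apply_of_eventually {D : 𝔸.Op V} (hD : 𝔸.IsConnection D) (a : 𝔸.bundle.Γ)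
    {s e : V.Γ} {f : C^∞⟮𝓘(ℝ, E), M; ℝ⟯} {m : M} (h : ∀ᶠ x in 𝓝 m, s.1 x = f x • e.1 x) :
    (D a s).1 m = f m • (D a e).1 m + 𝔸.act a f m • e.1 m :=
  (hD.isDer a).apply_of_eventually h

/-- The curvature of a connection, computed in a local frame. -/
theorem IsConnection.curvature_apply {D : 𝔸.Op V} (hD : 𝔸.IsConnection D)
    {θ : 𝔸.bundle.Γ → C^∞⟮𝓘(ℝ, E), M; ℝ⟯} {s e : V.Γ} {f : C^∞⟮𝓘(ℝ, E), M; ℝ⟯} {m : M}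
    (he : ∀ a, ∀ᶠ x in 𝓝 m, (D a e).1 x = θ a x • e.1 x)
    (hs : ∀ᶠ x in 𝓝 m, s.1 x = f x • e.1 x) (a b : 𝔸.bundle.Γ) :
    (D a (D b s)).1 m - (D b (D a s)).1 m - (D (𝔸.bracket a b) s).1 m =
      (f m * (𝔸.act a (θ b) m - 𝔸.act b (θ a) m - θ (𝔸.bracket a b) m)) • e.1 m := by
  have h1 : ∀ a, ∀ (g : C^∞⟮𝓘(ℝ, E), M; ℝ⟯) (t : V.Γ), (∀ᶠ x in 𝓝 m, t.1 x = g x • e.1 x) →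
      ∀ᶠ x in 𝓝 m, (D a t).1 x = (𝔸.act a g + g * θ a) x • e.1 x := fun a g t ht => by
    filter_upwards [eventually_eventually_nhds.2 ht, he a] with x h2 h3
    rw [hD.apply_of_eventually a h2, h3, smooth_add_apply, smooth_mul_apply]
    module
  rw [(h1 a _ _ (h1 b _ _ hs)).self_of_nhds, (h1 b _ _ (h1 a _ _ hs)).self_of_nhds,
    (h1 _ _ _ hs).self_of_nhds]
  simp only [map_add, act_mul, smooth_add_apply, smooth_mul_apply, act_bracket]
  module

/-- A connection on a line bundle is flat if it is given by closed forms in local frames. -/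
theorem IsConnection.isRepresentation_of_frames {D : 𝔸.Op V} (hD : 𝔸.IsConnection D)
    (h : ∀ m, ∃ (e : V.Γ) (ξ : V.dual.Γ) (θ : 𝔸.bundle.Γ → C^∞⟮𝓘(ℝ, E), M; ℝ⟯),
      IsLineFrame e ξ m ∧ (∀ a, ∀ᶠ x in 𝓝 m, (D a e).1 x = θ a x • e.1 x) ∧
      ∀ a b, 𝔸.act a (θ b) m - 𝔸.act b (θ a) m = θ (𝔸.bracket a b) m) : 𝔸.IsRepresentation D := by
  refine ⟨hD, fun a b s => Γ_ext fun m => ?_⟩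
  obtain ⟨e, ξ, θ, he, hθ, hcl⟩ := h m
  have h1 := hD.curvature_apply hθ (he.mono fun x hx => hx.2 (s.1 x) :
    ∀ᶠ x in 𝓝 m, s.1 x = pair ξ s x • e.1 x) a b
  rw [hcl, sub_self, mul_zero, zero_smul, sub_eq_zero] at h1
  exact h1

/-- Two connections which agree on local frames are equal. -/
theorem IsConnection.ext_frames {D D' : 𝔸.Op V} (hD : 𝔸.IsConnection D) (hD' : 𝔸.IsConnection D')
    (h : ∀ m, ∃ (e : V.Γ) (ξ : V.dual.Γ), IsLineFrame e ξ m ∧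
      ∀ a, (D a e).1 m = (D' a e).1 m) : D = D' := by
  refine LinearMap.ext fun a => LinearMap.ext fun s => Γ_ext fun m => ?_
  obtain ⟨e, ξ, he, hDe⟩ := h m
  have hs : ∀ᶠ x in 𝓝 m, s.1 x = pair ξ s x • e.1 x := he.mono fun x hx => hx.2 _
  rw [hD.apply_of_eventually a hs, hD'.apply_of_eventually a hs, hDe]

/-- A connection on a line bundle can be prescribed on local frames, if the prescription is
compatible with changes of frame. -/
theorem exists_connection_of_frames (hV : V.IsLocal) (e : M → V.Γ) (ξ : M → V.dual.Γ)
    (he : ∀ m, IsLineFrame (e m) (ξ m) m) (Δ : M → 𝔸.bundle.Γ →ₗ[ℝ] V.Γ)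
    (hΔ : ∀ m₀ a, ∀ᶠ m in 𝓝 m₀, (Δ m₀ a).1 m = pair (ξ m) (e m₀) m • (Δ m a).1 m +
      𝔸.act a (pair (ξ m) (e m₀)) m • (e m).1 m)
    (hlin : ∀ m (f : C^∞⟮𝓘(ℝ, E), M; ℝ⟯) a, (Δ m (fsmul f a)).1 m = f m • (Δ m a).1 m) :
    ∃ D : 𝔸.Op V, 𝔸.IsConnection D ∧ ∀ a s m, (D a s).1 m =
      pair (ξ m) s m • (Δ m a).1 m + 𝔸.act a (pair (ξ m) s) m • (e m).1 m := by
  -- The value at `m` is computed in the frame attached to `m`, which need not vary smoothly with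
  -- `m`. Smoothness near `m₀` follows by comparison with the same formula in the fixed frame `e
  -- m₀`; the compatibility `hΔ` is what makes the two agree.
  let D₀ : 𝔸.bundle.Γ → V.Γ → V.Γ := fun a s =>
    ⟨fun m => pair (ξ m) s m • (Δ m a).1 m + 𝔸.act a (pair (ξ m) s) m • (e m).1 m, hV _ fun m₀ => by
      refine ⟨fsmul (pair (ξ m₀) s) (Δ m₀ a) + fsmul (𝔸.act a (pair (ξ m₀) s)) (e m₀), ?_⟩
      filter_upwards [hΔ m₀ a, (he m₀).eventually] with m h1 h2
      have h3 : 𝔸.act a (pair (ξ m) s) m =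
          𝔸.act a (pair (ξ m₀) s * pair (ξ m) (e m₀)) m := by
        refine 𝔸.act_congr a ?_
        filter_upwards [h2] with x hx
        have := congrArg (at' (ξ m) x) (hx.2 (s.1 x))
        rw [map_smul] at this
        exact this
      have h4 : pair (ξ m) s m = pair (ξ m₀) s m * pair (ξ m) (e m₀) m := by
        have := congrArg (at' (ξ m) m) (h2.self_of_nhds.2 (s.1 m))
        rw [map_smul] at this
        exact this
      have h5 : (e m₀).1 m = pair (ξ m) (e m₀) m • (e m).1 m :=
        (he m).self_of_nhds.2 _
      rw [h3, h4, act_mul, add_val, fsmul_val, fsmul_val, h1, h5]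
      simp only [smooth_add_apply, smooth_mul_apply]
      module⟩
  have hD₀ : ∀ a s m, (D₀ a s).1 m =
      pair (ξ m) s m • (Δ m a).1 m + 𝔸.act a (pair (ξ m) s) m • (e m).1 m := fun _ _ _ => rfl
  refine ⟨LinearMap.mk₂ ℝ D₀ ?_ ?_ ?_ ?_, ⟨?_, ?_⟩, fun a s m => ?_⟩
  · intro a a' s
    ext m
    rw [add_val, hD₀, hD₀, hD₀, map_add, add_val, act_add_left]
    module
  · intro c a s
    ext m
    rw [smul_val, hD₀, hD₀, map_smul, smul_val, act_smul_left]
    module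
  · intro a s s'
    ext m
    rw [add_val, hD₀, hD₀, hD₀, map_add, map_add, smooth_add_apply, smooth_add_apply]
    module
  · intro c a s
    ext m
    rw [smul_val, hD₀, hD₀, map_smul, map_smul, smooth_smul_apply, smooth_smul_apply]
    module
  · intro f a s
    ext m
    rw [fsmul_val, LinearMap.mk₂_apply, LinearMap.mk₂_apply, hD₀, hD₀, hlin, act_fsmul_left]
    module
  · intro f a s m
    rw [LinearMap.mk₂_apply, LinearMap.mk₂_apply, hD₀, hD₀, pair_fsmul, act_mul]
    have h5 : s.1 m = pair (ξ m) s m • (e m).1 m := (he m).self_of_nhds.2 _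
    rw [h5, ← act_apply]
    simp only [smooth_add_apply, smooth_mul_apply]
    module
  · exact hD₀ a s m

end LieAlgebroid

/-! ### Unit vectors -/

/-- `U` selects a pair of opposite vectors in each fibre of the line bundle `V`, which form smooth
local frames. -/
structure IsUnits (V : SmoothFamily.{w} E M) (U : ∀ m, Set (V.Fib m)) : Prop where
  isLocal : V.IsLocal
  frame : ∀ m, ∃ (e : V.Γ) (ξ : V.dual.Γ), IsLineFrame e ξ m ∧ ∀ᶠ x in 𝓝 m, e.1 x ∈ U x
  eq_or_neg : ∀ m, ∀ v ∈ U m, ∀ w ∈ U m, w = v ∨ w = -v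

/-- The ratio of two unit sections is a sign. The squared form avoids deciding which sign and is
exactly what `act_eq_zero_of_sq` needs. -/
theorem IsUnits.ratio {V : SmoothFamily.{w} E M} {U : ∀ m, Set (V.Fib m)} (hU : IsUnits V U)
    {m : M} {e e' : V.Γ} {ξ : V.dual.Γ} (he : IsLineFrame e ξ m) (h : ∀ᶠ x in 𝓝 m, e.1 x ∈ U x)
    (h' : ∀ᶠ x in 𝓝 m, e'.1 x ∈ U x) : ∀ᶠ x in 𝓝 m, pair ξ e' x * pair ξ e' x = 1 := by
  filter_upwards [he, h, h'] with x hx h1 h2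
  rcases hU.eq_or_neg x _ h1 _ h2 with h3 | h3
  · rw [pair_apply, h3, hx.1, one_mul]
  · rw [pair_apply, h3, map_neg, hx.1]
    norm_num

namespace LieAlgebroid

variable {𝔸 : LieAlgebroid E F A} {V : SmoothFamily.{w} E M} {U : ∀ m, Set (V.Fib m)}

/-- `D` acts on unit sections by multiplication by `β`. -/
def IsUnitForm (D : 𝔸.Op V) (U : ∀ m, Set (V.Fib m)) (β : 𝔸.Form 1) : Prop :=
  ∀ m, ∃ e : V.Γ, (∀ᶠ x in 𝓝 m, e.1 x ∈ U x) ∧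
    ∀ a, (D a e).1 m = 𝔸.pairing β a m • e.1 m

variable [FiniteDimensional ℝ E] [T2Space M]

/-- The definition of a unit form supplies just one unit section at each point. Any other differs
from it by a function of square 1, which has no derivative, so the same coefficient serves for all
of them; the rest is the Leibniz rule. -/
theorem IsUnitForm.apply {D : 𝔸.Op V} {β : 𝔸.Form 1} (h : IsUnitForm D U β)
    (hD : 𝔸.IsConnection D) (hU : IsUnits V U) {m : M} {e s : V.Γ}
    (he : ∀ᶠ x in 𝓝 m, e.1 x ∈ U x) {f : C^∞⟮𝓘(ℝ, E), M; ℝ⟯}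
    (hs : ∀ᶠ x in 𝓝 m, s.1 x = f x • e.1 x) (a : 𝔸.bundle.Γ) :
    (D a s).1 m = (𝔸.act a f m + f m * 𝔸.pairing β a m) • e.1 m := by
  obtain ⟨e₀, ξ, he₀, hU₀⟩ := hU.frame m
  obtain ⟨e₁, hU₁, h₁⟩ := h m
  have r := hU.ratio he₀ hU₀ he
  have r₁ := hU.ratio he₀ hU₀ hU₁
  -- Both unit sections are compared with `e₀`; a ratio with square 1 is its own inverse, so the
  -- transition factor is a product.
  have heq : ∀ᶠ x in 𝓝 m, e.1 x = (pair ξ e * pair ξ e₁) x • e₁.1 x := by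
    filter_upwards [he₀, r₁] with x hx hr
    conv_lhs => rw [hx.2 (e.1 x)]
    conv_rhs => rw [hx.2 (e₁.1 x)]
    rw [smul_smul, smooth_mul_apply, mul_assoc]
    rw [show pair ξ e₁ x * at' ξ x (e₁.1 x) = 1 from hr, mul_one]
    rfl
  have h0 : 𝔸.act a (pair ξ e * pair ξ e₁) m = 0 := by
    rw [act_mul, smooth_add_apply, smooth_mul_apply, smooth_mul_apply,
      𝔸.act_eq_zero_of_sq a r, 𝔸.act_eq_zero_of_sq a r₁]
    ring
  have hDe : (D a e).1 m = 𝔸.pairing β a m • e.1 m := by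
    rw [hD.apply_of_eventually a heq, h0, h₁, heq.self_of_nhds]
    module
  rw [hD.apply_of_eventually a hs, hDe]
  module

theorem IsUnitForm.eventually_apply {D : 𝔸.Op V} {β : 𝔸.Form 1} (h : IsUnitForm D U β)
    (hD : 𝔸.IsConnection D) (hU : IsUnits V U) {m : M} {e s : V.Γ}
    (he : ∀ᶠ x in 𝓝 m, e.1 x ∈ U x) {f : C^∞⟮𝓘(ℝ, E), M; ℝ⟯}
    (hs : ∀ᶠ x in 𝓝 m, s.1 x = f x • e.1 x) (a : 𝔸.bundle.Γ) :
    ∀ᶠ x in 𝓝 m, (D a s).1 x = (𝔸.act a f + f * 𝔸.pairing β a) x • e.1 x := by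
  filter_upwards [eventually_eventually_nhds.2 he, eventually_eventually_nhds.2 hs] with x h1 h2
  exact h.apply hD hU h1 h2 a

/-- A connection on a line bundle with units is determined by its 1-form. -/
theorem IsUnitForm.unique {D D' : 𝔸.Op V} {β : 𝔸.Form 1} (h : IsUnitForm D U β)
    (h' : IsUnitForm D' U β) (hD : 𝔸.IsConnection D) (hD' : 𝔸.IsConnection D')
    (hU : IsUnits V U) : D = D' := by
  refine hD.ext_frames hD' fun m => ?_
  obtain ⟨e, ξ, he, hU₀⟩ := hU.frame m
  have h1 : ∀ᶠ x in 𝓝 m, e.1 x = (1 : C^∞⟮𝓘(ℝ, E), M; ℝ⟯) x • e.1 x := by simp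
  exact ⟨e, ξ, he, fun a => by rw [h.apply hD hU hU₀ h1, h'.apply hD' hU hU₀ h1]⟩

/-- Every 1-form comes from a connection. -/
theorem exists_connection_of_form (hU : IsUnits V U) (β : 𝔸.Form 1) :
    ∃ D : 𝔸.Op V, 𝔸.IsConnection D ∧ IsUnitForm D U β := by
  choose e ξ he hUe using hU.frame
  obtain ⟨D, hD, h⟩ := exists_connection_of_frames (𝔸 := 𝔸) hU.isLocal e ξ he
    (fun m =>
      { toFun := fun a => fsmul (𝔸.pairing β a) (e m)
        map_add' := fun a b => by
          ext x
          simp [add_smul]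
        map_smul' := fun c a => by
          ext x
          simp [mul_smul] })
    (fun m₀ a => by
      filter_upwards [eventually_eventually_nhds.2 (hUe m₀)] with m h1
      have h5 : (e m₀).1 m = pair (ξ m) (e m₀) m • (e m).1 m := (he m).self_of_nhds.2 _
      rw [𝔸.act_eq_zero_of_sq a (hU.ratio (he m) (hUe m) h1)]
      change 𝔸.pairing β a m • (e m₀).1 m = _ • (𝔸.pairing β a m • (e m).1 m) + _
      rw [h5]
      module)
    (fun m f a => by
      change 𝔸.pairing β (fsmul f a) m • (e m).1 m = f m • (𝔸.pairing β a m • (e m).1 m)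
      rw [pairing_fsmul, mul_smul])
  refine ⟨D, hD, fun m => ⟨e m, hUe m, fun a => ?_⟩⟩
  rw [h, pair_apply, (he m).self_of_nhds.1]
  have : 𝔸.act a (pair (ξ m) (e m)) m = 0 :=
    dirD_eq_zero_of_eventually_const (c := 1) _ ((he m).mono fun x hx => hx.1)
  rw [this, one_smul, zero_smul, add_zero]
  rfl

/-- Every connection on a line bundle with units comes from a 1-form. -/
theorem IsConnection.exists_unitForm {n : ℕ} (hA : 𝔸.bundle.IsFramed n) (hU : IsUnits V U)
    {D : 𝔸.Op V} (hD : 𝔸.IsConnection D) : ∃ β : 𝔸.Form 1, IsUnitForm D U β := by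
  choose e ξ he hUe using hU.frame
  -- The coefficient of `D(a)` on the unit section chosen at `m`. It is function-linear in `a`, so
  -- it descends to the fibre of `A` through `lift`.
  let T : ∀ m, 𝔸.bundle.Γ →ₗ[ℝ] ℝ := fun m => at' (ξ m) m ∘ₗ V.ev m ∘ₗ D.flip (e m)
  have hT : ∀ m (f : C^∞⟮𝓘(ℝ, E), M; ℝ⟯) a, T m (fsmul f a) = f m • T m a := fun m f a => by
    change at' (ξ m) m ((D (fsmul f a) (e m)).1 m) = _
    rw [hD.fsmul_left, fsmul_val, map_smul]
    rfl
  have hlift : ∀ m (a : 𝔸.bundle.Γ), T m (𝔸.bundle.lift m (a.1 m)) = T m a := fun m a => by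
    obtain ⟨s, η, hs⟩ := hA.2 m
    exact hs.tensorial_lift (T m) (hT m) a
  have hTe : ∀ m a, (D a (e m)).1 m = T m a • (e m).1 m := fun m a => (he m).self_of_nhds.2 _
  have hsm : ∀ a : 𝔸.bundle.Γ, ContMDiff 𝓘(ℝ, E) 𝓘(ℝ, ℝ) ∞
      fun m => (T m ∘ₗ 𝔸.bundle.lift m) (a.1 m) := fun a => by
    -- Near `m₀` the fixed unit section `e m₀` yields the same coefficient as `e m`, because their
    -- ratio has zero derivative; in that section the coefficient is visibly smooth.
    refine contMDiff_of_eventually fun m₀ => ⟨pair (ξ m₀) (D a (e m₀)), ?_⟩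
    filter_upwards [he m₀, eventually_eventually_nhds.2 (hUe m₀)] with m h0 h1
    have r := hU.ratio (he m) (hUe m) h1
    have h5 : ∀ᶠ x in 𝓝 m, (e m₀).1 x = pair (ξ m) (e m₀) x • (e m).1 x :=
      (he m).mono fun x hx => hx.2 _
    rw [LinearMap.comp_apply, hlift, pair_apply, hD.apply_of_eventually a h5,
      𝔸.act_eq_zero_of_sq a r, zero_smul, add_zero, hTe, smul_comm, ← h5.self_of_nhds, map_smul,
      h0.1, smul_eq_mul, mul_one]
  refine ⟨𝔸.mkForm (fun m => T m ∘ₗ 𝔸.bundle.lift m) hsm, fun m => ⟨e m, hUe m, fun a => ?_⟩⟩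
  rw [pairing_mkForm, LinearMap.comp_apply, hlift, hTe]

/-- A connection on a line bundle is flat if and only if its 1-form is closed. -/
theorem IsUnitForm.isRepresentation_iff {D : 𝔸.Op V} {β : 𝔸.Form 1} (h : IsUnitForm D U β)
    (hD : 𝔸.IsConnection D) (hU : IsUnits V U) : 𝔸.IsRepresentation D ↔ β ∈ 𝔸.closed := by
  have hone : ∀ (e : V.Γ) (m : M), (∀ᶠ x in 𝓝 m, e.1 x ∈ U x) → ∀ a, ∀ᶠ x in 𝓝 m,
      (D a e).1 x = 𝔸.pairing β a x • e.1 x := fun e m he a => by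
    filter_upwards [h.eventually_apply hD hU he (f := 1) (s := e) (by simp) a] with x hx
    rw [hx, smooth_add_apply, smooth_mul_apply, smooth_one_apply, one_mul,
      𝔸.act_eq_zero_of_sq a (by simp), zero_add]
  rw [mem_closed_iff]
  constructor
  · intro hrep a b m
    obtain ⟨e, ξ, he, hUe⟩ := hU.frame m
    have h1 := hD.curvature_apply (hone e m hUe) (f := 1) (s := e) (by simp) a b
    rw [← sub_val, hrep.flat, sub_self, eq_comm, smul_eq_zero, smooth_one_apply, one_mul,
      sub_eq_zero] at h1
    exact h1.resolve_right he.ne_zero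
  · intro hβ
    refine hD.isRepresentation_of_frames fun m => ?_
    obtain ⟨e, ξ, he, hUe⟩ := hU.frame m
    exact ⟨e, ξ, 𝔸.pairing β, he, hone e m hUe, fun a b => hβ a b m⟩

end LieAlgebroid

end Connections

/-! ### Existence and functoriality of units -/

section Units

open SmoothFamily

variable {E : Type u} [NormedAddCommGroup E] [NormedSpace ℝ E]
  {M : Type*} [TopologicalSpace M] [ChartedSpace E M]
  {V : SmoothFamily.{w} E M}

@[simp] theorem at'_fsmul (f : C^∞⟮𝓘(ℝ, E), M; ℝ⟯) (ξ : V.dual.Γ) (m : M) (v : V.Fib m) :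
    at' (fsmul f ξ) m v = f m * at' ξ m v := rfl

/-- Every line bundle has units, namely the unit vectors of a fibre metric. -/
theorem SmoothFamily.IsLine.exists_isUnits [FiniteDimensional ℝ E] [T2Space M]
    [SecondCountableTopology M] [IsManifold 𝓘(ℝ, E) ∞ M] (hV : V.IsLine) :
    ∃ U : ∀ m, Set (V.Fib m), IsUnits V U := by
  choose e ξ he using hV.2
  have : LocallyCompactSpace M := ChartedSpace.locallyCompactSpace E M
  obtain ⟨ρ, hρ⟩ := SmoothPartitionOfUnity.exists_isSubordinate 𝓘(ℝ, E) (s := (Set.univ : Set M))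
    isClosed_univ (fun i => {x | IsLineFrame (e i) (ξ i) x})
    (fun i => isOpen_setOfPred_eventually_nhds) (fun m _ => Set.mem_iUnion.2 ⟨m, he m⟩)
  -- The quadratic form of a fibre metric: squares of local coordinates, averaged with the partition
  -- of unity. It is positive off zero, since some weight is nonzero and the corresponding
  -- coordinate is injective there.
  let q : ∀ m, V.Fib m → ℝ := fun m v => ∑ i ∈ ρ.finsupport m, ρ i m • (at' (ξ i) m v) ^ 2
  have hq : ∀ m (c : ℝ) v, q m (c • v) = c ^ 2 * q m v := fun m c v => by
    simp only [q, Finset.mul_sum, map_smul, smul_eq_mul]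
    exact Finset.sum_congr rfl fun i _ => by ring
  have hpos : ∀ m v, v ≠ 0 → 0 < q m v := fun m v hv => by
    have hne : (ρ.finsupport m).Nonempty := by
      by_contra hemp
      have h1 := ρ.sum_finsupport m (Set.mem_univ m)
      rw [Finset.not_nonempty_iff_eq_empty.1 hemp, Finset.sum_empty] at h1
      exact zero_ne_one h1
    refine Finset.sum_pos (fun i hi => ?_) hne
    have hi' : ρ i m ≠ 0 := (ρ.mem_finsupport m).1 hi
    have hfr : IsLineFrame (e i) (ξ i) m := hρ i (subset_tsupport _ hi')
    refine mul_pos (lt_of_le_of_ne (ρ.nonneg i m) (Ne.symm hi')) (sq_pos_of_ne_zero fun h0 => hv ?_)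
    rw [hfr.self_of_nhds.2 v, h0, zero_smul]
  have hsm : ∀ s : V.Γ, ContMDiff 𝓘(ℝ, E) 𝓘(ℝ, ℝ) ∞ fun m => q m (s.1 m) := fun s => by
    have h1 : (fun m => q m (s.1 m)) = fun m => ∑ᶠ i, ρ i m • (pair (ξ i) s m) ^ 2 := by
      funext m
      rw [← ρ.sum_finsupport_smul_eq_finsum m (fun i x => (pair (ξ i) s x) ^ 2)]
      rfl
    rw [h1]
    exact ρ.contMDiff_finsum_smul fun i x _ => ((pair (ξ i) s).contMDiff x).pow 2
  refine ⟨fun m => {v | q m v = 1}, hV.1, fun m => ?_, fun m v hv w hw => ?_⟩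
  · let Q : C^∞⟮𝓘(ℝ, E), M; ℝ⟯ := ⟨fun x => q x ((e m).1 x), hsm (e m)⟩
    have hQ : ∀ᶠ x in 𝓝 m, 0 < Q x := (he m).eventually.mono fun x hx => hpos x _ hx.ne_zero
    -- The factor `Q^(-1/2)` normalises the frame. It is smooth only where `Q > 0`, so only its germ
    -- at `m` is extended to a global function.
    obtain ⟨g, hg⟩ := exists_smooth_extension (E := E) (m := m) (f := fun x => (√(Q x))⁻¹)
      (hQ.mono fun x hx => by
        have h1 : ContDiffAt ℝ ∞ (fun y : ℝ => (√y)⁻¹) (Q x) :=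
          (Real.contDiffAt_sqrt hx.ne').inv (Real.sqrt_ne_zero'.2 hx)
        exact h1.contMDiffAt.comp x (Q.contMDiff x))
    have hgQ : ∀ᶠ x in 𝓝 m, g x * g x * Q x = 1 := by
      filter_upwards [hQ, hg] with x h1 h2
      rw [h2, ← mul_inv, Real.mul_self_sqrt h1.le, inv_mul_cancel₀ h1.ne']
    -- Since `g² Q = 1` near `m`, the functional `g Q ξ` is dual to `g e`.
    refine ⟨fsmul g (e m), fsmul (g * Q) (ξ m), ?_, ?_⟩
    · filter_upwards [he m, hgQ] with x h1 h2
      refine ⟨?_, fun v => ?_⟩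
      · rw [at'_fsmul, fsmul_val, map_smul, h1.1, smooth_mul_apply, smul_eq_mul]
        linarith
      · rw [at'_fsmul, fsmul_val, smul_smul, smooth_mul_apply]
        conv_lhs => rw [h1.2 v]
        congr 1
        linear_combination (-(at' (ξ m) x v)) * h2
    · filter_upwards [hgQ] with x hx
      change q x (g x • (e m).1 x) = 1
      rw [hq, ← hx, pow_two]
      rfl
  · have h1 := (he m).self_of_nhds.2 v
    have h2 := (he m).self_of_nhds.2 w
    have hvw : at' (ξ m) m w ^ 2 = at' (ξ m) m v ^ 2 := by
      have hv' : q m v = 1 := hv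
      have hw' : q m w = 1 := hw
      rw [h1, hq] at hv'
      rw [h2, hq] at hw'
      have h3 := hpos m _ (he m).ne_zero
      exact mul_right_cancel₀ h3.ne' (hw'.trans hv'.symm)
    rcases sq_eq_sq_iff_eq_or_eq_neg.1 hvw with h | h
    · left
      rw [h2, h, ← h1]
    · right
      rw [h2, h, neg_smul, ← h1]

/-- The products of units of `V` and of `W`. -/
def tensorUnits {W : SmoothFamily.{v} E M} (U : ∀ m, Set (V.Fib m)) (U' : ∀ m, Set (W.Fib m)) :
    ∀ m, Set ((V.tensor W).Fib m) := fun m => {t | ∃ u ∈ U m, ∃ u' ∈ U' m, t = u ⊗ₜ[ℝ] u'}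

theorem IsUnits.tensor {W : SmoothFamily.{v} E M} {U : ∀ m, Set (V.Fib m)}
    {U' : ∀ m, Set (W.Fib m)} (hU : IsUnits V U) (hU' : IsUnits W U') :
    IsUnits (V.tensor W) (tensorUnits U U') := by
  refine ⟨tensor_isLocal W, fun m => ?_, ?_⟩
  · obtain ⟨e, ξ, he, h⟩ := hU.frame m
    obtain ⟨e', ξ', he', h'⟩ := hU'.frame m
    refine ⟨tmul e e', tmulDual ξ ξ', he.tensor he', ?_⟩
    filter_upwards [h, h'] with x h1 h2
    exact ⟨_, h1, _, h2, rfl⟩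
  · rintro m _ ⟨u, hu, u', hu', rfl⟩ _ ⟨w, hw, w', hw', rfl⟩
    rcases hU.eq_or_neg m u hu w hw with rfl | rfl <;>
      rcases hU'.eq_or_neg m u' hu' w' hw' with rfl | rfl
    · exact Or.inl rfl
    · exact Or.inr (TensorProduct.tmul_neg _ _)
    · exact Or.inr (TensorProduct.neg_tmul _ _)
    · left
      rw [TensorProduct.neg_tmul, TensorProduct.tmul_neg, neg_neg]

/-- The functionals dual to units. -/
def dualUnits (U : ∀ m, Set (V.Fib m)) : ∀ m, Set (V.dual.Fib m) := fun m =>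
  {ξ | ∃ u ∈ U m, (show V.Fib m →ₗ[ℝ] ℝ from ξ) u = 1}

theorem IsUnits.dual {U : ∀ m, Set (V.Fib m)} (hU : IsUnits V U) :
    IsUnits V.dual (dualUnits U) := by
  refine ⟨dual_isLocal, fun m => ?_, ?_⟩
  · obtain ⟨e, ξ, he, h⟩ := hU.frame m
    refine ⟨ξ, evalAt e, he.dual, ?_⟩
    filter_upwards [h, he] with x h1 h2
    exact ⟨_, h1, h2.1⟩
  · rintro m ξ ⟨u, hu, h1⟩ η ⟨u', hu', h2⟩
    obtain ⟨e, ζ, he, h⟩ := hU.frame m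
    -- The unit `u` is the frame vector up to sign, so it spans the fibre and a functional is
    -- determined by its value on `u`.
    obtain ⟨c, hc⟩ : ∃ c : ℝ, e.1 m = c • u := by
      rcases hU.eq_or_neg m u hu _ h.self_of_nhds with h | h
      · exact ⟨1, by rw [h, one_smul]⟩
      · exact ⟨-1, by rw [h, neg_smul, one_smul]⟩
    have hspan : ∀ v : V.Fib m, v = (at' ζ m v * c) • u := fun v => by
      rw [mul_smul, ← hc]
      exact he.self_of_nhds.2 v
    change V.Fib m →ₗ[ℝ] ℝ at ξ η
    change ξ u = 1 at h1
    change η u' = 1 at h2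
    rcases hU.eq_or_neg m u hu u' hu' with rfl | rfl
    · left
      refine LinearMap.ext fun v => ?_
      rw [hspan v, map_smul, map_smul, h1, h2]
    · right
      refine LinearMap.ext fun v => ?_
      rw [map_neg] at h2
      rw [LinearMap.neg_apply, hspan v, map_smul, map_smul, h1, ← h2, smul_neg, neg_neg]

/-- The pull-back of units. -/
theorem IsUnits.pullback {E' : Type*} [NormedAddCommGroup E'] [NormedSpace ℝ E']
    {N : Type*} [TopologicalSpace N] [ChartedSpace E' N] {V : SmoothFamily.{w} E' N}
    (φ : C^∞⟮𝓘(ℝ, E), M; 𝓘(ℝ, E'), N⟯) {U : ∀ n, Set (V.Fib n)} (hU : IsUnits V U) :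
    IsUnits (V.pullback φ) (fun m => U (φ m)) := by
  refine ⟨pullback_isLocal φ, fun m => ?_, fun m => hU.eq_or_neg (φ m)⟩
  obtain ⟨e, ξ, he, h⟩ := hU.frame (φ m)
  exact ⟨pullSec φ e, pullDual φ ξ, he.pullback φ,
    φ.contMDiff.continuous.continuousAt.eventually h⟩

/-- The square of a line bundle with units has a nowhere vanishing section. -/
theorem IsUnits.exists_nowhereZero_square {U : ∀ m, Set (V.Fib m)} (hU : IsUnits V U) :
    ∃ s : (V.tensor V).Γ, NowhereZero s := by
  choose e ξ he hUe using hU.frame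
  -- The unit is picked arbitrarily at each point, but `u ⊗ u` is insensitive to its sign, so near
  -- `m₀` it equals the smooth `e m₀ ⊗ e m₀`.
  refine ⟨⟨fun m => (e m).1 m ⊗ₜ[ℝ] (e m).1 m, tensor_isLocal V _ fun m₀ => ?_⟩, fun m =>
    ((he m).tensor (he m)).ne_zero⟩
  refine ⟨tmul (e m₀) (e m₀), ?_⟩
  filter_upwards [hUe m₀] with m h1
  rw [tmul_val]
  rcases hU.eq_or_neg m _ (hUe m).self_of_nhds _ h1 with h | h
  · rw [h]
  · rw [h, TensorProduct.neg_tmul, TensorProduct.tmul_neg, neg_neg]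

end Units

/-! ### Tensor products, duals and characteristic classes -/

section CharClass

open SmoothFamily

variable {E : Type u} [NormedAddCommGroup E] [NormedSpace ℝ E] [FiniteDimensional ℝ E]
  {F : Type*} [NormedAddCommGroup F] [NormedSpace ℝ F]
  {M : Type*} [TopologicalSpace M] [T2Space M] [ChartedSpace E M] [IsManifold 𝓘(ℝ, E) ∞ M]
  {A : M → Type v} [TopologicalSpace (TotalSpace F A)] [∀ m, AddCommGroup (A m)]
  [∀ m, Module ℝ (A m)] [∀ m, TopologicalSpace (A m)] [FiberBundle F A] [VectorBundle ℝ F A]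

namespace LieAlgebroid

variable {𝔸 : LieAlgebroid E F A} {V : SmoothFamily.{w} E M} {U : ∀ m, Set (V.Fib m)}
  {D : 𝔸.Op V} {β : 𝔸.Form 1}

/-! ### Tensor products: the unit forms add -/

section Tensor

variable {W : SmoothFamily.{w'} E M} {U' : ∀ m, Set (W.Fib m)} {D' : 𝔸.Op W} {β' : 𝔸.Form 1}

/-- On a product of unit sections the Leibniz formula adds the two coefficients. -/
theorem IsTensor.isUnitForm {D'' : 𝔸.Op (V.tensor W)} (h'' : 𝔸.IsTensor D D' D'')
    (h : IsUnitForm D U β) (h' : IsUnitForm D' U' β') :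
    IsUnitForm D'' (tensorUnits U U') (β + β') := fun m => by
  obtain ⟨e, he, hD⟩ := h m
  obtain ⟨e', he', hD'⟩ := h' m
  refine ⟨tmul e e', ?_, fun a => ?_⟩
  · filter_upwards [he, he'] with x h1 h2
    exact ⟨_, h1, _, h2, rfl⟩
  · rw [h''.2, add_val, tmul_val, tmul_val, hD, hD', tmul_val, pairing_add_left, smooth_add_apply,
      add_smul, TensorProduct.tmul_smul, ← TensorProduct.smul_tmul']

/-- The candidate is the connection with form `β + β'`. For `x = f e` and `y = g e'` in unit frames,
the required formula is the product rule for `f g`. -/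
theorem exists_isTensor (hU : IsUnits V U) (hU' : IsUnits W U') (hD : 𝔸.IsConnection D)
    (hD' : 𝔸.IsConnection D') (h : IsUnitForm D U β) (h' : IsUnitForm D' U' β') :
    ∃ D'', 𝔸.IsTensor D D' D'' := by
  obtain ⟨D'', hD'', h''⟩ := exists_connection_of_form (hU.tensor hU') (β + β')
  refine ⟨D'', hD'', fun a x y => Γ_ext fun m => ?_⟩
  obtain ⟨e, ξ, he, hUe⟩ := hU.frame m
  obtain ⟨e', ξ', he', hUe'⟩ := hU'.frame m
  have hx : ∀ᶠ z in 𝓝 m, x.1 z = pair ξ x z • e.1 z := he.mono fun z hz => hz.2 _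
  have hy : ∀ᶠ z in 𝓝 m, y.1 z = pair ξ' y z • e'.1 z := he'.mono fun z hz => hz.2 _
  have hxy : ∀ᶠ z in 𝓝 m, (tmul x y).1 z = (pair ξ x * pair ξ' y) z • (tmul e e').1 z := by
    filter_upwards [hx, hy] with z h1 h2
    rw [tmul_val, h1, h2, TensorProduct.smul_tmul_smul]
    rfl
  have hee : ∀ᶠ z in 𝓝 m, (tmul e e').1 z ∈ tensorUnits U U' z := by
    filter_upwards [hUe, hUe'] with z h1 h2
    exact ⟨_, h1, _, h2, rfl⟩
  rw [h''.apply hD'' (hU.tensor hU') hee hxy, add_val, tmul_val, tmul_val (D a x) y,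
    tmul_val x (D' a y), h.apply hD hU hUe hx, h'.apply hD' hU' hUe' hy, hx.self_of_nhds,
    hy.self_of_nhds, TensorProduct.smul_tmul_smul, TensorProduct.smul_tmul_smul, ← add_smul,
    act_mul, pairing_add_left]
  congr 1
  simp only [smooth_add_apply, smooth_mul_apply]
  ring

/-- Every solution has unit form `β + β'`, and a connection is determined by its unit form. -/
theorem existsUnique_isTensor (hU : IsUnits V U) (hU' : IsUnits W U') (hD : 𝔸.IsConnection D)
    (hD' : 𝔸.IsConnection D') (h : IsUnitForm D U β) (h' : IsUnitForm D' U' β') :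
    ∃! D'', 𝔸.IsTensor D D' D'' := by
  obtain ⟨D'', h''⟩ := exists_isTensor hU hU' hD hD' h h'
  exact ⟨D'', h'', fun D₁ h₁ => (h₁.isUnitForm h h').unique (h''.isUnitForm h h') h₁.1 h''.1
    (hU.tensor hU')⟩

theorem isTensor_tensorRep (hU : IsUnits V U) (hU' : IsUnits W U') (hD : 𝔸.IsConnection D)
    (hD' : 𝔸.IsConnection D') (h : IsUnitForm D U β) (h' : IsUnitForm D' U' β') :
    𝔸.IsTensor D D' (𝔸.tensorRep D D') :=
  Classical.epsilon_spec (exists_isTensor hU hU' hD hD' h h')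

end Tensor

/-! ### Duals: the unit form changes sign -/

section Dual

/-- The candidate is the connection with form `-β`. Written in a unit frame and its dual, the
duality formula is the product rule for the coefficients, the contributions of `β` accounting for
each other. -/
theorem exists_isDual (hU : IsUnits V U) (hD : 𝔸.IsConnection D) (h : IsUnitForm D U β) :
    ∃ D' : 𝔸.Op V.dual, 𝔸.IsDual D D' ∧ 𝔸.IsConnection D' ∧ IsUnitForm D' (dualUnits U) (-β) := by
  obtain ⟨D', hD', h'⟩ := exists_connection_of_form (𝔸 := 𝔸) hU.dual (-β)
  refine ⟨D', fun a ξ x m => ?_, hD', h'⟩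
  obtain ⟨e, η, he, hUe⟩ := hU.frame m
  have hx : ∀ᶠ z in 𝓝 m, x.1 z = pair η x z • e.1 z := he.mono fun z hz => hz.2 _
  have hξ : ∀ᶠ z in 𝓝 m, ξ.1 z = pair ξ e z • η.1 z := by
    filter_upwards [he] with z hz
    refine LinearMap.ext fun v => ?_
    change at' ξ z v = at' ξ z (e.1 z) * at' η z v
    conv_lhs => rw [hz.2 v]
    rw [map_smul, smul_eq_mul, mul_comm]
  have hη : ∀ᶠ z in 𝓝 m, η.1 z ∈ dualUnits U z := by
    filter_upwards [hUe, he] with z h1 h2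
    exact ⟨_, h1, h2.1⟩
  have hξx : ∀ᶠ z in 𝓝 m, pair ξ x z = (pair ξ e * pair η x) z := by
    filter_upwards [hx] with z hz
    rw [pair_apply, hz, map_smul, smooth_mul_apply, smul_eq_mul, mul_comm]
    rfl
  change at' (D' a ξ) m (x.1 m) = -at' ξ m ((D a x).1 m) + 𝔸.act a (pair ξ x) m
  have h1 : at' (D' a ξ) m =
      (𝔸.act a (pair ξ e) m + pair ξ e m * 𝔸.pairing (-β) a m) • at' η m :=
    h'.apply hD' hU.dual hη hξ a
  rw [h1, h.apply hD hU hUe hx, 𝔸.act_congr a hξx, act_mul, pairing_neg_left, map_smul,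
    LinearMap.smul_apply]
  simp only [smooth_add_apply, smooth_mul_apply, smooth_neg_apply, smul_eq_mul, pair_apply]
  ring

/-- The duality formula fixes the pairing with every section, and every vector is a value of a
section. -/
theorem IsDual.unique {D₁ D₂ : 𝔸.Op V.dual} (hU : IsUnits V U) (h₁ : 𝔸.IsDual D D₁)
    (h₂ : 𝔸.IsDual D D₂) : D₁ = D₂ := by
  refine LinearMap.ext fun a => LinearMap.ext fun ξ => Γ_ext fun m => LinearMap.ext fun v => ?_
  obtain ⟨e, η, he, -⟩ := hU.frame m
  obtain ⟨x, rfl⟩ := he.ev_surjective v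
  exact (h₁ a ξ x m).trans (h₂ a ξ x m).symm

theorem existsUnique_isDual (hU : IsUnits V U) (hD : 𝔸.IsConnection D) (h : IsUnitForm D U β) :
    ∃! D', 𝔸.IsDual D D' :=
  let ⟨D', hD', _⟩ := exists_isDual hU hD h
  ⟨D', hD', fun _ h₁ => h₁.unique hU hD'⟩

theorem dualRep_spec (hU : IsUnits V U) (hD : 𝔸.IsConnection D) (h : IsUnitForm D U β) :
    𝔸.IsConnection (𝔸.dualRep D) ∧ IsUnitForm (𝔸.dualRep D) (dualUnits U) (-β) := by
  obtain ⟨D', hD', h'⟩ := exists_isDual hU hD h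
  have : 𝔸.dualRep D = D' := (Classical.epsilon_spec ⟨D', hD'⟩ : 𝔸.IsDual D _).unique hU hD'
  rwa [this]

end Dual

/-- Here `d² = 0` on functions is `act_bracket`. -/
theorem dForm_mem_closed (f : C^∞⟮𝓘(ℝ, E), M; ℝ⟯) : 𝔸.dForm f ∈ 𝔸.closed :=
  (𝔸.mem_closed_iff _).2 fun a b m => by simp only [pairing_dForm, act_bracket]

theorem dirDeriv_log {f : C^∞⟮𝓘(ℝ, E), M; ℝ⟯} {m : M} (hf : f m ≠ 0)
    (v : TangentSpace 𝓘(ℝ, E) m) :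
    f m * dirDeriv (fun x => Real.log (f x)) m v = dirDeriv f m v := by
  have h1 := (Real.hasDerivAt_log hf).hasFDerivAt.hasMFDerivAt
  have h2 := (h1.comp m (mdifferentiableAt_smooth f m).hasMFDerivAt).mfderiv
  have h3 : dirDeriv (fun x => Real.log (f x)) m v = dirDeriv f m v * (f m)⁻¹ :=
    congrArg (fun L => L v) h2
  rw [h3]
  field_simp

/-- The characteristic cocycle of a nowhere vanishing section is cohomologous to the unit form. -/
theorem IsUnitForm.exists_charCocycle (h : IsUnitForm D U β) (hU : IsUnits V U)
    (hD : 𝔸.IsConnection D) {s : V.Γ} (hs : NowhereZero s) :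
    ∃ f : C^∞⟮𝓘(ℝ, E), M; ℝ⟯, 𝔸.IsCharCocycle D s (β + 𝔸.dForm f) := by
  choose e ξ he hUe using hU.frame
  have hse : ∀ m, ∀ᶠ x in 𝓝 m, s.1 x = pair (ξ m) s x • (e m).1 x := fun m =>
    (he m).mono fun x hx => hx.2 _
  have hne : ∀ m, pair (ξ m) s m ≠ 0 := fun m h0 => hs m <| by
    rw [(hse m).self_of_nhds, h0, zero_smul]
  -- The coefficients of `s` in the unit sections `e m` and `e m₀` agree up to sign. `Real.log` is
  -- the logarithm of the absolute value, so the sign is lost and the pointwise choices glue to a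
  -- smooth function.
  have hloc : ∀ m₀, (fun m => Real.log (pair (ξ m) s m)) =ᶠ[𝓝 m₀]
      fun m => Real.log (pair (ξ m₀) s m) := fun m₀ => by
    filter_upwards [hUe m₀, hse m₀] with m h1 h2
    have h3 := congrArg (at' (ξ m) m) h2
    rcases hU.eq_or_neg m _ (hUe m).self_of_nhds _ h1 with h4 | h4
    · rw [map_smul, h4, (he m).self_of_nhds.1, smul_eq_mul, mul_one] at h3
      rw [pair_apply, h3]
    · rw [map_smul, h4, map_neg, (he m).self_of_nhds.1, smul_eq_mul, mul_neg, mul_one] at h3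
      rw [pair_apply, h3, Real.log_neg_eq_log]
  let f : C^∞⟮𝓘(ℝ, E), M; ℝ⟯ := ⟨fun m => Real.log (pair (ξ m) s m), fun m₀ =>
    ((Real.contDiffAt_log.2 (hne m₀)).contMDiffAt.comp m₀
      ((pair (ξ m₀) s).contMDiff m₀)).congr_of_eventuallyEq (hloc m₀)⟩
  refine ⟨f, fun a m => ?_⟩
  change 𝔸.pairing (β + 𝔸.dForm f) a m • s.1 m = _
  have hlog : pair (ξ m) s m * 𝔸.act a f m = 𝔸.act a (pair (ξ m) s) m := by
    have : 𝔸.act a f m = dirDeriv (fun x => Real.log (pair (ξ m) s x)) m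
        (𝔸.anchor m (a.1 m)) := dirDeriv_congr (hloc m) _
    rw [this, dirDeriv_log (hne m)]
    rfl
  rw [h.apply hD hU (hUe m) (hse m), ← hlog, pairing_add_left, pairing_dForm, smooth_add_apply]
  conv_lhs => rw [(hse m).self_of_nhds]
  module

/-- Since `s` vanishes nowhere, its coefficient can be cancelled; every vector of `A` extends to a
section, so the form is fixed. -/
theorem IsCharCocycle.unique {n : ℕ} (hA : 𝔸.bundle.IsFramed n) {s : V.Γ} (hs : NowhereZero s)
    {α α' : 𝔸.Form 1} (h : 𝔸.IsCharCocycle D s α) (h' : 𝔸.IsCharCocycle D s α') : α = α' := by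
  refine Γ_ext fun m => AlternatingMap.ext fun v => ?_
  obtain ⟨x, η, hx⟩ := hA.2 m
  obtain ⟨a, ha⟩ := hx.ev_surjective (v 0)
  have hv : v = fun _ => a.1 m := funext fun i => by
    rw [Subsingleton.elim i 0]
    exact ha.symm
  rw [hv]
  exact smul_left_injective ℝ (hs m) ((h a m).trans (h' a m).symm)

/-- Each nowhere-vanishing section gives a cocycle differing from `β` by an exact form, so the class
does not depend on the section. -/
theorem IsUnitForm.isCocycleClass_iff {n : ℕ} (hA : 𝔸.bundle.IsFramed n) (h : IsUnitForm D U β)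
    (hU : IsUnits V U) (hD : 𝔸.IsConnection D) (hβ : β ∈ 𝔸.closed)
    (hs : ∃ s : V.Γ, NowhereZero s) (c : 𝔸.H1) :
    𝔸.IsCocycleClass D c ↔ c = Submodule.Quotient.mk ⟨β, hβ⟩ := by
  have hmk : ∀ f : C^∞⟮𝓘(ℝ, E), M; ℝ⟯,
      (Submodule.Quotient.mk ⟨β + 𝔸.dForm f, 𝔸.closed.add_mem hβ (dForm_mem_closed f)⟩ : 𝔸.H1) =
        Submodule.Quotient.mk ⟨β, hβ⟩ := fun f => by
    rw [Submodule.Quotient.eq, Submodule.mem_comap]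
    change β + 𝔸.dForm f - β ∈ 𝔸.exact
    rw [add_sub_cancel_left]
    exact 𝔸.dForm_mem_exact f
  constructor
  · rintro ⟨s, α, hs, hα, rfl⟩
    obtain ⟨f, hf⟩ := h.exists_charCocycle hU hD hs
    rw [← hmk f]
    exact congrArg _ (Subtype.ext (hα.unique hA hs hf))
  · rintro rfl
    obtain ⟨s, hs⟩ := hs
    obtain ⟨f, hf⟩ := h.exists_charCocycle hU hD hs
    exact ⟨s, _, hs, hf, (hmk f).symm⟩

/-- The characteristic class of a flat connection is the class of its unit form. -/
theorem IsUnitForm.isCharClass_iff {n : ℕ} (hA : 𝔸.bundle.IsFramed n) (h : IsUnitForm D U β)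
    (hU : IsUnits V U) (hD : 𝔸.IsConnection D) (hβ : β ∈ 𝔸.closed) (c : 𝔸.H1) :
    𝔸.IsCharClass D c ↔ c = Submodule.Quotient.mk ⟨β, hβ⟩ := by
  have ht := isTensor_tensorRep hU hU hD hD h h
  -- The square always has a nowhere-vanishing section, and the form of `D ⊗ D` is `β + β`. Half of
  -- its class is the class of `β`, so both branches of the definition give the same answer.
  have h2 : ∀ c₂ : 𝔸.H1, 𝔸.IsCocycleClass (𝔸.tensorRep D D) c₂ ↔
      c₂ = Submodule.Quotient.mk ⟨β + β, 𝔸.closed.add_mem hβ hβ⟩ :=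
    (ht.isUnitForm h h).isCocycleClass_iff hA (hU.tensor hU) ht.1 _ hU.exists_nowhereZero_square
  have h3 : (1 / 2 : ℝ) • (Submodule.Quotient.mk ⟨β + β, 𝔸.closed.add_mem hβ hβ⟩ : 𝔸.H1) =
      Submodule.Quotient.mk ⟨β, hβ⟩ := by
    rw [← Submodule.Quotient.mk_smul]
    congr 1
    refine Subtype.ext ?_
    change (1 / 2 : ℝ) • (β + β) = β
    module
  by_cases hs : ∃ s : V.Γ, NowhereZero s
  · simp only [IsCharClass, hs, true_and, not_true_eq_false, false_and, or_false]
    exact h.isCocycleClass_iff hA hU hD hβ hs c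
  · simp only [IsCharClass, hs, false_and, not_false_eq_true, true_and, false_or, h2]
    simp only [exists_eq_left, h3]

theorem IsUnitForm.charClass_eq {n : ℕ} (hA : 𝔸.bundle.IsFramed n) (h : IsUnitForm D U β)
    (hU : IsUnits V U) (hD : 𝔸.IsConnection D) (hβ : β ∈ 𝔸.closed) :
    𝔸.charClass D = Submodule.Quotient.mk ⟨β, hβ⟩ :=
  (h.isCharClass_iff hA hU hD hβ _).1
    (Classical.epsilon_spec ⟨_, (h.isCharClass_iff hA hU hD hβ _).2 rfl⟩)

theorem IsUnitForm.existsUnique_charClass {n : ℕ} (hA : 𝔸.bundle.IsFramed n)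
    (h : IsUnitForm D U β) (hU : IsUnits V U) (hD : 𝔸.IsConnection D) (hβ : β ∈ 𝔸.closed) :
    ∃! c, 𝔸.IsCharClass D c :=
  ⟨_, (h.isCharClass_iff hA hU hD hβ _).2 rfl, fun _ hc => (h.isCharClass_iff hA hU hD hβ _).1 hc⟩

end LieAlgebroid

end CharClass

/-! ### The modular representation -/

section Modular

open SmoothFamily

/-- Replacing one vector of a frame in an alternating map multiplies it by a coordinate. -/
theorem alternating_update {k : ℕ} {U N : Type*} [AddCommGroup U] [Module ℝ U] [AddCommGroup N]
    [Module ℝ N] {s : Fin k → U} {ξ : Fin k → U →ₗ[ℝ] ℝ} (h : ∀ v, v = ∑ i, ξ i v • s i)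
    (f : U [⋀^Fin k]→ₗ[ℝ] N) (i : Fin k) (v : U) :
    f (Function.update s i v) = ξ i v • f s := by
  have h1 : f.toMultilinearMap.toLinearMap s i v =
      ∑ j, ξ j v • f.toMultilinearMap.toLinearMap s i (s j) := by
    conv_lhs => rw [h v]
    rw [map_sum]
    simp only [map_smul]
  change f (Function.update s i v) = ∑ j, ξ j v • f (Function.update s i (s j)) at h1
  rw [h1, Finset.sum_eq_single i]
  · rw [Function.update_eq_self]
  · intro j _ hj
    rw [f.map_update_self s (Ne.symm hj), smul_zero]
  · simp

theorem update_val {E : Type*} [NormedAddCommGroup E] [NormedSpace ℝ E]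
    {M : Type*} [TopologicalSpace M] [ChartedSpace E M] {V : SmoothFamily.{w} E M} {k : ℕ}
    (s : Fin k → V.Γ) (i : Fin k) (x : V.Γ) (m : M) :
    (fun l => (Function.update s i x l).1 m) =
      Function.update (fun l => (s l).1 m) i (x.1 m) := by
  funext l
  by_cases hl : l = i
  · subst hl; simp
  · simp [hl]

variable {E : Type u} [NormedAddCommGroup E] [NormedSpace ℝ E] [FiniteDimensional ℝ E]
  {F : Type*} [NormedAddCommGroup F] [NormedSpace ℝ F]
  {M : Type*} [TopologicalSpace M] [T2Space M] [ChartedSpace E M] [IsManifold 𝓘(ℝ, E) ∞ M]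
  {A : M → Type v} [TopologicalSpace (TotalSpace F A)] [∀ m, AddCommGroup (A m)]
  [∀ m, Module ℝ (A m)] [∀ m, TopologicalSpace (A m)] [FiberBundle F A] [VectorBundle ℝ F A]

namespace LieAlgebroid

variable (𝔸 : LieAlgebroid E F A)

theorem isDer_bracket (a : 𝔸.bundle.Γ) :
    IsDer (fun m => 𝔸.anchor m (a.1 m)) (𝔸.bracket a) := fun f s m => 𝔸.leibniz a s f m

theorem bracket_swap (a b : 𝔸.bundle.Γ) : 𝔸.bracket a b = -𝔸.bracket b a := by
  have h := 𝔸.bracket_self (a + b)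
  simp only [map_add, LinearMap.add_apply, 𝔸.bracket_self, zero_add, add_zero] at h
  first
  | exact eq_neg_of_add_eq_zero_left h
  | exact eq_neg_of_add_eq_zero_right h

theorem bracket_fsmul_left (f : C^∞⟮𝓘(ℝ, E), M; ℝ⟯) (a b : 𝔸.bundle.Γ) (m : M) :
    (𝔸.bracket (fsmul f a) b).1 m = f m • (𝔸.bracket a b).1 m - 𝔸.act b f m • a.1 m := by
  rw [bracket_swap, neg_val, 𝔸.isDer_bracket b f a m, bracket_swap 𝔸 a b, neg_val,
    ← act_eq_dirD]
  module

theorem bracket_commutator (a b : 𝔸.bundle.Γ) :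
    𝔸.bracket a ∘ₗ 𝔸.bracket b - 𝔸.bracket b ∘ₗ 𝔸.bracket a = 𝔸.bracket (𝔸.bracket a b) := by
  refine LinearMap.ext fun c => ?_
  change 𝔸.bracket a (𝔸.bracket b c) - 𝔸.bracket b (𝔸.bracket a c) = _
  rw [𝔸.jacobi a b c, add_sub_cancel_right]

/-- The Lie derivative `𝓛_{ρ(a)} μ` of a differential form. -/
def lieForm (a : 𝔸.bundle.Γ) {k : ℕ} (μ : ((tangent E M).alt k).Γ) : ((tangent E M).alt k).Γ :=
  altDer tangent_isFramed (contMDiff_dirD (𝔸.anchorSec a)) (isDer_lieBr (𝔸.anchorSec a)) μ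

theorem isLieDeriv_iff (a : 𝔸.bundle.Γ) {k : ℕ} (μ ν : ((tangent E M).alt k).Γ) :
    𝔸.IsLieDeriv a μ ν ↔ ∀ (Y : Fin k → (tangent E M).Γ) (m : M), evAlt ν Y m =
      𝔸.act a (evAlt μ Y) m -
        ∑ i, evAlt μ (Function.update Y i (lieBr (𝔸.anchorSec a) (Y i))) m := by
  refine forall_congr' fun Y => forall_congr' fun m => ?_
  have h : ∀ i, evAlt μ (Function.update Y i (lieBr (𝔸.anchorSec a) (Y i))) m =
      altAt μ m (Function.update (fun j => (Y j).1 m) i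
        ((lieBr (𝔸.anchorSec a) (Y i)).1 m)) := fun i => by
    rw [evAlt_apply, update_val]
  rw [Finset.sum_congr rfl fun i _ => h i]
  rfl

theorem isLieDeriv_lieForm (a : 𝔸.bundle.Γ) {k : ℕ} (μ : ((tangent E M).alt k).Γ) :
    𝔸.IsLieDeriv a μ (𝔸.lieForm a μ) :=
  (𝔸.isLieDeriv_iff a μ _).2 fun Y m => altDer_apply _ _ _ μ Y m

/-- The section `[a, x₁ ∧ … ∧ x_r] ⊗ μ + (x₁ ∧ … ∧ x_r) ⊗ ν`. -/
def modularValue (a : 𝔸.bundle.Γ) (x : Fin (Module.finrank ℝ F) → 𝔸.bundle.Γ)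
    (μ ν : ((tangent E M).alt (Module.finrank ℝ E)).Γ) : 𝔸.modularBundle.Γ :=
  tmul (∑ i, wedge (Function.update x i (𝔸.bracket a (x i)))) μ + tmul (wedge x) ν

/-- The functional on `L^A` given by a form on `A` and vector fields on `M`. -/
def modularDual (α : 𝔸.Form (Module.finrank ℝ F))
    (Y : Fin (Module.finrank ℝ E) → (tangent E M).Γ) : 𝔸.modularBundle.dual.Γ :=
  tmulDual (extDual α) (evalOn Y)

theorem pair_modularDual (α : 𝔸.Form (Module.finrank ℝ F))
    (Y : Fin (Module.finrank ℝ E) → (tangent E M).Γ)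
    (x : Fin (Module.finrank ℝ F) → 𝔸.bundle.Γ) (μ : ((tangent E M).alt (Module.finrank ℝ E)).Γ) :
    pair (𝔸.modularDual α Y) (tmul (wedge x) μ) = evAlt α x * evAlt μ Y := by
  ext m
  refine (at'_tmulDual (extDual α) (evalOn Y) m _ _).trans ?_
  rw [at'_extDual_wedge]
  rfl

theorem pair_modularDual_modularValue (α : 𝔸.Form (Module.finrank ℝ F))
    (Y : Fin (Module.finrank ℝ E) → (tangent E M).Γ) (a : 𝔸.bundle.Γ)
    (x : Fin (Module.finrank ℝ F) → 𝔸.bundle.Γ)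
    (μ ν : ((tangent E M).alt (Module.finrank ℝ E)).Γ) :
    pair (𝔸.modularDual α Y) (𝔸.modularValue a x μ ν) =
      (∑ i, evAlt α (Function.update x i (𝔸.bracket a (x i)))) * evAlt μ Y +
        evAlt α x * evAlt ν Y := by
  have h : tmul (∑ i, wedge (Function.update x i (𝔸.bracket a (x i)))) μ =
      ∑ i, tmul (wedge (Function.update x i (𝔸.bracket a (x i)))) μ := by
    ext m
    rw [tmul_val, sum_val, sum_val, TensorProduct.sum_tmul]
    rfl
  rw [modularValue, map_add, h, map_sum, pair_modularDual, Finset.sum_mul]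
  simp only [pair_modularDual]

variable {𝔸}

/-- The prescribed derivative of `x₁ ∧ … ∧ x_r ⊗ μ`, tested against a functional, is the derivative
of the test value up to a term depending on values only. -/
theorem exists_modularDual_defect {n : ℕ} (hA : 𝔸.bundle.IsFramed n)
    (α : 𝔸.Form (Module.finrank ℝ F))
    (Y : Fin (Module.finrank ℝ E) → (tangent E M).Γ) (a : 𝔸.bundle.Γ) :
    ∃ R : 𝔸.modularBundle.dual.Γ, ∀ (x : Fin (Module.finrank ℝ F) → 𝔸.bundle.Γ)
      (μ ν : ((tangent E M).alt (Module.finrank ℝ E)).Γ), 𝔸.IsLieDeriv a μ ν →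
      ∀ m, pair (𝔸.modularDual α Y) (𝔸.modularValue a x μ ν) m =
        𝔸.act a (pair (𝔸.modularDual α Y) (tmul (wedge x) μ)) m -
          pair R (tmul (wedge x) μ) m := by
  -- The Lie derivative of `α` along `a` absorbs the brackets `[a, xᵢ]`. Likewise the brackets of
  -- `ρ(a)` in the Lie derivative of `μ` are moved onto the fields `Y`. What remains is the
  -- derivative of `α(x) μ(Y)`, minus a pairing of order zero in `x ⊗ μ`.
  let α' : 𝔸.Form (Module.finrank ℝ F) :=
    altDer hA (contMDiff_dirD (𝔸.anchorSec a)) (𝔸.isDer_bracket a) α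
  have hα' : ∀ (x : Fin (Module.finrank ℝ F) → 𝔸.bundle.Γ) (m : M), evAlt α' x m =
      𝔸.act a (evAlt α x) m - ∑ i, evAlt α (Function.update x i (𝔸.bracket a (x i))) m :=
    fun x m => altDer_apply hA (contMDiff_dirD (𝔸.anchorSec a)) (𝔸.isDer_bracket a) α x m
  refine ⟨𝔸.modularDual α' Y +
    ∑ i, 𝔸.modularDual α (Function.update Y i (lieBr (𝔸.anchorSec a) (Y i))), ?_⟩
  intro x μ ν hν m
  have hsum : pair (𝔸.modularDual α' Y +
      ∑ i, 𝔸.modularDual α (Function.update Y i (lieBr (𝔸.anchorSec a) (Y i))))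
      (tmul (wedge x) μ) m = pair (𝔸.modularDual α' Y) (tmul (wedge x) μ) m +
      ∑ i, pair (𝔸.modularDual α (Function.update Y i (lieBr (𝔸.anchorSec a) (Y i))))
        (tmul (wedge x) μ) m := by
    let evx : 𝔸.modularBundle.dual.Γ →ₗ[ℝ] ℝ :=
      { toFun := fun R => pair R (tmul (wedge x) μ) m
        map_add' := fun _ _ => rfl
        map_smul' := fun _ _ => rfl }
    exact (map_add evx _ _).trans (congrArg _ (map_sum evx _ _))
  rw [hsum, pair_modularDual_modularValue, pair_modularDual, pair_modularDual, act_mul]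
  simp only [pair_modularDual, smooth_add_apply, smooth_mul_apply, smooth_sum_apply,
    (𝔸.isLieDeriv_iff a μ ν).1 hν, hα', ← Finset.mul_sum]
  ring

/-- The prescribed derivatives are compatible with the Leibniz rule. -/
theorem modularValue_of_eventually {n : ℕ} (hA : 𝔸.bundle.IsFramed n) (a : 𝔸.bundle.Γ)
    {α : 𝔸.Form (Module.finrank ℝ F)} {Y : Fin (Module.finrank ℝ E) → (tangent E M).Γ}
    {x x' : Fin (Module.finrank ℝ F) → 𝔸.bundle.Γ}
    {μ ν μ' ν' : ((tangent E M).alt (Module.finrank ℝ E)).Γ} (hν : 𝔸.IsLieDeriv a μ ν)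
    (hν' : 𝔸.IsLieDeriv a μ' ν') {m : M} {h : C^∞⟮𝓘(ℝ, E), M; ℝ⟯}
    (he : IsLineFrame (tmul (wedge x) μ) (𝔸.modularDual α Y) m)
    (hh : ∀ᶠ z in 𝓝 m, (tmul (wedge x') μ').1 z = h z • (tmul (wedge x) μ).1 z) :
    (𝔸.modularValue a x' μ' ν').1 m =
      h m • (𝔸.modularValue a x μ ν).1 m + 𝔸.act a h m • (tmul (wedge x) μ).1 m := by
  obtain ⟨R, hR⟩ := exists_modularDual_defect hA α Y a
  have h1 : ∀ᶠ z in 𝓝 m, pair (𝔸.modularDual α Y) (tmul (wedge x') μ') z =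
      (h * pair (𝔸.modularDual α Y) (tmul (wedge x) μ)) z := by
    filter_upwards [hh] with z hz
    rw [pair_apply, hz, map_smul]
    rfl
  -- The functional is a coordinate on the line, so it suffices to test with it. The defect `R`
  -- simply scales by `h`; only the derivative of the test value contributes the term with the
  -- derivative of `h`.
  have h2 : at' (𝔸.modularDual α Y) m ((𝔸.modularValue a x' μ' ν').1 m) =
      at' (𝔸.modularDual α Y) m
        (h m • (𝔸.modularValue a x μ ν).1 m + 𝔸.act a h m • (tmul (wedge x) μ).1 m) := by
    have e1 := hR x μ ν hν m
    have e2 := hR x' μ' ν' hν' m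
    rw [𝔸.act_congr a h1, act_mul] at e2
    have e3 : pair R (tmul (wedge x') μ') m = h m * pair R (tmul (wedge x) μ) m := by
      rw [pair_apply, hh.self_of_nhds, map_smul]
      rfl
    rw [map_add, map_smul, map_smul]
    refine e2.trans ?_
    rw [e3]
    change _ = h m * pair (𝔸.modularDual α Y) (𝔸.modularValue a x μ ν) m +
      𝔸.act a h m * pair (𝔸.modularDual α Y) (tmul (wedge x) μ) m
    rw [e1]
    simp only [smooth_add_apply, smooth_mul_apply]
    ring
  have h3 := he.self_of_nhds.2
  rw [h3 ((𝔸.modularValue a x' μ' ν').1 m), h2, ← h3]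

/-! ### The modular connection form in a local frame -/

section Frame

variable {x : Fin (Module.finrank ℝ F) → 𝔸.bundle.Γ}
  {ξ : Fin (Module.finrank ℝ F) → 𝔸.bundle.dual.Γ}
  {y : Fin (Module.finrank ℝ E) → (tangent E M).Γ}
  {η : Fin (Module.finrank ℝ E) → (tangent E M).dual.Γ} {m : M}

theorem isLineFrame_modular (hx : IsFrame x ξ m) (hy : IsFrame y η m) :
    IsLineFrame (tmul (wedge x) (detForm η)) (𝔸.modularDual (detForm ξ) y) m :=
  hx.isLineFrame_ext.tensor hy.isLineFrame_alt

/-- The connection form of the modular representation in a local frame: the trace of `[a, ·]` minus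
the trace of `[ρ(a), ·]`. -/
def modularForm (x : Fin (Module.finrank ℝ F) → 𝔸.bundle.Γ)
    (ξ : Fin (Module.finrank ℝ F) → 𝔸.bundle.dual.Γ)
    (y : Fin (Module.finrank ℝ E) → (tangent E M).Γ)
    (η : Fin (Module.finrank ℝ E) → (tangent E M).dual.Γ) (a : 𝔸.bundle.Γ) :
    C^∞⟮𝓘(ℝ, E), M; ℝ⟯ :=
  trace x ξ (𝔸.bracket a) - trace y η (lieBr (𝔸.anchorSec a))

/-- The determinant forms are constantly 1 on their own frames, so the derivative term vanishes.
Replacing one frame vector extracts a diagonal coefficient, and the diagonal sums to a trace; the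
Lie derivative of the form on `M` supplies the minus sign. -/
theorem modularValue_frame (hx : IsFrame x ξ m) (hy : IsFrame y η m) (a : 𝔸.bundle.Γ)
    {ν : ((tangent E M).alt (Module.finrank ℝ E)).Γ} (hν : 𝔸.IsLieDeriv a (detForm η) ν) :
    (𝔸.modularValue a x (detForm η) ν).1 m =
      modularForm x ξ y η a m • (tmul (wedge x) (detForm η)).1 m := by
  have he := isLineFrame_modular (𝔸 := 𝔸) hx hy
  have hα : evAlt (detForm ξ) x m = 1 := det_eq_one_of_dual hx.self_of_nhds.1
  have hμ : ∀ᶠ z in 𝓝 m, evAlt (detForm η) y z = 1 := hy.mono fun z hz => det_eq_one_of_dual hz.1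
  have h0 : 𝔸.act a (evAlt (detForm η) y) m = 0 := dirD_eq_zero_of_eventually_const _ hμ
  have h1 : ∀ i, evAlt (detForm ξ) (Function.update x i (𝔸.bracket a (x i))) m =
      pair (ξ i) (𝔸.bracket a (x i)) m := fun i => by
    rw [evAlt_apply, update_val]
    refine (alternating_update hx.self_of_nhds.2 _ i _).trans ?_
    rw [← evAlt_apply, hα, smul_eq_mul, mul_one]
    rfl
  have h2 : ∀ i, evAlt (detForm η) (Function.update y i (lieBr (𝔸.anchorSec a) (y i))) m =
      pair (η i) (lieBr (𝔸.anchorSec a) (y i)) m := fun i => by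
    rw [evAlt_apply, update_val]
    refine (alternating_update hy.self_of_nhds.2 _ i _).trans ?_
    rw [← evAlt_apply, hμ.self_of_nhds, smul_eq_mul, mul_one]
    rfl
  have h3 : at' (𝔸.modularDual (detForm ξ) y) m ((𝔸.modularValue a x (detForm η) ν).1 m) =
      modularForm x ξ y η a m := by
    rw [← pair_apply, pair_modularDual_modularValue, smooth_add_apply, smooth_mul_apply,
      smooth_mul_apply, hα, hμ.self_of_nhds, (𝔸.isLieDeriv_iff a _ ν).1 hν, h0, modularForm,
      smooth_sub_apply, trace, trace]
    simp only [smooth_sum_apply, h1, h2]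
    ring
  rw [he.self_of_nhds.2 ((𝔸.modularValue a x (detForm η) ν).1 m), h3]

/-- Since `[f a, xᵢ] = f [a, xᵢ] - (ρ(xᵢ) f) a`, the first trace acquires the error `-ρ(a) f`. The
trace for vector fields acquires the same error, and the difference of the traces removes it. -/
theorem modularForm_fsmul (hx : IsFrame x ξ m) (hy : IsFrame y η m) (f : C^∞⟮𝓘(ℝ, E), M; ℝ⟯)
    (a : 𝔸.bundle.Γ) :
    modularForm x ξ y η (fsmul f a) m = f m * modularForm x ξ y η a m := by
  have h1 : trace x ξ (𝔸.bracket (fsmul f a)) m =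
      f m * trace x ξ (𝔸.bracket a) m - 𝔸.act a f m := by
    have hact : 𝔸.act a f m = ∑ i, at' (ξ i) m (a.1 m) * 𝔸.act (x i) f m := by
      refine (congrArg (fun v => mfderiv 𝓘(ℝ, E) 𝓘(ℝ, ℝ) f m (𝔸.anchor m v))
        (hx.self_of_nhds.2 (a.1 m))).trans ?_
      refine (congrArg (mfderiv 𝓘(ℝ, E) 𝓘(ℝ, ℝ) f m) (map_sum (𝔸.anchor m) _ _)).trans ?_
      refine (map_sum (mfderiv 𝓘(ℝ, E) 𝓘(ℝ, ℝ) f m) _ _).trans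
        (Finset.sum_congr rfl fun i _ => ?_)
      rw [map_smul]
      exact map_smul (mfderiv 𝓘(ℝ, E) 𝓘(ℝ, ℝ) f m) _ _
    simp only [trace, smooth_sum_apply, pair_apply, bracket_fsmul_left, map_sub, map_smul,
      smul_eq_mul, hact, Finset.sum_sub_distrib, Finset.mul_sum]
    congr 1
    exact Finset.sum_congr rfl fun i _ => mul_comm _ _
  have hX : 𝔸.anchorSec (fsmul f a) = fsmul f (𝔸.anchorSec a) :=
    Γ_ext fun z => map_smul (𝔸.anchor z) (f z) (a.1 z)
  have h2 : trace y η (lieBr (𝔸.anchorSec (fsmul f a))) m =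
      f m * trace y η (lieBr (𝔸.anchorSec a)) m - 𝔸.act a f m := by
    have hact : 𝔸.act a f m = ∑ i, at' (η i) m ((𝔸.anchorSec a).1 m) *
        dirD (E := E) m ((y i).1 m) f := by
      refine (congrArg (mfderiv 𝓘(ℝ, E) 𝓘(ℝ, ℝ) f m)
        (hy.self_of_nhds.2 ((𝔸.anchorSec a).1 m))).trans ?_
      refine (map_sum (mfderiv 𝓘(ℝ, E) 𝓘(ℝ, ℝ) f m) _ _).trans
        (Finset.sum_congr rfl fun i _ => ?_)
      exact map_smul (mfderiv 𝓘(ℝ, E) 𝓘(ℝ, ℝ) f m) _ _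
    rw [hX]
    simp only [trace, smooth_sum_apply, pair_apply, lieBr_fsmul_left, map_sub, map_smul,
      smul_eq_mul, hact, Finset.sum_sub_distrib, Finset.mul_sum]
    congr 1
    exact Finset.sum_congr rfl fun i _ => mul_comm _ _
  rw [modularForm, smooth_sub_apply, h1, h2, modularForm, smooth_sub_apply]
  ring

/-- By the two Jacobi identities, bracketing with `[a, b]` is a commutator of derivations, on `A`
and on `TM` alike; apply `IsDer.trace_commutator` to each. -/
theorem modularForm_bracket (hx : IsFrame x ξ m) (hy : IsFrame y η m) (a b : 𝔸.bundle.Γ) :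
    𝔸.act a (modularForm x ξ y η b) m - 𝔸.act b (modularForm x ξ y η a) m =
      modularForm x ξ y η (𝔸.bracket a b) m := by
  have h1 := (𝔸.isDer_bracket a).trace_commutator (𝔸.isDer_bracket b) hx
  have h2 := (isDer_lieBr (𝔸.anchorSec a)).trace_commutator (isDer_lieBr (𝔸.anchorSec b)) hy
  rw [bracket_commutator] at h1
  rw [lieBr_jacobi, ← anchorSec_bracket] at h2
  simp only [modularForm, map_sub, smooth_sub_apply, h1, h2]
  simp only [act_eq_dirD, anchorSec_val]
  ring

end Frame

theorem isLine_modularBundle (hA : 𝔸.bundle.IsFramed (Module.finrank ℝ F)) :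
    𝔸.modularBundle.IsLine :=
  hA.isLine_ext.tensor tangent_isFramed.isLine_alt

/-- The connection is prescribed by the trace form on frames `x₁ ∧ … ∧ x_r ⊗ det η`. One fact,
`modularValue_of_eventually`, yields both the consistency of overlapping frames and the required
formula on all other decomposable sections. -/
theorem exists_isModular (hA : 𝔸.bundle.IsFramed (Module.finrank ℝ F)) :
    ∃ D, 𝔸.IsModular D := by
  choose x ξ hx using hA.2
  choose y η hy using (tangent_isFramed (E := E) (M := M)).2
  have hval : ∀ m a, ∀ᶠ z in 𝓝 m, (𝔸.modularValue a (x m) (detForm (η m))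
      (𝔸.lieForm a (detForm (η m)))).1 z =
      modularForm (x m) (ξ m) (y m) (η m) a z • (tmul (wedge (x m)) (detForm (η m))).1 z :=
    fun m a => by
      filter_upwards [(hx m).eventually, (hy m).eventually] with z h1 h2
      exact modularValue_frame h1 h2 a (𝔸.isLieDeriv_lieForm a _)
  obtain ⟨D, hD, h⟩ := exists_connection_of_frames (𝔸 := 𝔸) (isLine_modularBundle hA).1
    (fun m => tmul (wedge (x m)) (detForm (η m))) (fun m => 𝔸.modularDual (detForm (ξ m)) (y m))
    (fun m => isLineFrame_modular (hx m) (hy m))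
    (fun m =>
      { toFun := fun a => fsmul (modularForm (x m) (ξ m) (y m) (η m) a)
          (tmul (wedge (x m)) (detForm (η m)))
        map_add' := fun a b => by
          have hX : 𝔸.anchorSec (a + b) = 𝔸.anchorSec a + 𝔸.anchorSec b :=
            Γ_ext fun z => map_add (𝔸.anchor z) (a.1 z) (b.1 z)
          ext z
          simp only [modularForm, trace, map_add, hX, lieBr_add_left, LinearMap.add_apply,
            Finset.sum_add_distrib, fsmul_val, add_val, smooth_sub_apply, smooth_add_apply]
          module
        map_smul' := fun c a => by
          have hX : 𝔸.anchorSec (c • a) = c • 𝔸.anchorSec a :=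
            Γ_ext fun z => map_smul (𝔸.anchor z) c (a.1 z)
          ext z
          simp only [modularForm, trace, map_smul, hX, lieBr_smul_left, LinearMap.smul_apply,
            ← Finset.smul_sum, fsmul_val, smul_val, smooth_sub_apply, smooth_smul_apply,
            RingHom.id_apply]
          module })
    (fun m₀ a => by
      filter_upwards [hval m₀ a, (isLineFrame_modular (𝔸 := 𝔸) (hx m₀) (hy m₀)).eventually]
        with m h1 _
      have hm := isLineFrame_modular (𝔸 := 𝔸) (hx m) (hy m)
      have h2 := modularValue_of_eventually hA a (𝔸.isLieDeriv_lieForm a (detForm (η m)))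
        (𝔸.isLieDeriv_lieForm a (detForm (η m₀))) hm
        (h := pair (𝔸.modularDual (detForm (ξ m)) (y m))
          (tmul (wedge (x m₀)) (detForm (η m₀)))) (hm.mono fun z hz => hz.2 _)
      rw [h1, (hval m a).self_of_nhds] at h2
      exact h2)
    (fun m f a => by
      change modularForm _ _ _ _ (fsmul f a) m • _ = f m • (modularForm _ _ _ _ a m • _)
      rw [modularForm_fsmul (hx m) (hy m), mul_smul])
  refine ⟨D, hD, fun a x' μ ν hν => Γ_ext fun m => ?_⟩
  have hm := isLineFrame_modular (𝔸 := 𝔸) (hx m) (hy m)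
  have h2 := modularValue_of_eventually hA a (𝔸.isLieDeriv_lieForm a (detForm (η m))) hν hm
    (h := pair (𝔸.modularDual (detForm (ξ m)) (y m)) (tmul (wedge x') μ))
    (hm.mono fun z hz => hz.2 _)
  refine Eq.trans ?_ h2.symm
  rw [h, (hval m a).self_of_nhds]
  rfl

/-- The line bundle has local frames of the form `x₁ ∧ … ∧ x_r ⊗ μ`, where the formula leaves no
choice because the Lie derivative of `μ` exists. -/
theorem IsModular.unique (hA : 𝔸.bundle.IsFramed (Module.finrank ℝ F))
    {D D' : 𝔸.Op 𝔸.modularBundle} (h : 𝔸.IsModular D) (h' : 𝔸.IsModular D') : D = D' := by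
  refine h.1.ext_frames h'.1 fun m => ?_
  obtain ⟨x, ξ, hx⟩ := hA.2 m
  obtain ⟨y, η, hy⟩ := (tangent_isFramed (E := E) (M := M)).2 m
  refine ⟨_, _, isLineFrame_modular hx hy, fun a => ?_⟩
  rw [h.2 a x _ _ (𝔸.isLieDeriv_lieForm a _), h'.2 a x _ _ (𝔸.isLieDeriv_lieForm a _)]

theorem isModular_modularRep (hA : 𝔸.bundle.IsFramed (Module.finrank ℝ F)) :
    𝔸.IsModular 𝔸.modularRep := Classical.epsilon_spec (exists_isModular hA)

theorem existsUnique_isModular (hA : 𝔸.bundle.IsFramed (Module.finrank ℝ F)) :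
    ∃! D, 𝔸.IsModular D :=
  ⟨_, isModular_modularRep hA, fun _ h => h.unique hA (isModular_modularRep hA)⟩

/-- In local frames the connection form is the trace form, which is closed. -/
theorem IsModular.isRepresentation (hA : 𝔸.bundle.IsFramed (Module.finrank ℝ F))
    {D : 𝔸.Op 𝔸.modularBundle} (h : 𝔸.IsModular D) : 𝔸.IsRepresentation D := by
  refine h.1.isRepresentation_of_frames fun m => ?_
  obtain ⟨x, ξ, hx⟩ := hA.2 m
  obtain ⟨y, η, hy⟩ := (tangent_isFramed (E := E) (M := M)).2 m
  refine ⟨_, _, modularForm x ξ y η, isLineFrame_modular hx hy, fun a => ?_,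
    modularForm_bracket hx hy⟩
  filter_upwards [hx.eventually, hy.eventually] with z h1 h2
  rw [h.2 a x _ _ (𝔸.isLieDeriv_lieForm a _)]
  exact modularValue_frame h1 h2 a (𝔸.isLieDeriv_lieForm a _)

end LieAlgebroid

end Modular

/-! ### Pull-backs by morphisms -/

section Pullbacks

open SmoothFamily LieAlgebroid

variable {E : Type u} [NormedAddCommGroup E] [NormedSpace ℝ E] [FiniteDimensional ℝ E]
  {F : Type*} [NormedAddCommGroup F] [NormedSpace ℝ F]
  {M : Type*} [TopologicalSpace M] [T2Space M] [ChartedSpace E M] [IsManifold 𝓘(ℝ, E) ∞ M]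
  {A : M → Type v} [TopologicalSpace (TotalSpace F A)] [∀ m, AddCommGroup (A m)]
  [∀ m, Module ℝ (A m)] [∀ m, TopologicalSpace (A m)] [FiberBundle F A] [VectorBundle ℝ F A]
  {E' : Type*} [NormedAddCommGroup E'] [NormedSpace ℝ E'] [FiniteDimensional ℝ E']
  {F' : Type*} [NormedAddCommGroup F'] [NormedSpace ℝ F'] [FiniteDimensional ℝ F']
  {N : Type*} [TopologicalSpace N] [T2Space N] [ChartedSpace E' N] [IsManifold 𝓘(ℝ, E') ∞ N]
  {B : N → Type*} [TopologicalSpace (TotalSpace F' B)] [∀ n, AddCommGroup (B n)]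
  [∀ n, Module ℝ (B n)] [∀ n, TopologicalSpace (B n)] [FiberBundle F' B] [VectorBundle ℝ F' B]
  [ContMDiffVectorBundle ∞ F' B 𝓘(ℝ, E')]

namespace Morphism

variable {𝔸 : LieAlgebroid E F A} {𝔹 : LieAlgebroid E' F' B} (Φ : Morphism 𝔸 𝔹)

/-- A morphism intertwines the actions on functions. -/
theorem act_comp {a : 𝔸.bundle.Γ} {b : 𝔹.bundle.Γ} {m : M}
    (h : Φ.map m (a.1 m) = b.1 (Φ.base m)) (f : C^∞⟮𝓘(ℝ, E'), N; ℝ⟯) :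
    𝔸.act a (f.comp Φ.base) m = 𝔹.act b f (Φ.base m) := by
  -- In degree 0 the chain map condition is compatibility with the anchors.
  have h1 := Φ.chain_map 0 (𝔹.zeroForm f) (𝔹.dForm f) (𝔹.isDifferential_dForm f) (fun _ => a) m
  rw [dValue_zero_form] at h1
  exact h1.symm.trans (congrArg (fun v => (𝔹.dForm f).1 (Φ.base m) fun _ => v) h)

theorem pairing_pullForm {a : 𝔸.bundle.Γ} {b : 𝔹.bundle.Γ} {m : M}
    (h : Φ.map m (a.1 m) = b.1 (Φ.base m)) (β : 𝔹.Form 1) :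
    𝔸.pairing (Φ.pullForm 1 β) a m = 𝔹.pairing β b (Φ.base m) :=
  congrArg (fun v => β.1 (Φ.base m) fun _ => v) h

theorem pullForm_mem_closed {β : 𝔹.Form 1} (hβ : β ∈ 𝔹.closed) : Φ.pullForm 1 β ∈ 𝔸.closed :=
  Φ.chain_map 1 β 0 hβ

variable {V : SmoothFamily.{w} E' N} {U : ∀ n, Set (V.Fib n)} {D : 𝔹.Op V} {β : 𝔹.Form 1}

/-- The candidate has form `Φ^*β`. If `y = f e` with `e` a unit section, then `φ^! y` has
coefficient `f ∘ φ`, whose derivative along `a` is controlled by `act_comp`. -/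
theorem exists_isPullback (hU : IsUnits V U) (hD : 𝔹.IsConnection D) (h : IsUnitForm D U β) :
    ∃ D', Φ.IsPullback D D' := by
  obtain ⟨D', hD', h'⟩ := exists_connection_of_form (𝔸 := 𝔸) (hU.pullback Φ.base) (Φ.pullForm 1 β)
  refine ⟨D', hD', fun a b y m hab => ?_⟩
  obtain ⟨e, ξ, he, hUe⟩ := hU.frame (Φ.base m)
  have hc := Φ.base.contMDiff.continuous.continuousAt (x := m)
  have hy : ∀ᶠ n in 𝓝 (Φ.base m), y.1 n = pair ξ y n • e.1 n := he.mono fun n hn => hn.2 _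
  have hy' : ∀ᶠ x in 𝓝 m, (pullSec Φ.base y).1 x =
      ((pair ξ y).comp Φ.base) x • (pullSec Φ.base e).1 x := hc.eventually hy
  rw [h'.apply hD' (hU.pullback Φ.base) (hc.eventually hUe) hy', h.apply hD hU hUe hy,
    Φ.act_comp hab, Φ.pairing_pullForm hab]
  rfl

variable {Φ} in
/-- The pull-back of a connection has the pulled-back unit form. -/
theorem IsPullback.isUnitForm {n : ℕ} (hB : 𝔹.bundle.IsFramed n) (h : IsUnitForm D U β)
    {D' : 𝔸.Op (V.pullback Φ.base)} (hD' : Φ.IsPullback D D') :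
    IsUnitForm D' (fun m => U (Φ.base m)) (Φ.pullForm 1 β) := by
  intro m
  obtain ⟨e, hUe, he⟩ := h (Φ.base m)
  refine ⟨pullSec Φ.base e, Φ.base.contMDiff.continuous.continuousAt.eventually hUe, fun a => ?_⟩
  obtain ⟨s, η, hs⟩ := hB.2 (Φ.base m)
  -- The defining property needs a section of `B` only through the single vector `Φ(a(m))`.
  obtain ⟨b, hb⟩ := hs.ev_surjective (Φ.map m (a.1 m))
  have hab : Φ.map m (a.1 m) = b.1 (Φ.base m) := hb.symm
  rw [hD'.2 a b e m hab, he, Φ.pairing_pullForm hab]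
  rfl

/-- Every solution has unit form `Φ^*β`, which determines it. -/
theorem existsUnique_isPullback {n : ℕ} (hB : 𝔹.bundle.IsFramed n) (hU : IsUnits V U)
    (hD : 𝔹.IsConnection D) (h : IsUnitForm D U β) : ∃! D', Φ.IsPullback D D' := by
  obtain ⟨D', hD'⟩ := Φ.exists_isPullback hU hD h
  exact ⟨D', hD', fun D₁ h₁ => (h₁.isUnitForm hB h).unique (hD'.isUnitForm hB h)
    h₁.1 hD'.1 (hU.pullback Φ.base)⟩

theorem isPullback_pullbackRep (hU : IsUnits V U) (hD : 𝔹.IsConnection D)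
    (h : IsUnitForm D U β) : Φ.IsPullback D (Φ.pullbackRep D) :=
  Classical.epsilon_spec (Φ.exists_isPullback hU hD h)

end Morphism

end Pullbacks

end LieAlgd

/-! ### The unit form of `D^Φ` and the modular class of the morphism -/

theorem theorem2p3
    {E : Type*} [NormedAddCommGroup E] [NormedSpace ℝ E] [FiniteDimensional ℝ E]
    {F : Type*} [NormedAddCommGroup F] [NormedSpace ℝ F] [FiniteDimensional ℝ F]
    {M : Type*} [TopologicalSpace M] [T2Space M] [SecondCountableTopology M]
    [ChartedSpace E M] [IsManifold 𝓘(ℝ, E) ∞ M]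
    {A : M → Type*} [TopologicalSpace (TotalSpace F A)] [∀ m, AddCommGroup (A m)]
    [∀ m, Module ℝ (A m)] [∀ m, TopologicalSpace (A m)] [FiberBundle F A] [VectorBundle ℝ F A]
    [ContMDiffVectorBundle ∞ F A 𝓘(ℝ, E)]
    {E' : Type*} [NormedAddCommGroup E'] [NormedSpace ℝ E'] [FiniteDimensional ℝ E']
    {F' : Type*} [NormedAddCommGroup F'] [NormedSpace ℝ F'] [FiniteDimensional ℝ F']
    {N : Type*} [TopologicalSpace N] [T2Space N] [SecondCountableTopology N]
    [ChartedSpace E' N] [IsManifold 𝓘(ℝ, E') ∞ N]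
    {B : N → Type*} [TopologicalSpace (TotalSpace F' B)] [∀ n, AddCommGroup (B n)]
    [∀ n, Module ℝ (B n)] [∀ n, TopologicalSpace (B n)] [FiberBundle F' B] [VectorBundle ℝ F' B]
    [ContMDiffVectorBundle ∞ F' B 𝓘(ℝ, E')]
    (𝔸 : LieAlgd.LieAlgebroid E F A) (𝔹 : LieAlgd.LieAlgebroid E' F' B)
    (Φ : LieAlgd.Morphism 𝔸 𝔹) :
    -- each ingredient of `D^Φ` exists and is determined by its defining property
    ((∃! D, 𝔸.IsModular D) ∧ (∃! D, 𝔹.IsModular D) ∧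
      (∃! D, 𝔹.IsDual 𝔹.modularRep D) ∧
      (∃! D, Φ.IsPullback (𝔹.dualRep 𝔹.modularRep) D) ∧
      (∃! D, 𝔸.IsTensor 𝔸.modularRep (Φ.pullbackRep (𝔹.dualRep 𝔹.modularRep)) D)) ∧
    -- (i) `D^Φ` is a representation of `A` on the line bundle `L^φ`
    (Φ.modularBundle.IsVectorBundle 1 ∧ 𝔸.IsRepresentation Φ.modularRep) ∧
    -- the characteristic classes in question exist and are unique
    ((∃! c, 𝔸.IsCharClass 𝔸.modularRep c) ∧ (∃! c, 𝔹.IsCharClass 𝔹.modularRep c) ∧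
      (∃! c, 𝔸.IsCharClass Φ.modularRep c)) ∧
    -- (ii) `Mod Φ` is the characteristic class of `D^Φ`
    Φ.modularClass = 𝔸.charClass Φ.modularRep := by
  have hA : 𝔸.bundle.IsFramed (Module.finrank ℝ F) := LieAlgd.ofBundle_isFramed
  have hB : 𝔹.bundle.IsFramed (Module.finrank ℝ F') := LieAlgd.ofBundle_isFramed
  have hLA := 𝔸.isLine_modularBundle hA
  have hLB := 𝔹.isLine_modularBundle hB
  obtain ⟨U, hU⟩ := hLA.exists_isUnits
  obtain ⟨U', hU'⟩ := hLB.exists_isUnits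
  have hDA := LieAlgd.LieAlgebroid.isModular_modularRep hA
  have hDB := LieAlgd.LieAlgebroid.isModular_modularRep hB
  obtain ⟨α, hα⟩ := hDA.1.exists_unitForm hA hU
  obtain ⟨β, hβ⟩ := hDB.1.exists_unitForm hB hU'
  -- Flatness of `D^A` and `D^B` is converted into closed forms, which can be combined freely; the
  -- converse direction then returns flatness of `D^Φ`.
  have hαc := (hα.isRepresentation_iff hDA.1 hU).1 (hDA.isRepresentation hA)
  have hβc := (hβ.isRepresentation_iff hDB.1 hU').1 (hDB.isRepresentation hB)
  obtain ⟨hD₁, h₁⟩ := LieAlgd.LieAlgebroid.dualRep_spec hU' hDB.1 hβ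
  have hD₂ := Φ.isPullback_pullbackRep hU'.dual hD₁ h₁
  have h₂ := hD₂.isUnitForm hB h₁
  have hU₂ := hU'.dual.pullback Φ.base
  have hD₃ : 𝔸.IsTensor _ _ Φ.modularRep :=
    LieAlgd.LieAlgebroid.isTensor_tensorRep hU hU₂ hDA.1 hD₂.1 hα h₂
  have h₃ := hD₃.isUnitForm hα h₂
  have hU₃ := hU.tensor hU₂
  -- The form of `D^Φ` is `α + Φ^*(-β)`; the chain map property keeps the pull-back closed.
  have hc := 𝔸.closed.add_mem hαc (Φ.pullForm_mem_closed (𝔹.closed.neg_mem hβc))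
  refine ⟨⟨LieAlgd.LieAlgebroid.existsUnique_isModular hA,
    LieAlgd.LieAlgebroid.existsUnique_isModular hB,
    LieAlgd.LieAlgebroid.existsUnique_isDual hU' hDB.1 hβ,
    Φ.existsUnique_isPullback hB hU'.dual hD₁ h₁,
    LieAlgd.LieAlgebroid.existsUnique_isTensor hU hU₂ hDA.1 hD₂.1 hα h₂⟩,
    ⟨(hLA.tensor (hLB.dual.pullback Φ.base)).isVectorBundle,
      (h₃.isRepresentation_iff hD₃.1 hU₃).2 hc⟩,
    ⟨hα.existsUnique_charClass hA hU hDA.1 hαc, hβ.existsUnique_charClass hB hU' hDB.1 hβc,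
      h₃.existsUnique_charClass hA hU₃ hD₃.1 hc⟩, ?_⟩
  rw [h₃.charClass_eq hA hU₃ hD₃.1 hc, LieAlgd.Morphism.modularClass,
    LieAlgd.LieAlgebroid.modularClass, LieAlgd.LieAlgebroid.modularClass,
    hα.charClass_eq hA hU hDA.1 hαc, hβ.charClass_eq hB hU' hDB.1 hβc, LieAlgd.Morphism.pullH1]
  refine (sub_eq_add_neg _ _).trans (congrArg Submodule.Quotient.mk (Subtype.ext ?_))
  -- With all classes represented by unit forms, the identity already holds between cocycles.
  change α + -Φ.pullForm 1 β = α + Φ.pullForm 1 (-β)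
  rw [map_neg]
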